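/- Let $F$ be an algebraically closed field (of arbitrary characteristic), let $n\ge 2$, and let $\Omega=(\omega_a)_{a\ge 0}$ be a sequence of elements of $F$. For a positive integer $m$, the degenerate affine BMW algebra $\widehat{N}_m=\widehat{N}_m(\Omega)$ is the unital associative $F$-algebra with generators $s_i,e_i$ $(1\le i<m)$ and $y_j$ $(1\le j\le m)$ and relations: (1) $s_i^2=1$; (2) $s_is_j=s_js_i$ if $|i-j|>1$; $s_is_{i+1}s_i=s_{i+1}s_is_{i+1}$; $s_iy_j=y_js_i$ if $j\ne i,i+1$; (3) $e_i^2=\omega_0e_i$; (4) $e_1y_1^ae_1=\omega_ae_1$ for $a>0$; (5) $s_ie_j=e_js_i$ and $e_ie_j=e_je_i$ if $|i-j|>1$; $e_iy_j=y_je_i$ if $j\ne i,i+1$; $y_iy_j=y_jy_i$; (6) $e_is_i=e_i=s_ie_i$; $s_ie_{i+1}e_i=s_{i+1}e_i$; $e_ie_{i+1}s_i=e_is_{i+1}$; $e_{i+1}e_is_{i+1}=e_{i+1}s_i$; $s_{i+1}e_ie_{i+1}=s_ie_{i+1}$; $e_{i+1}e_ie_{i+1}=e_{i+1}$; $e_ie_{i+1}e_i=e_i$;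 (7) $s_iy_i-y_{i+1}s_i=e_i-1$ and $y_is_i-s_iy_{i+1}=e_i-1$; (8) $e_i(y_i+y_{i+1})=0$ and $(y_i+y_{i+1})e_i=0$ (each for all indices for which its terms are defined). For $r\ge 1$ and $u_1,\dots,u_r\in F$, the degenerate cyclotomic BMW algebra $N_{m,r}(\Omega;u_1,\dots,u_r)$ is the quotient of $\widehat{N}_m(\Omega)$ by the relation $(y_1-u_1)\cdots(y_1-u_r)=0$. The parameters $\Omega$ and $u_1,\dots,u_r$ are called admissible if $e_1,y_1e_1,\dots,y_1^{r-1}e_1$ are linearly independent over $F$ in $N_{2,r}(\Omega;u_1,\dots,u_r)$. Theorem. Suppose that $e_1\ne 0$ in $\widehat{N}_n(\Omega)$. Then the following are equivalent. (i) The generating function $\sum_{a\ge 0}\omega_at^{-a}\in F((t^{-1}))$ is a rational function, i.e. it is the expansion in $F((t^{-1}))$ of an element of $F(t)$. (ii) There exist $r>0$, $N\ge 0$ and $a_0,\dots,a_{r-1}\in F$ such that $\omega_{r+\ell}+\sum_{j=0}^{r-1}a_j\omega_{j+\ell}=0$ for all $\ell\ge N$. (iii) There exist $r>0$ and $a_0,\dots,a_{r-1}\in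 F$ such that $\omega_{r+\ell}+\sum_{j=0}^{r-1}a_j\omega_{j+\ell}=0$ for all $\ell\ge 0$. (iv) There exist $r>0$ and $u_1,\dots,u_r\in F$ such that the parameters $\Omega$ and $u_1,\dots,u_r$ are admissible. (v) $\widehat{N}_n(\Omega)$ admits a module that is finite dimensional over $F$ and on which $e_1$ acts as a nonzero operator. -/

import Mathlib

universe u

open Polynomial

noncomputable section

/-! ### The degenerate affine BMW algebra -/

/-- The generators `s_i, e_i` (`1 ≤ i < n`) and `y_j` (`1 ≤ j ≤ n`). -/
inductive DegBMWGen (n : ℕ) : Type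
  | s (i : ℕ) (hi : 1 ≤ i ∧ i < n) : DegBMWGen n
  | e (i : ℕ) (hi : 1 ≤ i ∧ i < n) : DegBMWGen n
  | y (j : ℕ) (hj : 1 ≤ j ∧ j ≤ n) : DegBMWGen n

namespace DegBMWFree

variable (S : Type u) [CommRing S] {n : ℕ}

/-- The free generator `s_i`. -/
def s (i : ℕ) (hi : 1 ≤ i ∧ i < n) : FreeAlgebra S (DegBMWGen n) :=
  FreeAlgebra.ι S (DegBMWGen.s i hi)

/-- The free generator `e_i`. -/
def e (i : ℕ) (hi : 1 ≤ i ∧ i < n) : FreeAlgebra S (DegBMWGen n) :=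
  FreeAlgebra.ι S (DegBMWGen.e i hi)

/-- The free generator `y_j`. -/
def y (j : ℕ) (hj : 1 ≤ j ∧ j ≤ n) : FreeAlgebra S (DegBMWGen n) :=
  FreeAlgebra.ι S (DegBMWGen.y j hj)

end DegBMWFree

open DegBMWFree in
/-- The defining relations of the degenerate affine BMW algebra with parameters `ω`. -/
inductive DegAffBMWRel (n : ℕ) {S : Type u} [CommRing S] (ω : ℕ → S) :
    FreeAlgebra S (DegBMWGen n) → FreeAlgebra S (DegBMWGen n) → Prop
  -- involutions
  | involution (i : ℕ) (hi : 1 ≤ i ∧ i < n) :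
      DegAffBMWRel n ω (s S i hi * s S i hi) 1
  -- affine braid relations
  | s_comm_s (i j : ℕ) (hi : 1 ≤ i ∧ i < n) (hj : 1 ≤ j ∧ j < n)
      (hij : 1 < |(i : ℤ) - (j : ℤ)|) :
      DegAffBMWRel n ω (s S i hi * s S j hj) (s S j hj * s S i hi)
  | braid (i : ℕ) (hi : 1 ≤ i ∧ i < n) (hi' : 1 ≤ i + 1 ∧ i + 1 < n) :
      DegAffBMWRel n ω (s S i hi * s S (i + 1) hi' * s S i hi)
        (s S (i + 1) hi' * s S i hi * s S (i + 1) hi')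
  | s_comm_y (i j : ℕ) (hi : 1 ≤ i ∧ i < n) (hj : 1 ≤ j ∧ j ≤ n)
      (h : j ≠ i) (h' : j ≠ i + 1) :
      DegAffBMWRel n ω (s S i hi * y S j hj) (y S j hj * s S i hi)
  -- idempotent relations
  | idempotent (i : ℕ) (hi : 1 ≤ i ∧ i < n) :
      DegAffBMWRel n ω (e S i hi * e S i hi) (ω 0 • e S i hi)
  -- compression relations
  | compression (a : ℕ) (ha : 0 < a) (he : 1 ≤ 1 ∧ 1 < n) (hy : 1 ≤ 1 ∧ 1 ≤ n) :
      DegAffBMWRel n ω (e S 1 he * y S 1 hy ^ a * e S 1 he) (ω a • e S 1 he)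
  -- commutation relations
  | s_comm_e (i j : ℕ) (hi : 1 ≤ i ∧ i < n) (hj : 1 ≤ j ∧ j < n)
      (hij : 1 < |(i : ℤ) - (j : ℤ)|) :
      DegAffBMWRel n ω (s S i hi * e S j hj) (e S j hj * s S i hi)
  | e_comm_e (i j : ℕ) (hi : 1 ≤ i ∧ i < n) (hj : 1 ≤ j ∧ j < n)
      (hij : 1 < |(i : ℤ) - (j : ℤ)|) :
      DegAffBMWRel n ω (e S i hi * e S j hj) (e S j hj * e S i hi)
  | e_comm_y (i j : ℕ) (hi : 1 ≤ i ∧ i < n) (hj : 1 ≤ j ∧ j ≤ n)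
      (h : j ≠ i) (h' : j ≠ i + 1) :
      DegAffBMWRel n ω (e S i hi * y S j hj) (y S j hj * e S i hi)
  | y_comm_y (i j : ℕ) (hi : 1 ≤ i ∧ i ≤ n) (hj : 1 ≤ j ∧ j ≤ n) :
      DegAffBMWRel n ω (y S i hi * y S j hj) (y S j hj * y S i hi)
  -- tangle relations
  | e_mul_s (i : ℕ) (hi : 1 ≤ i ∧ i < n) :
      DegAffBMWRel n ω (e S i hi * s S i hi) (e S i hi)
  | s_mul_e (i : ℕ) (hi : 1 ≤ i ∧ i < n) :
      DegAffBMWRel n ω (s S i hi * e S i hi) (e S i hi)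
  | tangle_see (i : ℕ) (hi : 1 ≤ i ∧ i < n) (hi' : 1 ≤ i + 1 ∧ i + 1 < n) :
      DegAffBMWRel n ω (s S i hi * e S (i + 1) hi' * e S i hi) (s S (i + 1) hi' * e S i hi)
  | tangle_ees (i : ℕ) (hi : 1 ≤ i ∧ i < n) (hi' : 1 ≤ i + 1 ∧ i + 1 < n) :
      DegAffBMWRel n ω (e S i hi * e S (i + 1) hi' * s S i hi) (e S i hi * s S (i + 1) hi')
  | tangle_ees' (i : ℕ) (hi : 1 ≤ i ∧ i < n) (hi' : 1 ≤ i + 1 ∧ i + 1 < n) :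
      DegAffBMWRel n ω (e S (i + 1) hi' * e S i hi * s S (i + 1) hi')
        (e S (i + 1) hi' * s S i hi)
  | tangle_see' (i : ℕ) (hi : 1 ≤ i ∧ i < n) (hi' : 1 ≤ i + 1 ∧ i + 1 < n) :
      DegAffBMWRel n ω (s S (i + 1) hi' * e S i hi * e S (i + 1) hi')
        (s S i hi * e S (i + 1) hi')
  | tangle_eee' (i : ℕ) (hi : 1 ≤ i ∧ i < n) (hi' : 1 ≤ i + 1 ∧ i + 1 < n) :
      DegAffBMWRel n ω (e S (i + 1) hi' * e S i hi * e S (i + 1) hi') (e S (i + 1) hi')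
  | tangle_eee (i : ℕ) (hi : 1 ≤ i ∧ i < n) (hi' : 1 ≤ i + 1 ∧ i + 1 < n) :
      DegAffBMWRel n ω (e S i hi * e S (i + 1) hi' * e S i hi) (e S i hi)
  -- skein relations
  | skein (i : ℕ) (hi : 1 ≤ i ∧ i < n) (hy : 1 ≤ i ∧ i ≤ n) (hy' : 1 ≤ i + 1 ∧ i + 1 ≤ n) :
      DegAffBMWRel n ω (s S i hi * y S i hy - y S (i + 1) hy' * s S i hi) (e S i hi - 1)
  | skein' (i : ℕ) (hi : 1 ≤ i ∧ i < n) (hy : 1 ≤ i ∧ i ≤ n) (hy' : 1 ≤ i + 1 ∧ i + 1 ≤ n) :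
      DegAffBMWRel n ω (y S i hy * s S i hi - s S i hi * y S (i + 1) hy') (e S i hi - 1)
  -- anti-symmetry relations
  | antisymm (i : ℕ) (hi : 1 ≤ i ∧ i < n) (hy : 1 ≤ i ∧ i ≤ n)
      (hy' : 1 ≤ i + 1 ∧ i + 1 ≤ n) :
      DegAffBMWRel n ω (e S i hi * (y S i hy + y S (i + 1) hy')) 0
  | antisymm' (i : ℕ) (hi : 1 ≤ i ∧ i < n) (hy : 1 ≤ i ∧ i ≤ n)
      (hy' : 1 ≤ i + 1 ∧ i + 1 ≤ n) :
      DegAffBMWRel n ω ((y S i hy + y S (i + 1) hy') * e S i hi) 0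

/-- The degenerate affine BMW algebra on `n` strands over `S` with parameters `ω`. -/
def DegAffBMW (n : ℕ) {S : Type u} [CommRing S] (ω : ℕ → S) : Type u :=
  RingQuot (DegAffBMWRel n ω)

namespace DegAffBMW

variable {n : ℕ} {S : Type u} [CommRing S] (ω : ℕ → S)

instance : Ring (DegAffBMW n ω) := inferInstanceAs (Ring (RingQuot (DegAffBMWRel n ω)))

instance : Algebra S (DegAffBMW n ω) :=
  inferInstanceAs (Algebra S (RingQuot (DegAffBMWRel n ω)))

/-- The quotient map from the free algebra. -/
def mk : FreeAlgebra S (DegBMWGen n) →ₐ[S] DegAffBMW n ω :=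
  RingQuot.mkAlgHom S (DegAffBMWRel n ω)

/-- The generator `e_i`. -/
def e (i : ℕ) (hi : 1 ≤ i ∧ i < n) : DegAffBMW n ω := mk ω (DegBMWFree.e S i hi)

/-- The generator `y_j`. -/
def y (j : ℕ) (hj : 1 ≤ j ∧ j ≤ n) : DegAffBMW n ω := mk ω (DegBMWFree.y S j hj)

end DegAffBMW

/-! ### The degenerate cyclotomic BMW algebra and admissibility -/

/-- The cyclotomic relation `(y_1 - u_1) ⋯ (y_1 - u_r) = 0`. -/
inductive DegCycBMWRel (n : ℕ) {S : Type u} [CommRing S] (ω : ℕ → S) {r : ℕ}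
    (u : Fin r → S) : DegAffBMW n ω → DegAffBMW n ω → Prop
  | cyclotomic (hy : 1 ≤ 1 ∧ 1 ≤ n) :
      DegCycBMWRel n ω u
        (List.ofFn fun k : Fin r =>
          DegAffBMW.y ω 1 hy - algebraMap S (DegAffBMW n ω) (u k)).prod 0

/-- The degenerate cyclotomic BMW algebra: the quotient of the degenerate affine one by the
cyclotomic relation. -/
def DegCycBMW (n : ℕ) {S : Type u} [CommRing S] (ω : ℕ → S) {r : ℕ} (u : Fin r → S) :
    Type u :=
  RingQuot (DegCycBMWRel n ω u)

namespace DegCycBMW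

variable {n : ℕ} {S : Type u} [CommRing S] (ω : ℕ → S) {r : ℕ} (u : Fin r → S)

instance : Ring (DegCycBMW n ω u) := inferInstanceAs (Ring (RingQuot (DegCycBMWRel n ω u)))

instance : Algebra S (DegCycBMW n ω u) :=
  inferInstanceAs (Algebra S (RingQuot (DegCycBMWRel n ω u)))

/-- The quotient map from the degenerate affine BMW algebra. -/
def mk : DegAffBMW n ω →ₐ[S] DegCycBMW n ω u :=
  RingQuot.mkAlgHom S (DegCycBMWRel n ω u)

/-- The generator `e_i`. -/
def e (i : ℕ) (hi : 1 ≤ i ∧ i < n) : DegCycBMW n ω u := mk ω u (DegAffBMW.e ω i hi)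

/-- The generator `y_j`. -/
def y (j : ℕ) (hj : 1 ≤ j ∧ j ≤ n) : DegCycBMW n ω u := mk ω u (DegAffBMW.y ω j hj)

end DegCycBMW

/-- The parameters `ω` and `u_1, …, u_r` are admissible: `e_1, y_1 e_1, …, y_1 ^ (r-1) e_1` are
linearly independent over `S` in the degenerate cyclotomic BMW algebra on two strands. -/
def DegBMWAdmissible {S : Type u} [CommRing S] (ω : ℕ → S) {r : ℕ} (u : Fin r → S) : Prop :=
  LinearIndependent S fun k : Fin r =>
    DegCycBMW.y (n := 2) ω u 1 (by decide) ^ (k : ℕ) *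
      DegCycBMW.e (n := 2) ω u 1 (by decide)

/-- The degenerate affine BMW algebra on `n` strands admits a finite-dimensional module on which
`e_1` is nonzero. -/
def DegAffBMWHasModule {F : Type u} [Field F] (n : ℕ) (hn : 2 ≤ n) (ω : ℕ → F) : Prop :=
  ∃ (M : Type u) (_ : AddCommGroup M) (_ : Module F M) (_ : Module (DegAffBMW n ω) M)
    (_ : IsScalarTower F (DegAffBMW n ω) M),
    FiniteDimensional F M ∧ ∃ m : M, DegAffBMW.e ω 1 ⟨le_rfl, hn⟩ • m ≠ 0

/-! ### Rational functions expanded at infinity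

`LaurentSeries F` is used here as the field `F((t⁻¹))` of Laurent series in `t⁻¹`, so that the
series with coefficients `c k` stands for the sum of the `c k t ^ (-k)`. -/

/-- The element `t` of `F((t⁻¹))`. -/
def tAtInfinity (F : Type u) [Field F] : LaurentSeries F := HahnSeries.single (-1 : ℤ) (1 : F)

/-- The evaluation `F[t] → F((t⁻¹))` sending `t` to `t` and fixing the constants. -/
def polyAtInfinity (F : Type u) [Field F] : F[X] →+* LaurentSeries F :=
  Polynomial.eval₂RingHom (HahnSeries.C : F →+* LaurentSeries F) (tAtInfinity F)

theorem polyAtInfinity_coeff {F : Type u} [Field F] (p : F[X]) (k : ℕ) :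
    (polyAtInfinity F p).coeff (-(k : ℤ)) = p.coeff k := by
  induction p using Polynomial.induction_on' with
  | add p q hp hq => simp [hp, hq]
  | monomial m a =>
    rw [polyAtInfinity, Polynomial.coe_eval₂RingHom, Polynomial.eval₂_monomial, tAtInfinity,
      HahnSeries.single_pow, HahnSeries.C_apply, HahnSeries.single_mul_single,
      Polynomial.coeff_monomial]
    simp only [HahnSeries.coeff_single, one_pow, mul_one, nsmul_eq_mul]
    by_cases hm : m = k
    · subst hm; simp
    · rw [if_neg hm, if_neg (by omega)]

theorem polyAtInfinity_injective (F : Type u) [Field F] :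
    Function.Injective (polyAtInfinity F) := by
  intro p q h
  ext k
  rw [← polyAtInfinity_coeff, ← polyAtInfinity_coeff]
  exact congrArg (fun f : LaurentSeries F => f.coeff (-(k : ℤ))) h

/-- The embedding of `F(t)` into `F((t⁻¹))` sending `t` to `t` and fixing the constants. -/
def expandAtInfinity (F : Type u) [Field F] : RatFunc F →+* LaurentSeries F :=
  RatFunc.liftRingHom (polyAtInfinity F)
    (nonZeroDivisors_le_comap_nonZeroDivisors_of_injective _ (polyAtInfinity_injective F))

/-- The generating function `∑_{a ≥ 0} ω_a t ^ (-a)`, an element of `F((t⁻¹))`. -/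
def genFunAtInfinity {F : Type u} [Field F] (ω : ℕ → F) : LaurentSeries F :=
  HahnSeries.ofPowerSeries ℤ F (PowerSeries.mk ω)

end

/-!
The sequence `ω` is regarded as the linear functional `moment ω` on polynomials in one variable,
with moments `ω a`. The conditions on generating functions and recurrences all say that its
annihilator, the ideal of the polynomials `g` with `moment ω (f * g) = 0` for all `f`, is not zero.
A recurrence that holds eventually gives one that holds from the start after multiplication by a
power of `X`. Since `e_1 f(y_1) e_1 = moment ω f • e_1`, a polynomial that annihilates `y_1` in a
representation where `e_1 ≠ 0` lies in this ideal. This applies to the cyclotomic relation and to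
the minimal polynomial of `y_1` on a finite-dimensional module.

For the converse, suppose that the annihilator is not zero, and let `B` be its monic generator. In
the algebra, `s_1 f(y_1) e_1 = (S f)(y_1) e_1` and `e_1 f(y_1) s_1 = e_1 (S f)(y_1)` for an
explicit operator `S` on polynomials (`DegBMWPoly.twist`), so that `e_1 ≠ 0` makes `S` symmetric
for the form `moment ω (f * g)` (`TwoStrandRel.moment_symm`). Hence `S` preserves the annihilator,
`B` is an eigenvector of `S`, and this is a formula for the generating function of `ω` in terms of
the roots `u_1, …, u_r` of `B` (`DegBMWPoly.divDiff_eq_numer_sub`).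

It remains to find a finite-dimensional representation in which `e_1 ≠ 0`, `y_1` is killed by `B`,
and the moments of `y_1` are given by this formula. It is modelled on the operators built from the
split Casimir tensor of an orthogonal Lie algebra `𝔤`, acting on the coinvariants of `𝔤` in
`M ⊗ M' ⊗ V ⊗ ⋯ ⊗ V`, where `V` is the natural module and `M`, `M'` are scalar parabolic Verma
modules for two opposite parabolic subalgebras. As these meet in a Levi subalgebra, under which `V`
is a sum of parts `V_a`, with `V_a` dual to `V_{r + 1 - a}`, these coinvariants are those of the
Levi subalgebra in `V ⊗ ⋯ ⊗ V`. This space is spanned by pairings of the tensor factors, so it can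
be written down without Lie theory and for arbitrary values of the dimensions of the `V_a`: it is
spanned by perfect matchings whose arcs are coloured (`ColMatching`), and it carries the coloured
Brauer operators `ColoredBrauer`. The operator `y_1` becomes `ColoredBrauer.jm`, which is
triangular in the colour at its position, with eigenvalues `u_a`; hence the cyclotomic relation
holds (`ColoredBrauer.aeval_jm_prod`). The skein relations define the other `y_j`, and the
relations that need work are `y_1 y_2 = y_2 y_1` (`ColoredBrauer.commute_jm`, a consequence of the
infinitesimal braid relations), `e_1 (y_1 + y_2) = 0 = (y_1 + y_2) e_1`, which force the dimension
of `V_a` to be `δ_a = u_a + u_{r + 1 - a}`, increased by `1` if `V_a` is self-dual, and the values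
of `e_1 y_1 ^ k e_1`. The latter are computed by a triangular recursion (`jmMoment`), whose
generating function, found by telescoping from the inside outwards, depends on the `u_a` as
required (`jmMoment_eq`).

The same representation, for two strands, shows that `e_1 ≠ 0` in the cyclotomic algebra. Linear
independence of the elements `y_1 ^ k e_1` for `k < r` then follows from the minimality of `B`. The
case `B = 1`, that is `ω = 0`, is exceptional: there `u = (0, 0)` is used, and `y_1 e_1 ≠ 0`
follows from the relations.
-/

noncomputable section

/-! ### Coloured matchings -/

/-- A perfect matching of `I` given by a fixed-point-free involution `f`, with a colour `c i` at
each point; the colours at the two ends of an arc are exchanged by `Fin.rev`. -/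
@[ext]
structure ColMatching (I : Type) (r : ℕ) where
  /-- The point joined to a given point. -/
  f : I → I
  /-- The colour of a point. -/
  c : I → Fin r
  f_f : ∀ x, f (f x) = x
  f_ne : ∀ x, f x ≠ x
  c_f : ∀ x, c (f x) = (c x).rev

namespace ColMatching

variable {I : Type} {r : ℕ}

instance [Finite I] : Finite (ColMatching I r) :=
  Finite.of_injective (fun d : ColMatching I r => (d.f, d.c)) fun d d' h => by
    cases d; cases d'; simp_all

/-- Transport of a coloured matching along a permutation of the points. -/
def perm (g : Equiv.Perm I) (d : ColMatching I r) : ColMatching I r where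
  f x := g (d.f (g⁻¹ x))
  c x := d.c (g⁻¹ x)
  f_f x := by simp [d.f_f]
  f_ne x h := d.f_ne (g⁻¹ x) (by rw [← Equiv.Perm.eq_inv_iff_eq] at h; exact h)
  c_f x := by simp [d.c_f]

variable [DecidableEq I]

/-- The matching obtained by joining `i` with `j`, and the former partners of `i` and `j` with each
other; the new arc from `i` to `j` gets the colour `b` at `i`. The colours at `i` and `j` have to
match for the former partners to be joined consistently. -/
def join (d : ColMatching I r) (i j : I) (h : i ≠ j ∧ d.c j = (d.c i).rev) (b : Fin r) :
    ColMatching I r where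
  f x := if x = i then j else if x = j then i else if x = d.f i then d.f j
    else if x = d.f j then d.f i else d.f x
  c x := if x = i then b else if x = j then b.rev else d.c x
  f_f x := by
    have := d.f_f; have := d.f_ne
    grind
  f_ne x := by
    have := d.f_f; have := d.f_ne
    grind
  c_f x := by
    have := d.f_f; have := d.f_ne; have := d.c_f; have := @Fin.rev_rev r
    grind

end ColMatching

/-! ### Coloured Brauer operators -/

/-- Operators on `n`-fold tensors over a space with a symmetric form and a decomposition into
parts `V_a`, the parts `V_a` and `V_{rev a}` being dual to each other: permutations `σ g` of the
tensor factors, the contraction `e i j` of the factors `i` and `j` followed by the insertion of the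
invariant tensor, and the projection `P i a` of the factor `i` to `V_a`. The scalar `δ a` plays
the role of the dimension of `V_a`. -/
structure ColoredBrauer (I : Type) [DecidableEq I] {F : Type u} [Field F] (A : Type u) [Ring A]
    [Algebra F A] {r : ℕ} (δ : Fin r → F) where
  /-- The permutation of tensor factors. -/
  σ : Equiv.Perm I →* A
  /-- The contraction and insertion at two tensor factors. -/
  e : I → I → A
  /-- The projection to a part at a tensor factor. -/
  P : I → Fin r → A
  σ_e : ∀ g i j, σ g * e i j = e (g i) (g j) * σ g
  σ_P : ∀ g i a, σ g * P i a = P (g i) a * σ g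
  P_mul : ∀ i a b, P i a * P i b = if a = b then P i a else 0
  P_sum : ∀ i, ∑ a, P i a = 1
  P_comm : ∀ i j a b, P i a * P j b = P j b * P i a
  e_symm : ∀ i j, i ≠ j → e i j = e j i
  s_e : ∀ i j, i ≠ j → σ (Equiv.swap i j) * e i j = e i j
  P_e_comm : ∀ i j l a, l ≠ i → l ≠ j → P l a * e i j = e i j * P l a
  P_e : ∀ i j a, i ≠ j → P i a * e i j = P j a.rev * e i j
  e_P : ∀ i j a, i ≠ j → e i j * P i a = e i j * P j a.rev
  e_P_e : ∀ i j a, i ≠ j → e i j * P i a * e i j = δ a • e i j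
  e_e : ∀ i j k, i ≠ j → j ≠ k → i ≠ k → e i j * e j k = e i j * σ (Equiv.swap i k)
  e_e' : ∀ i j k, i ≠ j → j ≠ k → i ≠ k → e j k * e i j = σ (Equiv.swap i k) * e i j
  e_comm : ∀ i j k l, i ≠ j → k ≠ l → i ≠ k → i ≠ l → j ≠ k → j ≠ l →
    e i j * e k l = e k l * e i j

namespace ColMatching

variable {I : Type} {r : ℕ} {F : Type u} [Field F]

/-- The operator on the span of coloured matchings given by a permutation of the points. -/
def permEnd (F : Type u) [Field F] (g : Equiv.Perm I) :
    Module.End F (ColMatching I r →₀ F) :=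
  Finsupp.lmapDomain F F (perm g)

/-- The projection to the span of the coloured matchings with colour `a` at `i`. -/
def projEnd (F : Type u) [Field F] (i : I) (a : Fin r) :
    Module.End F (ColMatching I r →₀ F) :=
  Finsupp.linearCombination F fun d => if d.c i = a then Finsupp.single d 1 else 0

@[simp]
theorem permEnd_single (g : Equiv.Perm I) (d : ColMatching I r) :
    permEnd F g (Finsupp.single d 1) = Finsupp.single (d.perm g) 1 := by
  simp [permEnd]

@[simp]
theorem projEnd_single (i : I) (a : Fin r) (d : ColMatching I r) :
    projEnd F i a (Finsupp.single d 1) = if d.c i = a then Finsupp.single d 1 else 0 := by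
  simp [projEnd]

theorem end_ext {f g : Module.End F (ColMatching I r →₀ F)}
    (h : ∀ d, f (Finsupp.single d 1) = g (Finsupp.single d 1)) : f = g :=
  Finsupp.lhom_ext' fun d => LinearMap.ext_ring (h d)

variable [DecidableEq I]

/-- The operator that joins `i` and `j` in all colours; a closed loop of colour `a` is replaced by
the scalar `δ a`. -/
def joinEnd (δ : Fin r → F) (i j : I) : Module.End F (ColMatching I r →₀ F) :=
  Finsupp.linearCombination F fun d =>
    if h : i ≠ j ∧ d.c j = (d.c i).rev then
      (if d.f i = j then δ (d.c i) else 1) • ∑ b, Finsupp.single (d.join i j h b) 1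
    else 0

theorem joinEnd_single (δ : Fin r → F) (i j : I) (d : ColMatching I r) :
    joinEnd δ i j (Finsupp.single d 1) = if h : i ≠ j ∧ d.c j = (d.c i).rev then
      (if d.f i = j then δ (d.c i) else 1) • ∑ b, Finsupp.single (d.join i j h b) 1
    else 0 := by
  simp [joinEnd]

theorem joinEnd_single_pos (δ : Fin r → F) {i j : I} {d : ColMatching I r}
    (h : i ≠ j ∧ d.c j = (d.c i).rev) :
    joinEnd δ i j (Finsupp.single d 1) =
      (if d.f i = j then δ (d.c i) else 1) • ∑ b, Finsupp.single (d.join i j h b) 1 := by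
  rw [joinEnd_single, dif_pos h]

theorem joinEnd_single_neg (δ : Fin r → F) {i j : I} {d : ColMatching I r}
    (h : ¬ (i ≠ j ∧ d.c j = (d.c i).rev)) :
    joinEnd δ i j (Finsupp.single d 1) = 0 := by
  rw [joinEnd_single, dif_neg h]

theorem permEnd_joinEnd (δ : Fin r → F) (g : Equiv.Perm I) (i j : I) :
    permEnd F g * joinEnd δ i j = joinEnd δ (g i) (g j) * permEnd F g := by
  refine end_ext fun d => ?_
  simp only [Module.End.mul_apply, permEnd_single]
  by_cases h : i ≠ j ∧ d.c j = (d.c i).rev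
  · have h' : g i ≠ g j ∧ (d.perm g).c (g j) = ((d.perm g).c (g i)).rev := by
      simpa [perm] using h
    rw [joinEnd_single_pos δ h, joinEnd_single_pos δ h', map_smul, map_sum]
    congr 1
    · simp [perm]
    · refine Finset.sum_congr rfl fun b _ => ?_
      rw [permEnd_single]
      congr 1
      ext x
      · simp only [perm, join, Equiv.Perm.inv_eq_iff_eq]
        simp only [Equiv.Perm.inv_def, Equiv.symm_apply_apply]
        split_ifs <;> rfl
      · simp only [perm, join, Equiv.Perm.inv_eq_iff_eq]
  · have h' : ¬ (g i ≠ g j ∧ (d.perm g).c (g j) = ((d.perm g).c (g i)).rev) := by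
      simpa [perm] using h
    rw [joinEnd_single_neg δ h, joinEnd_single_neg δ h', map_zero]

theorem joinEnd_symm {δ : Fin r → F} (hδ : ∀ a, δ a.rev = δ a) (i j : I) (hij : i ≠ j) :
    joinEnd δ i j = joinEnd δ j i := by
  refine end_ext fun d => ?_
  by_cases h : d.c j = (d.c i).rev
  · have h' : d.c i = (d.c j).rev := by rw [h, Fin.rev_rev]
    rw [joinEnd_single_pos δ ⟨hij, h⟩, joinEnd_single_pos δ ⟨hij.symm, h'⟩]
    congr 1
    · have := d.f_f; grind
    · rw [← Equiv.sum_comp Fin.revPerm]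
      refine Finset.sum_congr rfl fun b _ => ?_
      congr 1
      have := d.f_f; have := d.f_ne; have := d.c_f; have := @Fin.rev_rev r
      ext x
      · simp only [join]; grind
      · simp only [join, Fin.revPerm_apply]; grind
  · have h' : ¬ d.c i = (d.c j).rev := fun h' => h (by rw [h', Fin.rev_rev])
    rw [joinEnd_single_neg δ (by tauto), joinEnd_single_neg δ (by tauto)]

theorem perm_swap_joinEnd (δ : Fin r → F) (i j : I) (hij : i ≠ j) :
    permEnd F (Equiv.swap i j) * joinEnd δ i j = joinEnd δ i j := by
  refine end_ext fun d => ?_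
  rw [Module.End.mul_apply]
  by_cases h : i ≠ j ∧ d.c j = (d.c i).rev
  · rw [joinEnd_single_pos δ h, map_smul, map_sum, ← Equiv.sum_comp Fin.revPerm]
    congr 1
    refine Finset.sum_congr rfl fun b _ => ?_
    rw [permEnd_single]
    congr 1
    have := d.f_f; have := d.f_ne; have := @Fin.rev_rev r
    ext x
    · simp only [join, perm, Equiv.swap_inv, Equiv.swap_apply_def]; grind
    · simp only [join, perm, Equiv.swap_inv, Equiv.swap_apply_def, Fin.revPerm_apply]; grind
  · rw [joinEnd_single_neg δ h, map_zero]

theorem projEnd_joinEnd_comm (δ : Fin r → F) (i j l : I) (a : Fin r) (hi : l ≠ i) (hj : l ≠ j) :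
    projEnd F l a * joinEnd δ i j = joinEnd δ i j * projEnd F l a := by
  refine end_ext fun d => ?_
  simp only [Module.End.mul_apply, projEnd_single]
  by_cases h : i ≠ j ∧ d.c j = (d.c i).rev
  · rw [joinEnd_single_pos δ h, map_smul, map_sum]
    have key : ∀ b, (d.join i j h b).c l = d.c l := fun b => by simp [join, hi, hj]
    simp only [projEnd_single, key]
    split_ifs <;> simp [joinEnd_single_pos δ h, *]
  · rw [joinEnd_single_neg δ h, map_zero]
    split_ifs
    · rw [joinEnd_single_neg δ h]
    · rw [map_zero]

theorem projEnd_mul_joinEnd (δ : Fin r → F) (i j : I) (a : Fin r) (hij : i ≠ j) :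
    projEnd F i a * joinEnd δ i j = projEnd F j a.rev * joinEnd δ i j := by
  refine end_ext fun d => ?_
  simp only [Module.End.mul_apply]
  by_cases h : i ≠ j ∧ d.c j = (d.c i).rev
  · rw [joinEnd_single_pos δ h, map_smul, map_smul, map_sum, map_sum]
    simp [join, hij.symm, Fin.rev_inj]
  · rw [joinEnd_single_neg δ h, map_zero, map_zero]

theorem joinEnd_mul_projEnd (δ : Fin r → F) (i j : I) (a : Fin r) :
    joinEnd δ i j * projEnd F i a = joinEnd δ i j * projEnd F j a.rev := by
  refine end_ext fun d => ?_
  simp only [Module.End.mul_apply, projEnd_single]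
  by_cases h : i ≠ j ∧ d.c j = (d.c i).rev
  · simp [h.2, Fin.rev_inj]
  · split_ifs <;> simp [joinEnd_single_neg δ h]

theorem joinEnd_projEnd_joinEnd (δ : Fin r → F) (i j : I) (a : Fin r) (hij : i ≠ j) :
    joinEnd δ i j * projEnd F i a * joinEnd δ i j = δ a • joinEnd δ i j := by
  refine end_ext fun d => ?_
  simp only [Module.End.mul_apply, LinearMap.smul_apply]
  by_cases h : i ≠ j ∧ d.c j = (d.c i).rev
  · have h' : i ≠ j ∧ (d.join i j h a).c j = ((d.join i j h a).c i).rev := by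
      simp [join, hij, hij.symm]
    have key : ∑ b, projEnd F i a (Finsupp.single (d.join i j h b) 1) =
        Finsupp.single (d.join i j h a) 1 := by
      simp only [projEnd_single]
      simp [join]
    rw [joinEnd_single_pos δ h, map_smul, map_sum, key, map_smul, joinEnd_single_pos δ h',
      smul_comm]
    congr 2
    · simp [join]
    · refine Finset.sum_congr rfl fun b _ => ?_
      congr 1
      have := d.f_f; have := d.f_ne
      ext x
      · simp only [join]; grind
      · simp only [join]; grind
  · simp [joinEnd_single_neg δ h]

theorem joinEnd_mul_joinEnd {δ : Fin r → F} (hδ : ∀ a, δ a.rev = δ a) (i j k : I) (hij : i ≠ j)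
    (hjk : j ≠ k) (hik : i ≠ k) :
    joinEnd δ i j * joinEnd δ j k = joinEnd δ i j * permEnd F (Equiv.swap i k) := by
  refine end_ext fun d => ?_
  simp only [Module.End.mul_apply, permEnd_single]
  have hs : (d.perm (Equiv.swap i k)).c j = d.c j := by
    simp [perm, Equiv.swap_apply_of_ne_of_ne hij.symm hjk]
  have hs' : (d.perm (Equiv.swap i k)).c i = d.c k := by simp [perm]
  by_cases h : d.c k = (d.c j).rev
  · have h1 : i ≠ j ∧ (d.perm (Equiv.swap i k)).c j = ((d.perm (Equiv.swap i k)).c i).rev := by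
      rw [hs, hs', h, Fin.rev_rev]; exact ⟨hij, rfl⟩
    have h2 : i ≠ j ∧ (d.join j k ⟨hjk, h⟩ (d.c i).rev).c j =
        ((d.join j k ⟨hjk, h⟩ (d.c i).rev).c i).rev := by
      simp [join, hij, hik]
    have h3 : (d.join j k ⟨hjk, h⟩ (d.c i).rev).f i ≠ j := by
      have := d.f_f; have := d.f_ne
      simp only [join]; grind
    rw [joinEnd_single_pos δ ⟨hjk, h⟩, joinEnd_single_pos δ h1, map_smul, map_sum,
      Finset.sum_eq_single (d.c i).rev, joinEnd_single_pos δ h2, if_neg h3, one_smul]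
    · congr 1
      · simp only [perm, Equiv.swap_inv, Equiv.swap_apply_def]
        have := d.f_f; have := d.f_ne
        grind
      · refine Finset.sum_congr rfl fun b _ => ?_
        congr 1
        have := d.f_f; have := d.f_ne; have := d.c_f; have := @Fin.rev_rev r
        ext x
        · simp only [join, perm, Equiv.swap_inv, Equiv.swap_apply_def]
          grind (splits := 30)
        · simp only [join, perm, Equiv.swap_inv, Equiv.swap_apply_def]; grind
    · intro b _ hb
      refine joinEnd_single_neg δ fun h' => hb ?_
      simpa [join, hij, hik] using h'.2
    · simp
  · rw [joinEnd_single_neg δ (fun h' => h h'.2), joinEnd_single_neg, map_zero]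
    rw [hs, hs']
    rintro ⟨-, h'⟩
    exact h (by rw [h', Fin.rev_rev])

theorem joinEnd_mul_joinEnd' (δ : Fin r → F) (i j k : I) (hij : i ≠ j)
    (hjk : j ≠ k) (hik : i ≠ k) :
    joinEnd δ j k * joinEnd δ i j = permEnd F (Equiv.swap i k) * joinEnd δ i j := by
  refine end_ext fun d => ?_
  simp only [Module.End.mul_apply]
  by_cases h : i ≠ j ∧ d.c j = (d.c i).rev
  · have h2 : j ≠ k ∧ (d.join i j h (d.c k)).c k = ((d.join i j h (d.c k)).c j).rev := by
      simp [join, hij.symm, hik.symm, hjk, hjk.symm]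
    have h3 : (d.join i j h (d.c k)).f j ≠ k := by
      simp [join, hij.symm, hik]
    rw [joinEnd_single_pos δ h, map_smul, map_smul, map_sum, map_sum,
      Finset.sum_eq_single (d.c k), joinEnd_single_pos δ h2, if_neg h3, one_smul]
    · congr 1
      rw [← Equiv.sum_comp Fin.revPerm]
      refine Finset.sum_congr rfl fun b _ => ?_
      rw [permEnd_single]
      congr 1
      have := d.f_f; have := d.f_ne; have := d.c_f; have := @Fin.rev_rev r
      ext x
      · simp only [join, perm, Equiv.swap_inv, Equiv.swap_apply_def]
        grind (splits := 40)
      · simp only [join, perm, Equiv.swap_inv, Equiv.swap_apply_def, Fin.revPerm_apply]; grind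
    · intro b _ hb
      refine joinEnd_single_neg δ fun h' => hb ?_
      have := h'.2
      simp only [join] at this
      grind [Fin.rev_rev]
    · simp
  · rw [joinEnd_single_neg δ h, map_zero, map_zero]

theorem joinEnd_comm {δ : Fin r → F} (hδ : ∀ a, δ a.rev = δ a) (i j k l : I) (hij : i ≠ j)
    (hkl : k ≠ l) (hik : i ≠ k) (hil : i ≠ l) (hjk : j ≠ k) (hjl : j ≠ l) :
    joinEnd δ i j * joinEnd δ k l = joinEnd δ k l * joinEnd δ i j := by
  refine end_ext fun d => ?_
  simp only [Module.End.mul_apply]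
  by_cases h : i ≠ j ∧ d.c j = (d.c i).rev <;> by_cases h' : k ≠ l ∧ d.c l = (d.c k).rev
  · have h1 : ∀ b, i ≠ j ∧ (d.join k l h' b).c j = ((d.join k l h' b).c i).rev := by
      intro b; simp only [join]; grind
    have h2 : ∀ b, k ≠ l ∧ (d.join i j h b).c l = ((d.join i j h b).c k).rev := by
      intro b; simp only [join]; grind
    rw [joinEnd_single_pos δ h, joinEnd_single_pos δ h', map_smul, map_smul, map_sum, map_sum]
    simp only [joinEnd_single_pos δ (h1 _), joinEnd_single_pos δ (h2 _), Finset.smul_sum]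
    rw [Finset.sum_comm]
    refine Finset.sum_congr rfl fun b _ => Finset.sum_congr rfl fun a _ => ?_
    rw [smul_smul, smul_smul]
    have := d.f_f; have := d.f_ne; have := d.c_f; have := @Fin.rev_rev r
    congr 1
    · simp only [join]
      grind (splits := 40)
    · congr 1
      ext x
      · simp only [join]
        grind (splits := 40)
      · simp only [join]
        grind
  · rw [joinEnd_single_neg δ h', joinEnd_single_pos δ h, map_zero, map_smul, map_sum,
      Finset.sum_eq_zero, smul_zero]
    intro b _
    refine joinEnd_single_neg δ ?_
    simp only [join]; grind
  · rw [joinEnd_single_neg δ h, joinEnd_single_pos δ h', map_zero, map_smul, map_sum,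
      Finset.sum_eq_zero, smul_zero]
    intro b _
    refine joinEnd_single_neg δ ?_
    simp only [join]; grind
  · rw [joinEnd_single_neg δ h, joinEnd_single_neg δ h', map_zero, map_zero]

/-- The span of the coloured matchings is the space of invariant tensors of a space whose parts
`V_a` have the formal dimensions `δ a`. -/
def coloredBrauer {δ : Fin r → F} (hδ : ∀ a, δ a.rev = δ a) :
    ColoredBrauer I (Module.End F (ColMatching I r →₀ F)) δ where
  σ :=
    { toFun := permEnd F
      map_one' := end_ext fun d => by simp; rfl
      map_mul' := fun g h => end_ext fun d => by simp; rfl }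
  e := joinEnd δ
  P := projEnd F
  σ_e := permEnd_joinEnd δ
  σ_P g i a := end_ext fun d => by
    simp only [Module.End.mul_apply, projEnd_single]
    split_ifs <;> simp_all [perm]
  P_mul i a b := end_ext fun d => by
    rw [Module.End.mul_apply, projEnd_single]
    by_cases h : d.c i = b
    · by_cases hab : a = b
      · rw [if_pos h, if_pos hab]
      · rw [if_pos h, if_neg hab, projEnd_single, if_neg fun h' => hab (h'.symm.trans h)]
        rfl
    · by_cases hab : a = b
      · rw [if_neg h, if_pos hab, projEnd_single, hab, if_neg h, map_zero]
      · rw [if_neg h, if_neg hab, map_zero]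
        rfl
  P_sum i := end_ext fun d => by simp [LinearMap.sum_apply]
  P_comm i j a b := end_ext fun d => by
    simp only [Module.End.mul_apply, projEnd_single]
    by_cases ha : d.c i = a <;> by_cases hb : d.c j = b <;> simp [ha, hb]
  e_symm := joinEnd_symm hδ
  s_e := perm_swap_joinEnd δ
  P_e_comm := projEnd_joinEnd_comm δ
  P_e := projEnd_mul_joinEnd δ
  e_P i j a _ := joinEnd_mul_projEnd δ i j a
  e_P_e := joinEnd_projEnd_joinEnd δ
  e_e := joinEnd_mul_joinEnd hδ
  e_e' := joinEnd_mul_joinEnd' δ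
  e_comm := joinEnd_comm hδ

/-- The matching of two copies of a set `J`, with prescribed colours on the first copy. -/
def double {J : Type} (γ : J → Fin r) : ColMatching (J × Bool) r where
  f x := (x.1, !x.2)
  c x := if x.2 then (γ x.1).rev else γ x.1
  f_f x := by simp
  f_ne x := by simp [Prod.ext_iff]
  c_f x := by cases x.2 <;> simp

/-- Two points of the first copy can be joined without closing a loop; hence no colour component of
the corresponding operator vanishes, whatever the loop parameters are. -/
theorem projEnd_mul_joinEnd_ne_zero {J : Type} [DecidableEq J] (δ : Fin r → F) {i j : J}
    (hij : i ≠ j) (a : Fin r) :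
    projEnd F (i, false) a * joinEnd δ (i, false) (j, false) ≠ 0 := by
  intro h0
  let d : ColMatching (J × Bool) r := double fun x => if x = i then a else a.rev
  have h : ((i, false) : J × Bool) ≠ (j, false) ∧ d.c (j, false) = (d.c (i, false)).rev := by
    simp [d, double, hij, hij.symm]
  have h1 := LinearMap.congr_fun h0 (Finsupp.single d 1)
  rw [Module.End.mul_apply, joinEnd_single_pos δ h, if_neg (by simp [d, double]), one_smul,
    map_sum, Finset.sum_eq_single a] at h1
  · simp [join] at h1
  · intro b _ hb
    simp [join, hb]
  · simp

end ColMatching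

namespace ColoredBrauer

variable {I : Type} [DecidableEq I] {F : Type u} [Field F] {A : Type u} [Ring A] [Algebra F A]
  {r : ℕ} {δ : Fin r → F} (M : ColoredBrauer I A δ)

/-- The transposition of two tensor factors. -/
def s (i j : I) : A := M.σ (Equiv.swap i j)

/-- The operator by which the invariant form of an orthogonal Lie algebra acts on two tensor
factors. -/
def t (i j : I) : A := M.s i j - M.e i j

/-- Multiplication by the scalar `u a` on the part `a` of the factor `i`. -/
def D (u : Fin r → F) (i : I) : A := ∑ a, u a • M.P i a

/-- The component of an operator consisting of the parts that change the colour of the factor `i`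
from `a` to `b`, for the pairs with `R a b`. -/
def comp (i : I) (R : Fin r → Fin r → Prop) [DecidableRel R] : A →ₗ[F] A where
  toFun X := ∑ a, ∑ b, if R a b then M.P i b * X * M.P i a else 0
  map_add' X Y := by
    simp only [← Finset.sum_add_distrib]
    refine Finset.sum_congr rfl fun a _ => Finset.sum_congr rfl fun b _ => ?_
    split_ifs
    · rw [mul_add, add_mul]
    · rw [add_zero]
  map_smul' x X := by
    simp only [Finset.smul_sum, RingHom.id_apply]
    refine Finset.sum_congr rfl fun a _ => Finset.sum_congr rfl fun b _ => ?_
    split_ifs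
    · rw [mul_smul_comm, smul_mul_assoc]
    · rw [smul_zero]

theorem comp_apply (i : I) (R : Fin r → Fin r → Prop) [DecidableRel R] (X : A) :
    M.comp i R X = ∑ a, ∑ b, if R a b then M.P i b * X * M.P i a else 0 := rfl

/-! ### Elementary relations between coloured Brauer operators -/

theorem s_symm (i j : I) : M.s i j = M.s j i := by
  rw [s, s, Equiv.swap_comm]

theorem s_mul_s (i j : I) : M.s i j * M.s i j = 1 := by
  rw [s, ← map_mul, Equiv.swap_mul_self, map_one]

theorem s_P_left (i j : I) (a : Fin r) : M.s i j * M.P i a = M.P j a * M.s i j := by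
  rw [s, M.σ_P, Equiv.swap_apply_left]

theorem s_P_right (i j : I) (a : Fin r) : M.s i j * M.P j a = M.P i a * M.s i j := by
  rw [s, M.σ_P, Equiv.swap_apply_right]

theorem s_P_of_ne {i j l : I} (hi : l ≠ i) (hj : l ≠ j) (a : Fin r) :
    M.s i j * M.P l a = M.P l a * M.s i j := by
  rw [s, M.σ_P, Equiv.swap_apply_of_ne_of_ne hi hj]

theorem s_mul_e {i j : I} (h : i ≠ j) : M.s i j * M.e i j = M.e i j := M.s_e i j h

theorem e_mul_s {i j : I} (h : i ≠ j) : M.e i j * M.s i j = M.e i j := by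
  have := M.σ_e (Equiv.swap i j) i j
  rw [Equiv.swap_apply_left, Equiv.swap_apply_right, ← M.e_symm i j h] at this
  exact this.symm.trans (M.s_e i j h)

theorem t_symm {i j : I} (h : i ≠ j) : M.t i j = M.t j i := by
  rw [t, t, s_symm, M.e_symm i j h]

theorem P_self (i : I) (a : Fin r) : M.P i a * M.P i a = M.P i a := by
  rw [M.P_mul, if_pos rfl]

theorem P_ne (i : I) {a b : Fin r} (h : a ≠ b) : M.P i a * M.P i b = 0 := by
  rw [M.P_mul, if_neg h]

theorem commute_t_P {i j l : I} (hi : l ≠ i) (hj : l ≠ j) (a : Fin r) :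
    Commute (M.t i j) (M.P l a) := by
  rw [Commute, SemiconjBy, t, sub_mul, mul_sub, M.s_P_of_ne hi hj, M.P_e_comm i j l a hi hj]

theorem σ_t (g : Equiv.Perm I) (i j : I) : M.σ g * M.t i j = M.t (g i) (g j) * M.σ g := by
  have h : M.σ g * M.s i j = M.s (g i) (g j) * M.σ g := by
    rw [s, s, ← map_mul, ← map_mul]
    congr 1
    exact Equiv.mul_swap_eq_swap_mul g i j
  rw [t, t, mul_sub, sub_mul, h, M.σ_e]

theorem commute_D_P (u : Fin r → F) (i j : I) (a : Fin r) : Commute (M.D u i) (M.P j a) := by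
  rw [D]
  refine Commute.sum_left _ _ _ fun b _ => Commute.smul_left ?_ _
  exact M.P_comm i j b a

theorem D_mul_P (u : Fin r → F) (i : I) (a : Fin r) : M.D u i * M.P i a = u a • M.P i a := by
  simp [D, Finset.sum_mul, M.P_mul]

theorem P_mul_D (u : Fin r → F) (i : I) (a : Fin r) : M.P i a * M.D u i = u a • M.P i a := by
  rw [← D_mul_P]
  exact (M.commute_D_P u i i a).symm.eq

theorem σ_D (u : Fin r → F) (g : Equiv.Perm I) (i : I) :
    M.σ g * M.D u i = M.D u (g i) * M.σ g := by
  simp only [D, Finset.mul_sum, Finset.sum_mul, mul_smul_comm, smul_mul_assoc, M.σ_P]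

/-! ### Components of operators -/

section comp

variable {M} {i j l : I} {R R' : Fin r → Fin r → Prop} [DecidableRel R] [DecidableRel R']

theorem ext_P {X Y : A} (i : I)
    (h : ∀ a b, M.P i b * X * M.P i a = M.P i b * Y * M.P i a) : X = Y := by
  have key : ∀ X : A, X = ∑ b, ∑ a, M.P i b * X * M.P i a := fun X => by
    simp only [← Finset.mul_sum, M.P_sum, mul_one, ← Finset.sum_mul, one_mul]
  rw [key X, key Y]
  exact Finset.sum_congr rfl fun b _ => Finset.sum_congr rfl fun a _ => h a b

theorem P_mul_comp (b : Fin r) (X : A) :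
    M.P i b * M.comp i R X = ∑ a, if R a b then M.P i b * X * M.P i a else 0 := by
  rw [comp_apply, Finset.mul_sum]
  refine Finset.sum_congr rfl fun a _ => ?_
  rw [Finset.mul_sum, Finset.sum_eq_single b]
  · rw [mul_ite, mul_zero, ← mul_assoc, ← mul_assoc, P_self]
  · intro c _ hc
    rw [mul_ite, mul_zero, ← mul_assoc, ← mul_assoc, P_ne _ _ hc.symm, zero_mul, zero_mul, ite_self]
  · simp

theorem comp_mul_P (a : Fin r) (X : A) :
    M.comp i R X * M.P i a = ∑ b, if R a b then M.P i b * X * M.P i a else 0 := by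
  rw [comp_apply, Finset.sum_mul, Finset.sum_eq_single a]
  · rw [Finset.sum_mul]
    refine Finset.sum_congr rfl fun b _ => ?_
    rw [ite_mul, zero_mul, mul_assoc, P_self]
  · intro c _ hc
    rw [Finset.sum_mul]
    refine Finset.sum_eq_zero fun b _ => ?_
    rw [ite_mul, zero_mul, mul_assoc, P_ne _ _ hc, mul_zero, ite_self]
  · simp

theorem P_mul_comp_mul_P (a b : Fin r) (X : A) :
    M.P i b * M.comp i R X * M.P i a = if R a b then M.P i b * X * M.P i a else 0 := by
  rw [mul_assoc, comp_mul_P, Finset.mul_sum, Finset.sum_eq_single b]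
  · rw [mul_ite, mul_zero, ← mul_assoc, ← mul_assoc, P_self]
  · intro c _ hc
    rw [mul_ite, mul_zero, ← mul_assoc, ← mul_assoc, P_ne _ _ hc.symm, zero_mul, zero_mul, ite_self]
  · simp

theorem comp_mul_left {X Y : A} (h : ∀ a, Commute Y (M.P i a)) :
    M.comp i R (Y * X) = Y * M.comp i R X := by
  simp only [comp_apply, Finset.mul_sum, mul_ite, mul_zero, ← mul_assoc]
  simp only [(h _).eq]

theorem comp_mul_right {X Y : A} (h : ∀ a, Commute Y (M.P i a)) :
    M.comp i R (X * Y) = M.comp i R X * Y := by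
  simp only [comp_apply, Finset.sum_mul, ite_mul, zero_mul, mul_assoc]
  simp only [(h _).eq]

theorem commute_comp {X Y : A} (h : ∀ a, Commute Y (M.P i a)) (hX : Commute Y X) :
    Commute Y (M.comp i R X) := by
  rw [Commute, SemiconjBy, ← comp_mul_left h, ← comp_mul_right h, hX.eq]

theorem comp_comp_comm (X : A) :
    M.comp i R (M.comp j R' X) = M.comp j R' (M.comp i R X) := by
  refine ext_P (M := M) i fun a b => ?_
  rw [P_mul_comp_mul_P, ← comp_mul_left fun c => M.P_comm i j b c,
    ← comp_mul_left fun c => M.P_comm i j b c, ← comp_mul_right fun c => M.P_comm i j a c,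
    ← comp_mul_right fun c => M.P_comm i j a c, P_mul_comp_mul_P]
  split_ifs
  · rfl
  · rw [map_zero]

theorem comp_mul_eq_self {R'' : Fin r → Fin r → Prop} [DecidableRel R''] {X Y : A}
    (h : ∀ a b c, R' a b → R b c → R'' a c) :
    M.comp i R'' (M.comp i R X * M.comp i R' Y) = M.comp i R X * M.comp i R' Y := by
  refine ext_P (M := M) i fun a c => ?_
  rw [P_mul_comp_mul_P]
  split_ifs with hac
  · rfl
  · rw [← mul_assoc, P_mul_comp, mul_assoc, comp_mul_P, Finset.sum_mul]
    symm
    refine Finset.sum_eq_zero fun b _ => ?_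
    rw [Finset.mul_sum]
    refine Finset.sum_eq_zero fun b' _ => ?_
    split_ifs with h1 h2
    · have : b ≠ b' := by rintro rfl; exact hac (h _ _ _ h2 h1)
      rw [mul_assoc, mul_assoc (M.P i b') Y, ← mul_assoc (M.P i b) (M.P i b'), P_ne _ _ this]
      simp
    · simp
    · simp
    · simp

theorem comp_lt_add_comp_ge (X : A) :
    M.comp i (· < ·) X + M.comp i (· ≥ ·) X = X := by
  refine ext_P (M := M) i fun a b => ?_
  rw [mul_add, add_mul, P_mul_comp_mul_P, P_mul_comp_mul_P]
  by_cases h : a < b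
  · rw [if_pos h, if_neg (not_le.2 h), add_zero]
  · rw [if_neg h, if_pos (not_lt.1 h), zero_add]

theorem comp_le (X : A) :
    M.comp i (· ≤ ·) X = M.comp i (· < ·) X + M.comp i (· = ·) X := by
  refine ext_P (M := M) i fun a b => ?_
  rw [mul_add, add_mul, P_mul_comp_mul_P, P_mul_comp_mul_P, P_mul_comp_mul_P]
  rcases lt_trichotomy a b with h | h | h
  · rw [if_pos h.le, if_pos h, if_neg h.ne, add_zero]
  · rw [if_pos h.le, if_neg h.not_lt, if_pos h, zero_add]
  · rw [if_neg (not_le.2 h), if_neg h.not_gt, if_neg h.ne', add_zero]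

theorem σ_comp (g : Equiv.Perm I) (X Y : A) (h : M.σ g * X = Y * M.σ g) :
    M.σ g * M.comp i R X = M.comp (g i) R Y * M.σ g := by
  simp only [comp_apply, Finset.mul_sum, Finset.sum_mul, mul_ite, mul_zero, ite_mul, zero_mul]
  refine Finset.sum_congr rfl fun a _ => Finset.sum_congr rfl fun b _ => ?_
  congr 1
  rw [← mul_assoc, ← mul_assoc, M.σ_P, mul_assoc (M.P _ b), h, mul_assoc, mul_assoc, mul_assoc,
    M.σ_P]
  simp only [mul_assoc]

/-- Changing the colour of one of two factors upwards by `t i j` changes the colour of the other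
one downwards. -/
theorem comp_t (hij : i ≠ j) (hR : ∀ a b, R a b ↔ R' b a) (hR' : ∀ a b, R a b → R b.rev a.rev) :
    M.comp i R (M.t i j) = M.comp j R' (M.t i j) := by
  have hR'' : ∀ a b, R b.rev a.rev ↔ R a b :=
    fun a b => ⟨fun h => by simpa using hR' _ _ h, hR' a b⟩
  have hs : M.comp i R (M.s i j) = M.comp j R' (M.s i j) := by
    simp only [comp_apply, ← M.s_P_right i j, ← M.s_P_left i j, mul_assoc]
    rw [Finset.sum_comm]
    refine Finset.sum_congr rfl fun a _ => Finset.sum_congr rfl fun b _ => ?_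
    rw [M.P_comm i j]
    exact if_congr (hR _ _) rfl rfl
  have he : M.comp i R (M.e i j) = M.comp j R' (M.e i j) := by
    simp only [comp_apply, M.P_e i j _ hij]
    rw [← Equiv.sum_comp Fin.revPerm]
    refine Finset.sum_congr rfl fun a _ => ?_
    rw [← Equiv.sum_comp Fin.revPerm]
    refine Finset.sum_congr rfl fun b _ => ?_
    simp only [Fin.revPerm_apply, Fin.rev_rev]
    rw [mul_assoc, M.e_P i j _ hij, Fin.rev_rev, mul_assoc]
    exact if_congr (((hR'' b a).trans (hR b a))) rfl rfl
  rw [t, map_sub, map_sub, hs, he]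

theorem comp_lt_t (hij : i ≠ j) :
    M.comp i (· < ·) (M.t i j) = M.comp j (· > ·) (M.t i j) :=
  comp_t hij (fun _ _ => Iff.rfl) fun _ _ h => Fin.rev_lt_rev.2 h

theorem comp_le_t (hij : i ≠ j) :
    M.comp i (· ≤ ·) (M.t i j) = M.comp j (· ≥ ·) (M.t i j) :=
  comp_t hij (fun _ _ => Iff.rfl) fun _ _ h => Fin.rev_le_rev.2 h

end comp

end ColoredBrauer

namespace ColoredBrauer

variable {I : Type} [DecidableEq I] {F : Type u} [Field F] {A : Type u} [Ring A] [Algebra F A]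
  {r : ℕ} {δ : Fin r → F} (M : ColoredBrauer I A δ)

/-! ### The infinitesimal braid relations -/

theorem t_add_t_mul_e {i j l : I} (hij : i ≠ j) (hi : l ≠ i) (hj : l ≠ j) :
    (M.t i l + M.t j l) * M.e i j = 0 := by
  have h1 : M.e j l * M.e i j = M.s i l * M.e i j := M.e_e' i j l hij hj.symm hi.symm
  have h2 : M.e i l * M.e i j = M.s j l * M.e i j := by
    rw [M.e_symm i j hij]; exact M.e_e' j i l hij.symm hi.symm hj.symm
  rw [t, t, add_mul, sub_mul, sub_mul, h1, h2]
  abel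

theorem e_mul_t_add_t {i j l : I} (hij : i ≠ j) (hi : l ≠ i) (hj : l ≠ j) :
    M.e i j * (M.t i l + M.t j l) = 0 := by
  have h1 : M.e i j * M.e j l = M.e i j * M.s i l := M.e_e i j l hij hj.symm hi.symm
  have h2 : M.e i j * M.e i l = M.e i j * M.s j l := by
    rw [M.e_symm i j hij]; exact M.e_e j i l hij.symm hi.symm hj.symm
  rw [t, t, mul_add, mul_sub, mul_sub, h1, h2]
  abel

theorem commute_t_t_add_t {i j l : I} (hij : i ≠ j) (hi : l ≠ i) (hj : l ≠ j) :
    Commute (M.t i j) (M.t i l + M.t j l) := by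
  have h1 : M.s i j * M.t i l = M.t j l * M.s i j := by
    rw [s, M.σ_t, Equiv.swap_apply_left, Equiv.swap_apply_of_ne_of_ne hi hj]
  have h2 : M.s i j * M.t j l = M.t i l * M.s i j := by
    rw [s, M.σ_t, Equiv.swap_apply_right, Equiv.swap_apply_of_ne_of_ne hi hj]
  rw [Commute, SemiconjBy, t, sub_mul, mul_sub, M.e_mul_t_add_t hij hi hj,
    M.t_add_t_mul_e hij hi hj, mul_add, h1, h2, add_mul, add_comm]

theorem commute_t_e {i j k l : I} (hij : i ≠ j) (hkl : k ≠ l) (hik : i ≠ k) (hil : i ≠ l)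
    (hjk : j ≠ k) (hjl : j ≠ l) : Commute (M.t i j) (M.e k l) := by
  rw [Commute, SemiconjBy, t, sub_mul, mul_sub, M.e_comm i j k l hij hkl hik hil hjk hjl, s, M.σ_e,
    Equiv.swap_apply_of_ne_of_ne hik.symm hjk.symm, Equiv.swap_apply_of_ne_of_ne hil.symm hjl.symm]

theorem commute_t_t {i j k l : I} (hij : i ≠ j) (hkl : k ≠ l) (hik : i ≠ k) (hil : i ≠ l)
    (hjk : j ≠ k) (hjl : j ≠ l) : Commute (M.t i j) (M.t k l) := by
  have h : Commute (M.s k l) (M.t i j) := by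
    rw [Commute, SemiconjBy, s, M.σ_t, Equiv.swap_apply_of_ne_of_ne hik hil,
      Equiv.swap_apply_of_ne_of_ne hjk hjl]
  exact h.symm.sub_right (M.commute_t_e hij hkl hik hil hjk hjl)

/-- The relation between three factors behind the commutation of the operators `jm`. It is a
consequence of the infinitesimal braid relations, by which the commutators of the operators `t` on
three factors agree up to sign. -/
theorem three_factor_relation {i j l : I} (hij : i ≠ j) (hi : l ≠ i) (hj : l ≠ j) :
    M.comp i (· < ·) (M.t i j) * M.comp j (· < ·) (M.t j l)
      - M.comp j (· < ·) (M.t j l) * M.comp i (· < ·) (M.t i j)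
      + (M.comp j (· ≥ ·) (M.t i j) * M.comp i (· < ·) (M.t i l)
        - M.comp i (· < ·) (M.t i l) * M.comp j (· ≥ ·) (M.t i j))
      + (M.comp i (· < ·) (M.t i l) * M.comp j (· < ·) (M.t j l)
        - M.comp j (· < ·) (M.t j l) * M.comp i (· < ·) (M.t i l)) = 0 := by
  set κ := M.t i l * M.t j l - M.t j l * M.t i l with hκ
  have hPij : ∀ a, Commute (M.t i j) (M.P l a) := M.commute_t_P hi hj
  have hPil : ∀ a, Commute (M.t i l) (M.P j a) := M.commute_t_P hij.symm hj.symm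
  have hPjl : ∀ a, Commute (M.t j l) (M.P i a) := M.commute_t_P hij hi.symm
  have braid1 : M.t i j * M.t j l - M.t j l * M.t i j = - κ := by
    have := (M.commute_t_t_add_t hj.symm hij hi.symm).eq
    rw [M.t_symm hij.symm, M.t_symm hi] at this
    rw [← sub_eq_zero] at this ⊢
    rw [hκ, ← neg_eq_zero, ← this]
    noncomm_ring
  have braid2 : M.t i j * M.t i l - M.t i l * M.t i j = κ := by
    have := (M.commute_t_t_add_t hi.symm hij.symm hj.symm).eq
    rw [M.t_symm hj] at this
    rw [← sub_eq_zero] at this ⊢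
    rw [hκ, ← neg_eq_zero, ← this]
    noncomm_ring
  have hil : M.comp i (· < ·) (M.t i l) = M.comp l (· > ·) (M.t i l) := comp_lt_t hi.symm
  have hjl : M.comp j (· < ·) (M.t j l) = M.comp l (· > ·) (M.t j l) := comp_lt_t hj.symm
  have hge : M.comp j (· ≥ ·) (M.t i j) = M.comp i (· ≤ ·) (M.t i j) := (comp_le_t hij).symm
  -- The colour at a factor not involved in `t` does not change.
  have c1 : ∀ (R : Fin r → Fin r → Prop) [DecidableRel R] a,
      Commute (M.comp i R (M.t i j)) (M.P l a) := fun R _ a =>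
    (commute_comp (fun b => M.P_comm l i a b) (hPij a).symm).symm
  have c2 : ∀ (R : Fin r → Fin r → Prop) [DecidableRel R] a,
      Commute (M.comp j R (M.t j l)) (M.P i a) := fun R _ a =>
    (commute_comp (fun b => M.P_comm i j a b) (hPjl a).symm).symm
  have c3 : ∀ (R : Fin r → Fin r → Prop) [DecidableRel R] a,
      Commute (M.comp i R (M.t i l)) (M.P j a) := fun R _ a =>
    (commute_comp (fun b => M.P_comm j i a b) (hPil a).symm).symm
  have c4 : ∀ (R : Fin r → Fin r → Prop) [DecidableRel R] a,
      Commute (M.comp j R (M.t i j)) (M.P l a) := fun R _ a =>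
    (commute_comp (fun b => M.P_comm l j a b) (hPij a).symm).symm
  have e1 : M.comp i (· < ·) (M.t i j) * M.comp j (· < ·) (M.t j l)
      - M.comp j (· < ·) (M.t j l) * M.comp i (· < ·) (M.t i j)
      = - M.comp l (· > ·) (M.comp i (· < ·) κ) := by
    rw [hjl, ← comp_mul_left (c1 _), ← comp_mul_right (c1 _), ← comp_mul_right hPjl,
      ← comp_mul_left hPjl, ← map_sub, ← map_sub, braid1, map_neg, map_neg]
  have e2 : M.comp j (· ≥ ·) (M.t i j) * M.comp i (· < ·) (M.t i l)
      - M.comp i (· < ·) (M.t i l) * M.comp j (· ≥ ·) (M.t i j)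
      = M.comp l (· > ·) (M.comp j (· ≥ ·) κ) := by
    rw [hil, ← comp_mul_left (c4 _), ← comp_mul_right (c4 _), ← comp_mul_right hPil,
      ← comp_mul_left hPil, ← map_sub, ← map_sub, braid2]
  have e3 : M.comp i (· < ·) (M.t i l) * M.comp j (· < ·) (M.t j l)
      - M.comp j (· < ·) (M.t j l) * M.comp i (· < ·) (M.t i l)
      = M.comp i (· < ·) (M.comp j (· < ·) κ) := by
    rw [comp_comp_comm, ← comp_mul_left (c3 _), ← comp_mul_right (c3 _), ← comp_mul_right hPjl,
      ← comp_mul_left hPjl, ← map_sub, ← map_sub]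
  -- The commutator in `e3` is made of operators that lower the colour at `l`.
  have f1 : M.comp l (· > ·) (M.comp i (· < ·) (M.comp j (· < ·) κ))
      = M.comp i (· < ·) (M.comp j (· < ·) κ) := by
    rw [← e3, hil, hjl, map_sub, comp_mul_eq_self fun a b c h h' => h'.trans h,
      comp_mul_eq_self fun a b c h h' => h'.trans h]
  -- The commutator in `e2` is made of operators of which one raises the colour at `i` and the
  -- other one does not lower it.
  have f2 : M.comp i (· < ·) (M.comp l (· > ·) (M.comp j (· ≥ ·) κ))
      = M.comp l (· > ·) (M.comp j (· ≥ ·) κ) := by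
    rw [← e2, hge, map_sub, comp_mul_eq_self fun a b c h h' => h.trans_le h',
      comp_mul_eq_self fun a b c h h' => h.trans_lt h']
  clear_value κ
  have f3 : M.comp j (· ≥ ·) κ = κ - M.comp j (· < ·) κ :=
    eq_sub_of_add_eq' (comp_lt_add_comp_ge κ)
  rw [e1, e2, e3]
  rw [f3, map_sub, map_sub, comp_comp_comm (i := i) (j := l), comp_comp_comm (i := i) (j := l),
    f1] at f2
  rw [f3, map_sub]
  rw [← sub_eq_zero] at f2
  rw [← neg_eq_zero, ← f2]
  abel

/-! ### The Levi part on two factors -/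

section levi

variable {u : Fin r → F}

/-- The sum of the parts of the first two Jucys-Murphy operators that involve only the factors `i`
and `j`, see `jm₂_add`. It preserves the colours, since the components that raise a colour
cancel. -/
def levi (u : Fin r → F) (i j : I) : A := M.D u i + M.D u j + M.comp i (· = ·) (M.t i j)

variable (hδ : ∀ a, δ a = u a + u a.rev + if a = a.rev then 1 else 0)
include hδ

theorem levi_mul_P_e {i j : I} (hij : i ≠ j) (a : Fin r) :
    M.levi u i j * (M.P i a * M.e i j) = 0 := by
  have h1 : M.D u j * (M.P i a * M.e i j) = u a.rev • (M.P i a * M.e i j) := by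
    rw [M.P_e i j a hij, ← mul_assoc, D_mul_P, smul_mul_assoc]
  have h2 : M.D u i * (M.P i a * M.e i j) = u a • (M.P i a * M.e i j) := by
    rw [← mul_assoc, D_mul_P, smul_mul_assoc]
  have h3 : M.P i a * M.s i j * M.P i a * M.e i j =
      (if a = a.rev then (1 : F) else 0) • (M.P i a * M.e i j) := by
    rw [mul_assoc (M.P i a), s_P_left, mul_assoc, mul_assoc, s_mul_e _ hij]
    have := M.P_e i j a.rev hij
    rw [Fin.rev_rev] at this
    rw [← this, ← mul_assoc, M.P_mul]
    split_ifs <;> simp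
  have h4 : M.comp i (· = ·) (M.t i j) * (M.P i a * M.e i j) =
      ((if a = a.rev then (1 : F) else 0) - δ a) • (M.P i a * M.e i j) := by
    rw [← mul_assoc, comp_mul_P]
    simp only [Finset.sum_ite_eq, Finset.mem_univ, if_true]
    rw [t, mul_sub, sub_mul, sub_mul, h3, sub_smul, mul_assoc (M.P i a), mul_assoc (M.P i a),
      M.e_P_e i j a hij, mul_smul_comm]
  rw [levi, add_mul, add_mul, h1, h2, h4, ← add_smul, ← add_smul, hδ]
  rw [show u a + u a.rev + ((if a = a.rev then (1 : F) else 0) -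
    (u a + u a.rev + if a = a.rev then 1 else 0)) = 0 by ring, zero_smul]

theorem e_P_mul_levi {i j : I} (hij : i ≠ j) (a : Fin r) :
    (M.e i j * M.P i a) * M.levi u i j = 0 := by
  have h1 : (M.e i j * M.P i a) * M.D u j = u a.rev • (M.e i j * M.P i a) := by
    rw [M.e_P i j a hij, mul_assoc, P_mul_D, mul_smul_comm]
  have h2 : (M.e i j * M.P i a) * M.D u i = u a • (M.e i j * M.P i a) := by
    rw [mul_assoc, P_mul_D, mul_smul_comm]
  have h3 : M.e i j * (M.P i a * M.s i j * M.P i a) =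
      (if a = a.rev then (1 : F) else 0) • (M.e i j * M.P i a) := by
    rw [← s_P_right, mul_assoc, ← mul_assoc, e_mul_s _ hij]
    have := M.e_P i j a.rev hij
    rw [Fin.rev_rev] at this
    rw [← mul_assoc, ← this, mul_assoc, M.P_mul]
    split_ifs with h h' h'
    · rw [h, one_smul]
    · exact absurd h.symm h'
    · exact absurd h'.symm h
    · simp
  have h4 : (M.e i j * M.P i a) * M.comp i (· = ·) (M.t i j) =
      ((if a = a.rev then (1 : F) else 0) - δ a) • (M.e i j * M.P i a) := by
    rw [mul_assoc, P_mul_comp]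
    simp only [Finset.sum_ite_eq', Finset.mem_univ, if_true]
    rw [t, mul_sub, sub_mul, mul_sub, h3, sub_smul, ← mul_assoc (M.e i j), ← mul_assoc (M.e i j),
      M.e_P_e i j a hij, smul_mul_assoc]
  rw [levi, mul_add, mul_add, h1, h2, h4, ← add_smul, ← add_smul, hδ]
  rw [show u a + u a.rev + ((if a = a.rev then (1 : F) else 0) -
    (u a + u a.rev + if a = a.rev then 1 else 0)) = 0 by ring, zero_smul]

theorem levi_mul_e {i j : I} (hij : i ≠ j) : M.levi u i j * M.e i j = 0 := by
  rw [← one_mul (M.e i j), ← M.P_sum i, Finset.sum_mul, Finset.mul_sum]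
  exact Finset.sum_eq_zero fun a _ => M.levi_mul_P_e hδ hij a

theorem e_mul_levi {i j : I} (hij : i ≠ j) : M.e i j * M.levi u i j = 0 := by
  rw [← mul_one (M.e i j), ← M.P_sum i, Finset.mul_sum, Finset.sum_mul]
  exact Finset.sum_eq_zero fun a _ => M.e_P_mul_levi hδ hij a

end levi

/-! ### Jucys-Murphy operators -/

section jm

variable [Fintype I] (u : Fin r → F)

/-- The Jucys-Murphy operator at the factor `i`: the split Casimir tensor acting on a parabolic
Verma module and the factor `i`, on coinvariants. The Levi subalgebra acts on the generator of the
Verma module by scalars, which gives the diagonal part; the elements of the opposite nilradical are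
moved to the other tensor factors. -/
def jm (i : I) : A := M.D u i - M.comp i (· < ·) (∑ l ∈ Finset.univ.erase i, M.t i l)

theorem σ_jm (g : Equiv.Perm I) (i : I) : M.σ g * M.jm u i = M.jm u (g i) * M.σ g := by
  rw [jm, jm, mul_sub, sub_mul, M.σ_D, σ_comp]
  rw [Finset.mul_sum, Finset.sum_mul]
  simp only [M.σ_t]
  refine Finset.sum_equiv g (fun l => ?_) fun l _ => rfl
  simp

theorem commute_jm_e {i j k : I} (hij : i ≠ j) (hik : i ≠ k) (hjk : j ≠ k) :
    Commute (M.jm u i) (M.e j k) := by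
  have hP : ∀ a, Commute (M.e j k) (M.P i a) := fun a => (M.P_e_comm j k i a hij hik).symm
  refine Commute.sub_left ?_ (commute_comp hP ?_).symm
  · exact Commute.sum_left _ _ _ fun a _ => Commute.smul_left (hP a).symm _
  · have hk : k ∈ (Finset.univ.erase i).erase j := by simp [hjk.symm, hik.symm]
    rw [← Finset.add_sum_erase _ _ (show j ∈ Finset.univ.erase i by simp [hij.symm]),
      ← Finset.add_sum_erase _ _ hk, ← add_assoc]
    refine Commute.add_right ?_ ?_
    · rw [Commute, SemiconjBy, M.t_symm hij, M.t_symm hik, M.e_mul_t_add_t hjk hij hik,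
        M.t_add_t_mul_e hjk hij hik]
    · refine Commute.sum_right _ _ _ fun l hl => ?_
      simp only [Finset.mem_erase, Finset.mem_univ, and_true] at hl
      exact (M.commute_t_e hl.2.2.symm hjk hij hik hl.2.1 hl.1).symm

end jm

end ColoredBrauer

/-! ### Commutation of the first two Jucys-Murphy operators -/

namespace ColoredBrauer

variable {I : Type} [DecidableEq I] {F : Type u} [Field F] {A : Type u} [Ring A] [Algebra F A]
  {r : ℕ} {δ : Fin r → F} (M : ColoredBrauer I A δ) {u : Fin r → F}

/-- The part of `jm u i` that involves one other factor only. -/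
def jm₂ (u : Fin r → F) (i j : I) : A := M.D u i - M.comp i (· < ·) (M.t i j)

theorem jm₂_add (i j : I) (hij : i ≠ j) :
    M.jm₂ u i j + (M.D u j + M.comp j (· ≥ ·) (M.t i j)) = M.levi u i j := by
  rw [jm₂, ← comp_le_t hij, comp_le, levi]
  abel

theorem commute_D_comp_eq (i : I) (X : A) : Commute (M.D u i) (M.comp i (· = ·) X) := by
  refine ext_P (M := M) i fun a b => ?_
  rw [← mul_assoc, P_mul_D, ← mul_assoc, smul_mul_assoc, smul_mul_assoc,
    mul_assoc (_ * _) (M.D u i), D_mul_P, mul_smul_comm, P_mul_comp_mul_P]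
  split_ifs with h
  · rw [h]
  · rw [smul_zero, smul_zero]

theorem commute_D_levi (i j : I) : Commute (M.D u i) (M.levi u i j) := by
  refine Commute.add_right (Commute.add_right (Commute.refl _) ?_) (M.commute_D_comp_eq i _)
  exact Commute.sum_right _ _ _ fun a _ => Commute.smul_right (M.commute_D_P u i j a) _

theorem commute_comp_s_levi (i j : I) (hij : i ≠ j) :
    Commute (M.comp i (· < ·) (M.s i j)) (M.levi u i j) := by
  have hD : Commute (M.D u i + M.D u j) (M.s i j) := by
    have h := M.σ_D u (Equiv.swap i j)
    have h1 := h i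
    have h2 := h j
    rw [Equiv.swap_apply_left] at h1
    rw [Equiv.swap_apply_right] at h2
    rw [Commute, SemiconjBy, add_mul, s, ← h1, ← h2, mul_add, add_comm]
  have hD' : Commute (M.comp i (· < ·) (M.s i j)) (M.D u i + M.D u j) :=
    (commute_comp (fun a => (M.commute_D_P u i i a).add_left (M.commute_D_P u j i a)) hD).symm
  refine hD'.add_right ?_
  refine ext_P (M := M) i fun a b => ?_
  have h1 : M.P i b * (M.comp i (· < ·) (M.s i j) * M.comp i (· = ·) (M.t i j)) * M.P i a =
      if a < b then M.P i b * M.s i j * M.P i a * M.t i j * M.P i a else 0 := by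
    have hY : M.comp i (· = ·) (M.t i j) * M.P i a = M.P i a * (M.t i j * M.P i a) := by
      rw [comp_mul_P, Finset.sum_ite_eq, if_pos (Finset.mem_univ _), mul_assoc]
    rw [mul_assoc, mul_assoc (M.comp i _ _), hY, ← mul_assoc, ← mul_assoc, P_mul_comp_mul_P,
      ite_mul, zero_mul, mul_assoc _ (M.t i j)]
  have h2 : M.P i b * (M.comp i (· = ·) (M.t i j) * M.comp i (· < ·) (M.s i j)) * M.P i a =
      if a < b then M.P i b * M.t i j * M.P i b * M.s i j * M.P i a else 0 := by
    have hY : M.P i b * M.comp i (· = ·) (M.t i j) = M.P i b * M.t i j * M.P i b := by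
      rw [P_mul_comp, Finset.sum_ite_eq', if_pos (Finset.mem_univ _)]
    rw [← mul_assoc, hY, mul_assoc, mul_assoc (_ * _) (M.P i b), ← mul_assoc (M.P i b),
      P_mul_comp_mul_P, mul_ite, mul_zero]
    simp only [mul_assoc]
  rw [h1, h2]
  split_ifs with hab
  · -- Both sides reduce to the part of `e i j` with colours `a` and `b = rev a`.
    have hs1 : M.P i b * M.s i j * M.P i a = M.P i b * M.P j a * M.s i j := by
      rw [mul_assoc, s_P_left, mul_assoc]
    have hs2 : M.P i b * M.s i j * M.P i a = M.s i j * (M.P j b * M.P i a) := by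
      rw [← M.s_P_right, mul_assoc]
    have k1 : M.P i b * M.P j a * M.s i j * M.s i j * M.P i a = 0 := by
      rw [mul_assoc (M.P i b * _), s_mul_s, mul_one, mul_assoc, M.P_comm j i, ← mul_assoc,
        P_ne _ _ hab.ne', zero_mul]
    have k2 : M.P i b * M.s i j * (M.s i j * (M.P j b * M.P i a)) = 0 := by
      rw [mul_assoc, ← mul_assoc (M.s i j), s_mul_s, one_mul, ← mul_assoc, M.P_comm i j,
        mul_assoc, P_ne _ _ hab.ne', mul_zero]
    have k3 : M.P i b * M.P j a * M.s i j * M.e i j * M.P i a =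
        if b = a.rev then M.P i b * M.e i j * M.P i a else 0 := by
      have := M.P_e i j a.rev hij
      rw [Fin.rev_rev] at this
      rw [mul_assoc (M.P i b * _), s_mul_e _ hij, mul_assoc (M.P i b), ← this, ← mul_assoc,
        M.P_mul]
      split_ifs
      · rfl
      · rw [zero_mul, zero_mul]
    have k4 : M.P i b * M.e i j * (M.s i j * (M.P j b * M.P i a)) =
        if b = a.rev then M.P i b * M.e i j * M.P i a else 0 := by
      have := M.e_P i j b.rev hij
      rw [Fin.rev_rev] at this
      rw [mul_assoc, ← mul_assoc (M.e i j), e_mul_s _ hij, ← mul_assoc (M.e i j), ← this,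
        mul_assoc (M.e i j), M.P_mul]
      split_ifs with h h' h'
      · rw [h, mul_assoc]
      · exact absurd (by rw [← h, Fin.rev_rev]) h'
      · exact absurd (by rw [h', Fin.rev_rev]) h
      · rw [mul_zero, mul_zero]
    rw [hs1, mul_assoc (M.P i b * M.t i j * M.P i b), mul_assoc (M.P i b * M.t i j),
      ← mul_assoc (M.P i b) (M.s i j), hs2, t, mul_sub, sub_mul, mul_sub, sub_mul, k1, k2, k3, k4]
  · rfl

section

variable (hδ : ∀ a, δ a = u a + u a.rev + if a = a.rev then 1 else 0)
include hδ

theorem commute_comp_e_levi (i j : I) (hij : i ≠ j) :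
    Commute (M.comp i (· < ·) (M.e i j)) (M.levi u i j) := by
  have h1 : M.comp i (· < ·) (M.e i j) * M.levi u i j = 0 := by
    rw [comp_apply, Finset.sum_mul]
    refine Finset.sum_eq_zero fun a _ => ?_
    rw [Finset.sum_mul]
    refine Finset.sum_eq_zero fun b _ => ?_
    rw [ite_mul, mul_assoc (M.P i b), mul_assoc (M.P i b), M.e_P_mul_levi hδ hij, mul_zero,
      zero_mul, ite_self]
  have h2 : M.levi u i j * M.comp i (· < ·) (M.e i j) = 0 := by
    rw [comp_apply, Finset.mul_sum]
    refine Finset.sum_eq_zero fun a _ => ?_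
    rw [Finset.mul_sum]
    refine Finset.sum_eq_zero fun b _ => ?_
    rw [mul_ite, ← mul_assoc, M.levi_mul_P_e hδ hij, mul_zero, zero_mul, ite_self]
  rw [Commute, SemiconjBy, h1, h2]

theorem commute_jm₂ (i j : I) (hij : i ≠ j) :
    Commute (M.jm₂ u i j) (M.D u j + M.comp j (· ≥ ·) (M.t i j)) := by
  have h : Commute (M.jm₂ u i j) (M.levi u i j) := by
    refine (M.commute_D_levi i j).sub_left ?_
    rw [t, map_sub]
    exact (M.commute_comp_s_levi i j hij).sub_left (M.commute_comp_e_levi hδ i j hij)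
  rw [← M.jm₂_add i j hij] at h
  have := h.sub_right (Commute.refl _)
  rwa [add_sub_cancel_left] at this

end

variable [Fintype I]

theorem jm_eq (i j : I) (hij : i ≠ j) :
    M.jm u i = M.jm₂ u i j - ∑ l ∈ (Finset.univ.erase i).erase j, M.comp i (· < ·) (M.t i l) := by
  rw [jm, jm₂, ← Finset.add_sum_erase _ _ (show j ∈ Finset.univ.erase i by simp [hij.symm]),
    map_add, map_sum, sub_add_eq_sub_sub]

/-- The second Jucys-Murphy operator `jm u j + t i j`, which acts on the Verma module and the factor
`i` together, with the part that involves the factors `i` and `j` only split off. -/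
theorem jm_add_t (i j : I) (hij : i ≠ j) :
    M.jm u j + M.t i j = (M.D u j + M.comp j (· ≥ ·) (M.t i j)) -
      ∑ l ∈ (Finset.univ.erase i).erase j, M.comp j (· < ·) (M.t j l) := by
  have h : M.t i j = M.comp j (· < ·) (M.t i j) + M.comp j (· ≥ ·) (M.t i j) :=
    (comp_lt_add_comp_ge _).symm
  rw [M.jm_eq j i hij.symm, jm₂, Finset.erase_right_comm, M.t_symm hij.symm]
  rw [eq_sub_of_add_eq' h.symm]
  abel

variable (hδ : ∀ a, δ a = u a + u a.rev + if a = a.rev then 1 else 0)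
include hδ

/-- The two-factor parts commute by `commute_jm₂`; the terms with one further factor cancel by
`three_factor_relation`, and those with two further factors commute. -/
theorem commute_jm (i j : I) (hij : i ≠ j) :
    Commute (M.jm u i) (M.jm u j + M.t i j) := by
  rw [M.jm_eq i j hij, M.jm_add_t i j hij]
  set a₁ := M.jm₂ u i j with ha₁
  set a₂ := M.D u j + M.comp j (· ≥ ·) (M.t i j) with ha₂
  set S := (Finset.univ.erase i).erase j with hS
  set p : I → A := fun l => M.comp i (· < ·) (M.t i l) with hp
  set q : I → A := fun l => M.comp j (· < ·) (M.t j l) with hq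
  have hmem : ∀ l ∈ S, l ≠ i ∧ l ≠ j := fun l hl => by
    simp only [hS, Finset.mem_erase, Finset.mem_univ, and_true] at hl
    exact ⟨hl.2, hl.1⟩
  have h12 : Commute a₁ a₂ := M.commute_jm₂ hδ i j hij
  have hqP : ∀ l ∈ S, ∀ a, Commute (M.P i a) (q l) := fun l hl a =>
    commute_comp (fun b => M.P_comm i j a b) (M.commute_t_P hij (hmem l hl).1.symm a).symm
  have hpP : ∀ l ∈ S, ∀ a, Commute (M.P j a) (p l) := fun l hl a =>
    commute_comp (fun b => M.P_comm j i a b)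
      (M.commute_t_P hij.symm (hmem l hl).2.symm a).symm
  have hDq : ∀ l ∈ S, Commute (M.D u i) (q l) := fun l hl =>
    Commute.sum_left _ _ _ fun a _ => Commute.smul_left (hqP l hl a) _
  have hDp : ∀ l ∈ S, Commute (M.D u j) (p l) := fun l hl =>
    Commute.sum_left _ _ _ fun a _ => Commute.smul_left (hpP l hl a) _
  have hpq : ∀ l ∈ S, ∀ m ∈ S, l ≠ m → Commute (p l) (q m) := fun l hl m hm hlm => by
    refine commute_comp (fun a => (hpP l hl a).symm) (commute_comp ?_ ?_).symm
    · exact fun a => M.commute_t_P hij (hmem m hm).1.symm a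
    · exact M.commute_t_t (hmem m hm).2.symm (hmem l hl).1.symm hij.symm (hmem l hl).2.symm
        (hmem m hm).1 hlm.symm
  have h3 : ∀ l ∈ S, a₁ * q l - q l * a₁ + (p l * a₂ - a₂ * p l) = p l * q l - q l * p l := by
    intro l hl
    have h := M.three_factor_relation hij (hmem l hl).1 (hmem l hl).2
    rw [ha₁, ha₂, jm₂, sub_mul, mul_sub, mul_add, add_mul, (hDq l hl).eq, (hDp l hl).eq,
      ← sub_eq_zero, ← neg_eq_zero, ← h]
    abel
  have hsum : (∑ l ∈ S, p l) * (∑ m ∈ S, q m) - (∑ m ∈ S, q m) * (∑ l ∈ S, p l) =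
      ∑ l ∈ S, (p l * q l - q l * p l) := by
    rw [Finset.sum_mul_sum, Finset.sum_mul_sum,
      Finset.sum_comm (s := S) (t := S) (f := fun m l => q m * p l), ← Finset.sum_sub_distrib]
    refine Finset.sum_congr rfl fun l hl => ?_
    rw [← Finset.sum_sub_distrib, Finset.sum_eq_single l]
    · intro m hm hml
      rw [(hpq l hl m hm hml.symm).eq, sub_self]
    · exact fun h => absurd hl h
  rw [← Finset.sum_congr rfl h3, Finset.sum_add_distrib, Finset.sum_sub_distrib,
    Finset.sum_sub_distrib, ← Finset.mul_sum, ← Finset.mul_sum, ← Finset.sum_mul,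
    ← Finset.sum_mul] at hsum
  rw [Commute, SemiconjBy, ← sub_eq_zero]
  rw [← sub_eq_zero] at hsum
  have e : (a₁ - ∑ l ∈ S, p l) * (a₂ - ∑ l ∈ S, q l) - (a₂ - ∑ l ∈ S, q l) * (a₁ - ∑ l ∈ S, p l)
      = (a₁ * a₂ - a₂ * a₁) + ((∑ l ∈ S, p l) * (∑ m ∈ S, q m) -
        (∑ m ∈ S, q m) * (∑ l ∈ S, p l) - (a₁ * ∑ l ∈ S, q l - (∑ l ∈ S, q l) * a₁ +
          ((∑ l ∈ S, p l) * a₂ - a₂ * ∑ l ∈ S, p l))) := by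
    noncomm_ring
  rw [e, h12.eq, sub_self, zero_add, hsum]

theorem jm_add_mul_e (i j : I) (hij : i ≠ j) :
    (M.jm u i + (M.jm u j + M.t i j)) * M.e i j = 0 := by
  rw [M.jm_eq i j hij, M.jm_add_t i j hij, sub_add_sub_comm, M.jm₂_add i j hij, sub_mul,
    M.levi_mul_e hδ hij, ← Finset.sum_add_distrib, Finset.sum_mul, Finset.sum_eq_zero, sub_zero]
  intro l hl
  simp only [Finset.mem_erase, Finset.mem_univ, and_true] at hl
  rw [comp_lt_t hl.2.symm, comp_lt_t hl.1.symm, ← map_add,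
    ← comp_mul_right fun a => (M.P_e_comm i j l a hl.2 hl.1).symm,
    M.t_add_t_mul_e hij hl.2 hl.1, map_zero]

theorem e_mul_jm_add (i j : I) (hij : i ≠ j) :
    M.e i j * (M.jm u i + (M.jm u j + M.t i j)) = 0 := by
  rw [M.jm_eq i j hij, M.jm_add_t i j hij, sub_add_sub_comm, M.jm₂_add i j hij, mul_sub,
    M.e_mul_levi hδ hij, ← Finset.sum_add_distrib, Finset.mul_sum, Finset.sum_eq_zero, sub_zero]
  intro l hl
  simp only [Finset.mem_erase, Finset.mem_univ, and_true] at hl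
  rw [comp_lt_t hl.2.symm, comp_lt_t hl.1.symm, ← map_add,
    ← comp_mul_left fun a => (M.P_e_comm i j l a hl.2 hl.1).symm,
    M.e_mul_t_add_t hij hl.2 hl.1, map_zero]

end ColoredBrauer

/-! ### Moments and eigenvalues of the Jucys-Murphy operators -/

/-- The matrix of the Jucys-Murphy operator `jm₂` on the span of the operators `P i b * e i j`. -/
def jmStep {F : Type u} [Field F] {r : ℕ} (δ u x : Fin r → F) (b : Fin r) : F :=
  u b * x b - (if b.rev < b then x b.rev else 0) + ∑ c, if c < b then δ c * x c else 0

/-- The coordinates of `jm₂ ^ k * e i j` with respect to the operators `P i b * e i j`. -/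
def jmCoord {F : Type u} [Field F] {r : ℕ} (δ u : Fin r → F) : ℕ → Fin r → F
  | 0 => 1
  | k + 1 => jmStep δ u (jmCoord δ u k)

/-- The scalars by which `e i j * jm u i ^ k * e i j` is a multiple of `e i j`. -/
def jmMoment {F : Type u} [Field F] {r : ℕ} (δ u : Fin r → F) (k : ℕ) : F :=
  ∑ b, δ b * jmCoord δ u k b

namespace ColoredBrauer

variable {I : Type} [DecidableEq I] {F : Type u} [Field F] {A : Type u} [Ring A] [Algebra F A]
  {r : ℕ} {δ : Fin r → F} (M : ColoredBrauer I A δ) {u : Fin r → F}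

theorem jm₂_mul_P_e {i j : I} (hij : i ≠ j) (c : Fin r) :
    M.jm₂ u i j * (M.P i c * M.e i j) = u c • (M.P i c * M.e i j) -
      (∑ b, if c < b then (if b = c.rev then M.P i b * M.e i j else 0) else 0) +
      ∑ b, if c < b then δ c • (M.P i b * M.e i j) else 0 := by
  have h1 : ∀ b, M.P i b * M.s i j * M.P i c * M.e i j =
      if b = c.rev then M.P i b * M.e i j else 0 := fun b => by
    have := M.P_e i j c.rev hij
    rw [Fin.rev_rev] at this
    rw [mul_assoc (M.P i b), s_P_left, mul_assoc, mul_assoc, s_mul_e _ hij, ← this, ← mul_assoc,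
      M.P_mul, ite_mul, zero_mul]
  rw [jm₂, sub_mul, ← mul_assoc, D_mul_P, smul_mul_assoc, ← mul_assoc, comp_mul_P,
    Finset.sum_mul, sub_add, ← Finset.sum_sub_distrib]
  congr 1
  refine Finset.sum_congr rfl fun b _ => ?_
  split_ifs with hcb hb
  · rw [t, mul_sub, sub_mul, sub_mul, h1, if_pos hb, mul_assoc (M.P i b), mul_assoc (M.P i b),
      M.e_P_e i j c hij, mul_smul_comm]
  · rw [t, mul_sub, sub_mul, sub_mul, h1, if_neg hb, mul_assoc (M.P i b), mul_assoc (M.P i b),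
      M.e_P_e i j c hij, mul_smul_comm]
  · rw [zero_mul, sub_zero]

theorem jm₂_mul_sum {i j : I} (hij : i ≠ j) (x : Fin r → F) :
    M.jm₂ u i j * ∑ c, x c • (M.P i c * M.e i j) =
      ∑ b, jmStep δ u x b • (M.P i b * M.e i j) := by
  simp only [Finset.mul_sum, mul_smul_comm, M.jm₂_mul_P_e hij, smul_add, smul_sub, smul_smul,
    Finset.sum_add_distrib, Finset.sum_sub_distrib, jmStep, add_smul, sub_smul, Finset.sum_smul]
  congr 1
  · congr 1
    · simp only [mul_comm]
    · simp only [Finset.smul_sum]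
      rw [Finset.sum_comm]
      refine Finset.sum_congr rfl fun b _ => ?_
      rw [Finset.sum_eq_single b.rev]
      · rw [Fin.rev_rev, if_pos rfl]
        split_ifs <;> simp
      · intro c _ hc
        have hb : b ≠ c.rev := fun h => hc (by rw [h, Fin.rev_rev])
        simp [hb]
      · simp
  · simp only [Finset.smul_sum]
    rw [Finset.sum_comm]
    refine Finset.sum_congr rfl fun b _ => Finset.sum_congr rfl fun c _ => ?_
    split_ifs
    · rw [smul_smul, mul_comm]
    · simp

/-- The operators whose values involve only tensors with a colour at `j` greater than the dual of
the colour at `i`. -/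
def above (i j : I) : Submodule F A where
  carrier := {X | ∀ p q : Fin r, q ≤ p.rev → M.P i p * (M.P j q * X) = 0}
  add_mem' {X Y} hX hY p q h := by rw [mul_add, mul_add, hX p q h, hY p q h, add_zero]
  zero_mem' p q _ := by simp
  smul_mem' x X hX p q h := by rw [mul_smul_comm, mul_smul_comm, hX p q h, smul_zero]

theorem comp_t_mul_mem_above {i j l : I} (hij : i ≠ j) (hl : l ≠ j) {X : A}
    (hX : X ∈ M.above i j) : M.comp i (· < ·) (M.t i l) * X ∈ M.above i j := by
  intro p q hpq
  rw [← mul_assoc, M.P_comm i j, mul_assoc, ← mul_assoc (M.P i p), P_mul_comp, Finset.sum_mul,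
    Finset.mul_sum]
  refine Finset.sum_eq_zero fun a _ => ?_
  split_ifs with hap
  · rw [← mul_assoc, ← mul_assoc, ← mul_assoc, M.P_comm j i, mul_assoc (M.P i p),
      ← (M.commute_t_P hij.symm hl.symm q).eq, mul_assoc, mul_assoc, mul_assoc,
      ← mul_assoc (M.P j q), M.P_comm j i, mul_assoc (M.P i a),
      hX a q (hpq.trans (Fin.rev_le_rev.2 hap.le)), mul_zero, mul_zero]
  · simp

theorem comp_t_mul_mem_above_self {i j : I} (hij : i ≠ j) {X : A}
    (hX : X ∈ M.above i j) : M.comp i (· < ·) (M.t i j) * X ∈ M.above i j := by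
  intro p q hpq
  rw [← mul_assoc, M.P_comm i j, mul_assoc, ← mul_assoc (M.P i p), P_mul_comp, Finset.sum_mul,
    Finset.mul_sum]
  refine Finset.sum_eq_zero fun a _ => ?_
  split_ifs with hap
  · have h1 : M.e i j * (M.P i a * X) = 0 := by
      rw [← M.P_self i a, mul_assoc, ← mul_assoc (M.e i j), M.e_P i j a hij, mul_assoc,
        ← mul_assoc (M.P j _), M.P_comm j i, mul_assoc, hX a a.rev le_rfl, mul_zero]
    have h2 : M.P j q * (M.P i p * (M.s i j * (M.P i a * X))) = 0 := by
      rw [← mul_assoc (M.P i p), ← s_P_right, mul_assoc, ← mul_assoc (M.P j q), ← s_P_left,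
        mul_assoc, ← mul_assoc (M.P j p), M.P_comm j i, mul_assoc, ← mul_assoc (M.P i q), M.P_mul]
      split_ifs with hqa
      · rw [hX q p (by rw [← Fin.rev_le_rev, Fin.rev_rev]; exact hpq), mul_zero]
      · simp
    rw [mul_assoc, mul_assoc, t, sub_mul, h1, sub_zero, h2]
  · simp

theorem comp_t_mul_P_e_mem_above {i j l : I} (hij : i ≠ j) (hl : l ≠ j) (c : Fin r) :
    M.comp i (· < ·) (M.t i l) * (M.P i c * M.e i j) ∈ M.above i j := by
  intro p q hpq
  rw [← mul_assoc, M.P_comm i j, mul_assoc, ← mul_assoc (M.P i p), ← mul_assoc (M.P i p * _),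
    P_mul_comp_mul_P]
  split_ifs with hcp
  · have hne : q ≠ c.rev := fun h =>
      absurd (Fin.rev_lt_rev.2 hcp) (not_lt.2 (h ▸ hpq))
    have h : M.P i c * (M.P j q * M.e i j) = 0 := by
      have := M.P_e i j q.rev hij
      rw [Fin.rev_rev] at this
      rw [← this, ← mul_assoc, M.P_mul, if_neg, zero_mul]
      rintro rfl
      exact hne (Fin.rev_rev q).symm
    rw [← mul_assoc, ← mul_assoc, ← mul_assoc, M.P_comm j i, mul_assoc (M.P i p),
      ← (M.commute_t_P hij.symm hl.symm q).eq, mul_assoc, mul_assoc, mul_assoc,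
      ← mul_assoc (M.P j q), M.P_comm j i, mul_assoc (M.P i c), h, mul_zero, mul_zero]
  · simp

theorem D_mul_mem_above {i j : I} {X : A} (hX : X ∈ M.above i j) :
    M.D u i * X ∈ M.above i j := by
  intro p q hpq
  rw [← mul_assoc (M.P j q), ← (M.commute_D_P u i j q).eq, mul_assoc, ← mul_assoc, P_mul_D,
    smul_mul_assoc, hX p q hpq, smul_zero]

theorem e_mul_of_mem_above {i j : I} (hij : i ≠ j) {X : A} (hX : X ∈ M.above i j) :
    M.e i j * X = 0 := by
  rw [← one_mul X, ← M.P_sum i, Finset.sum_mul, Finset.mul_sum]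
  refine Finset.sum_eq_zero fun a _ => ?_
  rw [← M.P_self i a, mul_assoc, ← mul_assoc, M.e_P i j a hij, mul_assoc, ← mul_assoc (M.P j _),
    M.P_comm j i, mul_assoc, hX a a.rev le_rfl, mul_zero]

variable [Fintype I]

/-- Modulo operators killed by `e i j`, the powers of `jm` act on `e i j` like those of `jm₂`. -/
theorem jm_pow_mul_e_sub_mem_above {i j : I} (hij : i ≠ j) (k : ℕ) :
    M.jm u i ^ k * M.e i j - ∑ b, jmCoord δ u k b • (M.P i b * M.e i j) ∈ M.above i j := by
  induction k with
  | zero =>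
    have : M.jm u i ^ 0 * M.e i j - ∑ b, jmCoord δ u 0 b • (M.P i b * M.e i j) = 0 := by
      simp only [jmCoord, Pi.one_apply, one_smul, ← Finset.sum_mul, M.P_sum, pow_zero, sub_self]
    rw [this]
    exact zero_mem _
  | succ k ih =>
    set Z := ∑ b, jmCoord δ u k b • (M.P i b * M.e i j) with hZ
    have e1 : M.jm u i ^ (k + 1) * M.e i j -
        ∑ b, jmCoord δ u (k + 1) b • (M.P i b * M.e i j) =
        M.jm u i * (M.jm u i ^ k * M.e i j - Z) -
          (∑ l ∈ (Finset.univ.erase i).erase j, M.comp i (· < ·) (M.t i l)) * Z := by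
      rw [jmCoord, ← M.jm₂_mul_sum hij, ← hZ, pow_succ', mul_sub, mul_assoc, sub_sub,
        ← add_mul]
      congr 2
      rw [M.jm_eq i j hij, sub_add_cancel]
    rw [e1]
    refine sub_mem ?_ ?_
    · generalize M.jm u i ^ k * M.e i j - Z = Y at ih ⊢
      rw [M.jm_eq i j hij, jm₂, sub_mul, sub_mul, Finset.sum_mul]
      refine sub_mem (sub_mem (M.D_mul_mem_above ih) (M.comp_t_mul_mem_above_self hij ih)) ?_
      refine sum_mem fun l hl => M.comp_t_mul_mem_above hij ?_ ih
      exact (Finset.mem_erase.1 hl).1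
    · rw [Finset.sum_mul]
      refine sum_mem fun l hl => ?_
      rw [hZ, Finset.mul_sum]
      refine sum_mem fun b _ => ?_
      rw [mul_smul_comm]
      exact Submodule.smul_mem _ _
        (M.comp_t_mul_P_e_mem_above hij (Finset.mem_erase.1 hl).1 b)

theorem e_mul_jm_pow_mul_e {i j : I} (hij : i ≠ j) (k : ℕ) :
    M.e i j * M.jm u i ^ k * M.e i j = jmMoment δ u k • M.e i j := by
  have h := M.e_mul_of_mem_above hij (M.jm_pow_mul_e_sub_mem_above (u := u) hij k)
  rw [mul_sub, sub_eq_zero, ← mul_assoc] at h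
  rw [h, Finset.mul_sum, jmMoment, Finset.sum_smul]
  refine Finset.sum_congr rfl fun b _ => ?_
  rw [mul_smul_comm, ← mul_assoc, M.e_P_e i j b hij, smul_smul, mul_comm]

/-- The Jucys-Murphy operator is triangular with respect to the colour at its position. -/
theorem aeval_jm_prod (i : I) :
    aeval (M.jm u i) (∏ c, (X - C (u c))) = 0 := by
  have key : ∀ k ≤ r, ∀ p : Fin r, (p : ℕ) < k →
      M.P i p * aeval (M.jm u i) (∏ c with c.val < k, (X - C (u c))) = 0 := by
    intro k
    induction k with
    | zero => intro _ p hp; simp at hp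
    | succ k ih =>
      intro hk p hp
      have hfilter : (Finset.univ.filter fun c : Fin r => c.val < k + 1) =
          insert ⟨k, hk⟩ (Finset.univ.filter fun c : Fin r => c.val < k) := by
        ext c
        simp only [Finset.mem_filter, Finset.mem_univ, true_and, Finset.mem_insert, Fin.ext_iff]
        omega
      rw [hfilter, Finset.prod_insert (by simp), map_mul]
      set Z := aeval (M.jm u i) (∏ c with c.val < k, (X - C (u c)))
      rw [map_sub, aeval_X, aeval_C, ← mul_assoc, jm, mul_sub, mul_sub, P_mul_D, P_mul_comp,
        sub_mul, sub_mul, Finset.sum_mul, Finset.sum_eq_zero, sub_zero, ← Algebra.commutes,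
        ← Algebra.smul_def, smul_mul_assoc, smul_mul_assoc, ← sub_smul]
      · rcases Nat.lt_succ_iff_lt_or_eq.1 hp with h | h
        · rw [ih (Nat.le_of_succ_le hk) p h, smul_zero]
        · rw [show p = ⟨k, hk⟩ from Fin.ext h, sub_self, zero_smul]
      · intro a _
        split_ifs with hap
        · rw [mul_assoc, ih (Nat.le_of_succ_le hk) a (by omega), mul_zero]
        · rw [zero_mul]
  have h := key r le_rfl
  rw [Finset.filter_true_of_mem fun c _ => c.isLt] at h
  rw [← one_mul (aeval _ _), ← M.P_sum i, Finset.sum_mul]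
  exact Finset.sum_eq_zero fun p _ => h p p.isLt

end ColoredBrauer

/-! ### Actions of the degenerate affine BMW algebra -/

/-- A presentation of the degenerate affine BMW algebra with the single polynomial generator `y`,
standing for `y_1`; the other `y_j` are determined by the skein relations. -/
structure DegBMWAction (n : ℕ) {F : Type u} [Field F] (ω : ℕ → F) (A : Type u) [Ring A]
    [Algebra F A] where
  /-- The image of `s_i`. -/
  s : ℕ → A
  /-- The image of `e_i`. -/
  e : ℕ → A
  /-- The image of `y_1`. -/
  y : A
  s_s : ∀ i, 1 ≤ i → i < n → s i * s i = 1
  s_comm : ∀ i j, 1 ≤ i → i + 2 ≤ j → j < n → Commute (s i) (s j)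
  s_comm_e : ∀ i j, 1 ≤ i → i + 2 ≤ j → j < n → Commute (s i) (e j)
  e_comm_s : ∀ i j, 1 ≤ i → i + 2 ≤ j → j < n → Commute (e i) (s j)
  e_comm : ∀ i j, 1 ≤ i → i + 2 ≤ j → j < n → Commute (e i) (e j)
  braid : ∀ i, 1 ≤ i → i + 1 < n → s i * s (i + 1) * s i = s (i + 1) * s i * s (i + 1)
  e_s : ∀ i, 1 ≤ i → i < n → e i * s i = e i
  s_e : ∀ i, 1 ≤ i → i < n → s i * e i = e i
  see : ∀ i, 1 ≤ i → i + 1 < n → s i * e (i + 1) * e i = s (i + 1) * e i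
  ees : ∀ i, 1 ≤ i → i + 1 < n → e i * e (i + 1) * s i = e i * s (i + 1)
  ees' : ∀ i, 1 ≤ i → i + 1 < n → e (i + 1) * e i * s (i + 1) = e (i + 1) * s i
  see' : ∀ i, 1 ≤ i → i + 1 < n → s (i + 1) * e i * e (i + 1) = s i * e (i + 1)
  eee : ∀ i, 1 ≤ i → i + 1 < n → e i * e (i + 1) * e i = e i
  eee' : ∀ i, 1 ≤ i → i + 1 < n → e (i + 1) * e i * e (i + 1) = e (i + 1)
  e_e : ∀ i, 1 ≤ i → i < n → e i * e i = ω 0 • e i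
  e_y_e : ∀ a, 1 < n → e 1 * y ^ a * e 1 = ω a • e 1
  y_s : ∀ i, 2 ≤ i → i < n → Commute y (s i)
  y_e : ∀ i, 2 ≤ i → i < n → Commute y (e i)
  y_y : 1 < n → Commute y (s 1 * y * s 1 + s 1 - e 1)
  e_y_add : 1 < n → e 1 * (y + (s 1 * y * s 1 + s 1 - e 1)) = 0
  y_add_e : 1 < n → (y + (s 1 * y * s 1 + s 1 - e 1)) * e 1 = 0

namespace DegBMWAction

variable {n : ℕ} {F : Type u} [Field F] {ω : ℕ → F} {A : Type u} [Ring A] [Algebra F A]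
  (H : DegBMWAction n ω A)

/-- The image of `y_j`; the value at `0` is irrelevant. -/
def Y : ℕ → A
  | 0 => H.y
  | 1 => H.y
  | k + 2 => H.s (k + 1) * Y (k + 1) * H.s (k + 1) + H.s (k + 1) - H.e (k + 1)

theorem Y_succ {i : ℕ} (hi : 1 ≤ i) : H.Y (i + 1) = H.s i * H.Y i * H.s i + H.s i - H.e i := by
  obtain ⟨k, rfl⟩ := Nat.exists_eq_add_of_le' hi
  rfl

theorem commute_Y_of_lt {j : ℕ} (hj : 1 ≤ j) :
    ∀ i, j < i → i < n → Commute (H.Y j) (H.s i) ∧ Commute (H.Y j) (H.e i) := by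
  induction j, hj using Nat.le_induction with
  | base => exact fun i hi hin => ⟨H.y_s i hi hin, H.y_e i hi hin⟩
  | succ j hj ih =>
    intro i hi hin
    have h := ih i (by omega) hin
    rw [H.Y_succ hj]
    have h1 := H.s_comm j i hj hi hin
    have h2 := H.s_comm_e j i hj hi hin
    exact ⟨((((h1.mul_left h.1).mul_left h1).add_left h1).sub_left (H.e_comm_s j i hj hi hin)),
      ((((h2.mul_left h.2).mul_left h2).add_left h2).sub_left (H.e_comm j i hj hi hin))⟩

section words

variable {s s' e e' y : A}

/-- The induction step for the commutation of `y_{i+2}` with `s_i`, for `s = s_i`, `s' = s_{i+1}`,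
`e = e_i`, `e' = e_{i+1}` and `y = y_i`, where `y_{i+1}` and `y_{i+2}` are expressed by the skein
relations. -/
theorem word_s_commute (hs : s * s = 1) (hb : s * s' * s = s' * s * s')
    (hsee : s * e' * e = s' * e) (hees : e * e' * s = e * s')
    (hees' : e' * e * s' = e' * s) (hsee' : s' * e * e' = s * e')
    (hy : Commute y s') : Commute (s' * (s * y * s + s - e) * s' + s' - e') s := by
  have a1 : s * (s' * (s * y * s) * s') = s' * (s * y * s) * s' * s := by
    calc s * (s' * (s * y * s) * s') = (s * s' * s) * y * (s * s') := by simp only [mul_assoc]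
      _ = s' * s * (s' * y) * (s * s') := by rw [hb]; simp only [mul_assoc]
      _ = s' * s * y * (s' * s * s') := by rw [← hy.eq]; simp only [mul_assoc]
      _ = s' * (s * y * s) * s' * s := by rw [← hb]; simp only [mul_assoc]
  have a2 : s * (s' * s * s') = s' * s := by
    rw [← hb, mul_assoc s s' s, ← mul_assoc, hs, one_mul]
  have a3 : s' * s * s' * s = s * s' := by
    rw [← hb, mul_assoc, hs, mul_one]
  have b1 : s * s' * e = e' * e := by
    rw [mul_assoc, ← hsee, mul_assoc, ← mul_assoc, hs, one_mul]
  have b2 : e * s' * s = e * e' := by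
    rw [← hees, mul_assoc, hs, mul_one]
  have a4 : s * (s' * e * s') = e' * s := by
    rw [← mul_assoc, ← mul_assoc, b1, hees']
  have a5 : s' * e * s' * s = s * e' := by
    rw [mul_assoc, mul_assoc, ← mul_assoc e, b2, ← mul_assoc, hsee']
  have e1 : s' * (s * y * s + s - e) * s' + s' - e' =
      s' * (s * y * s) * s' + s' * s * s' - s' * e * s' + s' - e' := by noncomm_ring
  rw [Commute, SemiconjBy, e1]
  simp only [mul_add, mul_sub, add_mul, sub_mul, a1, a2, a3, a4, a5]
  abel

theorem word_e_commute (hs : s * s = 1) (hs' : s' * s' = 1) (hse : s * e = e)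
    (hse' : s' * e' = e') (hes' : e' * s' = e')
    (hsee : s * e' * e = s' * e) (hees : e * e' * s = e * s')
    (hees' : e' * e * s' = e' * s) (hsee' : s' * e * e' = s * e') (heee : e * e' * e = e)
    (hy : Commute y e') : Commute (s' * (s * y * s + s - e) * s' + s' - e') e := by
  have b1 : s * s' * e = e' * e := by
    rw [mul_assoc, ← hsee, mul_assoc, ← mul_assoc, hs, one_mul]
  have b2 : e * s' * s = e * e' := by
    rw [← hees, mul_assoc, hs, mul_one]
  have b3 : e' * s * s' = e' * e := by
    rw [← hees', mul_assoc, hs', mul_one]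
  have b4 : s' * s * e' = e * e' := by
    rw [mul_assoc, ← hsee', ← mul_assoc, ← mul_assoc, hs', one_mul]
  have b5 : e * s' * e = e := by
    rw [← hees, mul_assoc, hse, heee]
  have a1 : e * (s' * (s * y * s) * s') = e * y * e' * e := by
    calc e * (s' * (s * y * s) * s') = (e * s' * s) * y * (s * s') := by simp only [mul_assoc]
      _ = e * (e' * y) * (s * s') := by rw [b2]; simp only [mul_assoc]
      _ = e * y * (e' * s * s') := by rw [← hy.eq]; simp only [mul_assoc]
      _ = e * y * e' * e := by rw [b3]; simp only [mul_assoc]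
  have a2 : s' * (s * y * s) * s' * e = e * y * e' * e := by
    calc s' * (s * y * s) * s' * e = s' * s * y * (s * s' * e) := by simp only [mul_assoc]
      _ = s' * s * (y * e') * e := by rw [b1]; simp only [mul_assoc]
      _ = (s' * s * e') * y * e := by rw [hy.eq]; simp only [mul_assoc]
      _ = e * (e' * y) * e := by rw [b4]; simp only [mul_assoc]
      _ = e * y * e' * e := by rw [← hy.eq]; simp only [mul_assoc]
  have a3 : e * (s' * s * s') = e * e' := by
    rw [← mul_assoc, ← mul_assoc, b2, mul_assoc, hes']
  have a4 : s' * s * s' * e = e' * e := by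
    rw [mul_assoc, mul_assoc, ← mul_assoc s, b1, ← mul_assoc, hse']
  have a5 : e * (s' * e * s') = e * s' := by
    rw [← mul_assoc, ← mul_assoc, b5]
  have a6 : s' * e * s' * e = s' * e := by
    rw [mul_assoc, mul_assoc, ← mul_assoc e, b5]
  have e1 : s' * (s * y * s + s - e) * s' + s' - e' =
      s' * (s * y * s) * s' + s' * s * s' - s' * e * s' + s' - e' := by noncomm_ring
  rw [Commute, SemiconjBy, e1]
  simp only [mul_add, mul_sub, add_mul, sub_mul, a1, a2, a3, a4, a5, a6]
  abel

theorem word_e_add {w : F} (hs : s * s = 1) (hb : s * s' * s = s' * s * s') (hes : e * s = e)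
    (hes' : e' * s' = e') (hs' : s' * s' = 1) (hees' : e' * e * s' = e' * s)
    (hee : e * e = w • e) (hee' : e' * e' = w • e') (hy : Commute y s')
    (h : e * (y + (s * y * s + s - e)) = 0) :
    e' * ((s * y * s + s - e) + (s' * (s * y * s + s - e) * s' + s' - e')) = 0 := by
  have h1 : e * y * (1 + s) = w • e - e := by
    rw [mul_add, mul_sub, mul_add, ← mul_assoc e, ← mul_assoc e, hes, hee] at h
    rw [← sub_eq_zero, ← h]
    noncomm_ring
  have b3 : e' * s * s' = e' * e := by
    rw [← hees', mul_assoc, hs', mul_one]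
  have h2 : e' * (s * y * s) * (1 + s') = w • e' - e' := by
    calc e' * (s * y * s) * (1 + s') = (e' * s) * y * s * (1 + s') := by simp only [mul_assoc]
      _ = e' * e * (s' * y) * s * (1 + s') := by rw [← hees']; simp only [mul_assoc]
      _ = e' * e * y * (s' * s + s' * s * s') := by rw [← hy.eq]; noncomm_ring
      _ = e' * (e * y * (1 + s)) * (s' * s) := by rw [← hb]; noncomm_ring
      _ = w • (e' * e * s' * s) - e' * e * s' * s := by
        rw [h1, mul_sub, mul_smul_comm, sub_mul, smul_mul_assoc, ← mul_assoc]
      _ = w • e' - e' := by rw [hees', mul_assoc, hs, mul_one]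
  have e1 : e' * ((s * y * s + s - e) + (s' * (s * y * s + s - e) * s' + s' - e')) =
      e' * (s * y * s) + e' * s - e' * e + ((e' * s') * (s * y * s + s - e) * s' + e' * s' -
        e' * e') := by noncomm_ring
  rw [e1, hes', hee']
  have e2 : e' * (s * y * s + s - e) * s' = e' * (s * y * s) * s' + e' * s * s' - e' * e * s' := by
    noncomm_ring
  rw [e2, b3, hees']
  rw [mul_add, mul_one] at h2
  rw [← sub_eq_zero] at h2
  rw [← h2]
  abel

theorem word_add_e {w : F} (hs : s * s = 1) (hb : s * s' * s = s' * s * s') (hse : s * e = e)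
    (hse' : s' * e' = e') (hs' : s' * s' = 1) (hsee' : s' * e * e' = s * e')
    (hee : e * e = w • e) (hee' : e' * e' = w • e') (hy : Commute y s')
    (h : (y + (s * y * s + s - e)) * e = 0) :
    ((s * y * s + s - e) + (s' * (s * y * s + s - e) * s' + s' - e')) * e' = 0 := by
  have h1 : (1 + s) * y * e = w • e - e := by
    rw [add_mul, sub_mul, add_mul, mul_assoc (s * y), hse, hee] at h
    rw [← sub_eq_zero, ← h]
    noncomm_ring
  have b3 : s' * s * e' = e * e' := by
    rw [mul_assoc, ← hsee', ← mul_assoc, ← mul_assoc, hs', one_mul]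
  have h2 : (1 + s') * (s * y * s) * e' = w • e' - e' := by
    calc (1 + s') * (s * y * s) * e' = (1 + s') * s * y * (s * e') := by simp only [mul_assoc]
      _ = (1 + s') * s * (y * s') * (e * e') := by rw [← hsee']; simp only [mul_assoc]
      _ = (s * s' + s' * s * s') * y * (e * e') := by rw [hy.eq]; noncomm_ring
      _ = s * s' * ((1 + s) * y * e) * e' := by rw [← hb]; noncomm_ring
      _ = w • (s * (s' * e * e')) - s * (s' * e * e') := by
        rw [h1, mul_sub, mul_smul_comm, sub_mul, smul_mul_assoc]; simp only [mul_assoc]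
      _ = w • e' - e' := by rw [hsee', ← mul_assoc, hs, one_mul]
  have e1 : ((s * y * s + s - e) + (s' * (s * y * s + s - e) * s' + s' - e')) * e' =
      s * y * s * e' + s * e' - e * e' + (s' * (s * y * s + s - e) * (s' * e') + s' * e' -
        e' * e') := by noncomm_ring
  rw [e1, hse', hee']
  have e2 : s' * (s * y * s + s - e) * e' = s' * (s * y * s) * e' + s' * s * e' - s' * e * e' := by
    noncomm_ring
  rw [e2, b3, hsee']
  rw [add_mul, add_mul, one_mul] at h2
  rw [← sub_eq_zero] at h2
  rw [← h2]
  abel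

end words

theorem commute_Y_of_gt {i : ℕ} (hi : 1 ≤ i) {j : ℕ} (hj : i + 2 ≤ j) (hjn : j ≤ n) :
    Commute (H.Y j) (H.s i) ∧ Commute (H.Y j) (H.e i) := by
  induction j, hj using Nat.le_induction with
  | base =>
    have hi1 : i + 1 < n := by omega
    have hin : i < n := by omega
    have hi' : 1 ≤ i + 1 := by omega
    rw [H.Y_succ hi', H.Y_succ hi]
    have hy := H.commute_Y_of_lt hi (i + 1) (by omega) hi1
    exact ⟨word_s_commute (H.s_s i hi hin) (H.braid i hi hi1) (H.see i hi hi1)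
      (H.ees i hi hi1) (H.ees' i hi hi1) (H.see' i hi hi1) hy.1,
      word_e_commute (H.s_s i hi hin) (H.s_s _ hi' hi1) (H.s_e i hi hin)
        (H.s_e _ hi' hi1) (H.e_s _ hi' hi1) (H.see i hi hi1)
        (H.ees i hi hi1) (H.ees' i hi hi1) (H.see' i hi hi1) (H.eee i hi hi1) hy.2⟩
  | succ j hj ih =>
    have h := ih (by omega)
    have hjn' : j < n := by omega
    have hj1 : 1 ≤ j := by omega
    rw [H.Y_succ hj1]
    have h1 := (H.s_comm i j hi hj hjn').symm
    have h2 := (H.e_comm_s i j hi hj hjn').symm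
    exact ⟨((((h1.mul_left h.1).mul_left h1).add_left h1).sub_left
        (H.s_comm_e i j hi hj hjn').symm),
      ((((h2.mul_left h.2).mul_left h2).add_left h2).sub_left (H.e_comm i j hi hj hjn').symm)⟩

theorem e_mul_Y_add {i : ℕ} (hi : 1 ≤ i) (hin : i < n) :
    H.e i * (H.Y i + H.Y (i + 1)) = 0 := by
  induction i, hi using Nat.le_induction with
  | base => exact H.e_y_add hin
  | succ i hi ih =>
    have hin' : i < n := by omega
    have hi' : 1 ≤ i + 1 := by omega
    have h := ih hin'
    rw [H.Y_succ hi] at h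
    rw [H.Y_succ hi', H.Y_succ hi]
    exact word_e_add (H.s_s i hi hin') (H.braid i hi hin) (H.e_s i hi hin') (H.e_s _ hi' hin)
      (H.s_s _ hi' hin) (H.ees' i hi hin) (H.e_e i hi hin') (H.e_e _ hi' hin)
      (H.commute_Y_of_lt hi (i + 1) (by omega) hin).1 h

theorem Y_add_mul_e {i : ℕ} (hi : 1 ≤ i) (hin : i < n) :
    (H.Y i + H.Y (i + 1)) * H.e i = 0 := by
  induction i, hi using Nat.le_induction with
  | base => exact H.y_add_e hin
  | succ i hi ih =>
    have hin' : i < n := by omega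
    have hi' : 1 ≤ i + 1 := by omega
    have h := ih hin'
    rw [H.Y_succ hi] at h
    rw [H.Y_succ hi', H.Y_succ hi]
    exact word_add_e (H.s_s i hi hin') (H.braid i hi hin) (H.s_e i hi hin') (H.s_e _ hi' hin)
      (H.s_s _ hi' hin) (H.see' i hi hin) (H.e_e i hi hin') (H.e_e _ hi' hin)
      (H.commute_Y_of_lt hi (i + 1) (by omega) hin).1 h

theorem commute_Y_Y {i : ℕ} (hi : 1 ≤ i) :
    ∀ j, i < j → j ≤ n → Commute (H.Y i) (H.Y j) := by
  induction i, hi using Nat.le_induction with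
  | base =>
    intro j hj
    induction j, hj using Nat.le_induction with
    | base => exact fun hn => H.y_y hn
    | succ j hj ih =>
      intro hjn
      have h := H.commute_Y_of_lt le_rfl j hj hjn
      rw [H.Y_succ (i := j) (by omega)]
      exact (((h.1.mul_right (ih (by omega))).mul_right h.1).add_right h.1).sub_right h.2
  | succ i hi ih =>
    intro j hj hjn
    have h := H.commute_Y_of_gt hi hj hjn
    have h1 := h.1.symm
    rw [H.Y_succ hi]
    exact (((h1.mul_left (ih j (by omega) hjn)).mul_left h1).add_left h1).sub_left h.2.symm

/-- The images of the generators. -/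
def gen : DegBMWGen n → A
  | .s i _ => H.s i
  | .e i _ => H.e i
  | .y j _ => H.Y j

theorem add_two_le_or_add_two_le {i j : ℕ} (h : 1 < |(i : ℤ) - (j : ℤ)|) :
    i + 2 ≤ j ∨ j + 2 ≤ i := by
  rcases lt_abs.1 h with h | h <;> omega

/-- The homomorphism given by the presentation. -/
def hom : DegAffBMW n ω →ₐ[F] A :=
  RingQuot.liftAlgHom F ⟨FreeAlgebra.lift F H.gen, by
    intro x y h
    have hs : ∀ i hi, FreeAlgebra.lift F H.gen (DegBMWFree.s F i hi) = H.s i := fun i hi => by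
      rw [DegBMWFree.s, FreeAlgebra.lift_ι_apply]; rfl
    have he : ∀ i hi, FreeAlgebra.lift F H.gen (DegBMWFree.e F i hi) = H.e i := fun i hi => by
      rw [DegBMWFree.e, FreeAlgebra.lift_ι_apply]; rfl
    have hy : ∀ i hi, FreeAlgebra.lift F H.gen (DegBMWFree.y F i hi) = H.Y i := fun i hi => by
      rw [DegBMWFree.y, FreeAlgebra.lift_ι_apply]; rfl
    cases h <;> simp only [map_mul, map_add, map_sub, map_pow, map_smul, map_one, map_zero,
      hs, he, hy]
    case involution i hi => exact H.s_s i hi.1 hi.2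
    case s_comm_s i j hi hj hij =>
      rcases add_two_le_or_add_two_le hij with h | h
      · exact H.s_comm i j hi.1 h hj.2
      · exact (H.s_comm j i hj.1 h hi.2).symm
    case braid i hi hi' => exact H.braid i hi.1 hi'.2
    case s_comm_y i j hi hj h h' =>
      rcases lt_or_ge i j with hij | hij
      · exact (H.commute_Y_of_gt hi.1 (by omega) hj.2).1.symm
      · exact (H.commute_Y_of_lt hj.1 i (by omega) hi.2).1.symm
    case idempotent i hi => exact H.e_e i hi.1 hi.2
    case compression a ha he' hy' => exact H.e_y_e a he'.2
    case s_comm_e i j hi hj hij =>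
      rcases add_two_le_or_add_two_le hij with h | h
      · exact H.s_comm_e i j hi.1 h hj.2
      · exact (H.e_comm_s j i hj.1 h hi.2).symm
    case e_comm_e i j hi hj hij =>
      rcases add_two_le_or_add_two_le hij with h | h
      · exact H.e_comm i j hi.1 h hj.2
      · exact (H.e_comm j i hj.1 h hi.2).symm
    case e_comm_y i j hi hj h h' =>
      rcases lt_or_ge i j with hij | hij
      · exact (H.commute_Y_of_gt hi.1 (by omega) hj.2).2.symm
      · exact (H.commute_Y_of_lt hj.1 i (by omega) hi.2).2.symm
    case y_comm_y i j hi hj =>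
      rcases lt_trichotomy i j with h | h | h
      · exact H.commute_Y_Y hi.1 j h hj.2
      · rw [h]
      · exact (H.commute_Y_Y hj.1 i h hi.2).symm
    case e_mul_s i hi => exact H.e_s i hi.1 hi.2
    case s_mul_e i hi => exact H.s_e i hi.1 hi.2
    case tangle_see i hi hi' => exact H.see i hi.1 hi'.2
    case tangle_ees i hi hi' => exact H.ees i hi.1 hi'.2
    case tangle_ees' i hi hi' => exact H.ees' i hi.1 hi'.2
    case tangle_see' i hi hi' => exact H.see' i hi.1 hi'.2
    case tangle_eee' i hi hi' => exact H.eee' i hi.1 hi'.2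
    case tangle_eee i hi hi' => exact H.eee i hi.1 hi'.2
    case skein i hi hy1 hy2 =>
      rw [H.Y_succ hi.1, sub_mul, add_mul, mul_assoc _ (H.s i) (H.s i), H.s_s i hi.1 hi.2, mul_one,
        H.e_s i hi.1 hi.2]
      abel
    case skein' i hi hy1 hy2 =>
      rw [H.Y_succ hi.1, mul_sub, mul_add, ← mul_assoc, ← mul_assoc, H.s_s i hi.1 hi.2, one_mul,
        H.s_e i hi.1 hi.2]
      abel
    case antisymm i hi hy1 hy2 => exact H.e_mul_Y_add hi.1 hi.2
    case antisymm' i hi hy1 hy2 => exact H.Y_add_mul_e hi.1 hi.2⟩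

theorem hom_mk (x : FreeAlgebra F (DegBMWGen n)) :
    H.hom (DegAffBMW.mk ω x) = FreeAlgebra.lift F H.gen x :=
  RingQuot.liftAlgHom_mkAlgHom_apply _ _ _ _

theorem hom_e (i : ℕ) (hi : 1 ≤ i ∧ i < n) : H.hom (DegAffBMW.e ω i hi) = H.e i := by
  rw [DegAffBMW.e, hom_mk, DegBMWFree.e, FreeAlgebra.lift_ι_apply]; rfl

theorem hom_y (i : ℕ) (hi : 1 ≤ i ∧ i ≤ n) : H.hom (DegAffBMW.y ω i hi) = H.Y i := by
  rw [DegAffBMW.y, hom_mk, DegBMWFree.y, FreeAlgebra.lift_ι_apply]; rfl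

end DegBMWAction

namespace ColoredBrauer

variable {I : Type} [DecidableEq I] {F : Type u} [Field F] {A : Type u} [Ring A] [Algebra F A]
  {r : ℕ} {δ : Fin r → F} (M : ColoredBrauer I A δ) {u : Fin r → F}

theorem s_mul_s_of_ne {i j k : I} (hik : i ≠ k) (hjk : j ≠ k) :
    M.s i j * M.s j k * M.s i j = M.s i k := by
  rw [s, s, s, ← map_mul, Equiv.mul_swap_eq_swap_mul (Equiv.swap i j), Equiv.swap_apply_right,
    Equiv.swap_apply_of_ne_of_ne hik.symm hjk.symm, map_mul, mul_assoc, ← map_mul,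
    Equiv.swap_mul_self, map_one, mul_one]

theorem braid {i j k : I} (hij : i ≠ j) (hik : i ≠ k) (hjk : j ≠ k) :
    M.s i j * M.s j k * M.s i j = M.s j k * M.s i j * M.s j k := by
  rw [M.s_mul_s_of_ne hik hjk, M.s_symm j k, M.s_symm i j, M.s_mul_s_of_ne hik.symm hij.symm,
    M.s_symm]

theorem s_mul_e_of_ne {i j k : I} (hik : i ≠ k) (hjk : j ≠ k) :
    M.s i j * M.e j k = M.e i k * M.s i j := by
  rw [s, M.σ_e, Equiv.swap_apply_right, Equiv.swap_apply_of_ne_of_ne hik.symm hjk.symm]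

theorem s_e_e {i j k : I} (hij : i ≠ j) (hik : i ≠ k) (hjk : j ≠ k) :
    M.s i j * M.e j k * M.e i j = M.s j k * M.e i j := by
  rw [M.s_mul_e_of_ne hik hjk, mul_assoc, M.s_mul_e hij, M.e_symm _ _ hij]
  exact M.e_e' _ _ _ hij.symm hik hjk

theorem e_e_s {i j k : I} (hij : i ≠ j) (hik : i ≠ k) (hjk : j ≠ k) :
    M.e i j * M.e j k * M.s i j = M.e i j * M.s j k := by
  rw [mul_assoc, M.s_symm, ← M.s_mul_e_of_ne hjk hik, ← mul_assoc, M.s_symm, M.e_mul_s hij,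
    M.e_symm _ _ hij]
  exact M.e_e _ _ _ hij.symm hik hjk

theorem e_e_e {i j k : I} (hij : i ≠ j) (hik : i ≠ k) (hjk : j ≠ k) :
    M.e i j * M.e j k * M.e i j = M.e i j := by
  have h : M.e i j * M.s i k = M.s i k * M.e j k := by
    rw [s, M.σ_e, Equiv.swap_apply_right, Equiv.swap_apply_of_ne_of_ne hij.symm hjk,
      M.e_symm _ _ hij]
  rw [M.e_e i j k hij hjk hik, ← s, h, mul_assoc, M.e_e' i j k hij hjk hik, ← s, ← mul_assoc,
    s_mul_s, one_mul]

theorem e_mul_e {i j : I} (hij : i ≠ j) : M.e i j * M.e i j = (∑ a, δ a) • M.e i j := by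
  rw [Finset.sum_smul, ← Finset.sum_congr rfl fun a _ => M.e_P_e i j a hij, ← Finset.sum_mul,
    ← Finset.mul_sum, M.P_sum, mul_one]

variable [Fintype I]

/-- The action of the degenerate affine BMW algebra on the positions `pos 1, …, pos n`. -/
def action (hδ : ∀ a, δ a = u a + u a.rev + if a = a.rev then 1 else 0) (n : ℕ) (pos : ℕ → I)
    (hpos : ∀ i j, i ≤ n → j ≤ n → pos i = pos j → i = j) :
    DegBMWAction n (jmMoment δ u) A :=
  have ne : ∀ {i j}, i ≤ n → j ≤ n → i ≠ j → pos i ≠ pos j := fun hi hj h h' =>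
    h (hpos _ _ hi hj h')
  have hw : jmMoment δ u 0 = ∑ a, δ a := by simp [jmMoment, jmCoord]
  have conj : ∀ i, M.s (pos i) (pos (i + 1)) * M.jm u (pos i) * M.s (pos i) (pos (i + 1)) =
      M.jm u (pos (i + 1)) := fun i => by
    rw [s, M.σ_jm, mul_assoc, ← s, s_mul_s, mul_one, Equiv.swap_apply_left]
  have y_two : M.s (pos 1) (pos 2) * M.jm u (pos 1) * M.s (pos 1) (pos 2) + M.s (pos 1) (pos 2) -
      M.e (pos 1) (pos 2) = M.jm u (pos 2) + M.t (pos 1) (pos 2) := by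
    rw [conj 1, t, add_sub_assoc]
  { s := fun i => M.s (pos i) (pos (i + 1))
    e := fun i => M.e (pos i) (pos (i + 1))
    y := M.jm u (pos 1)
    s_s := fun i _ _ => M.s_mul_s _ _
    s_comm := fun i j _ hij hj => by
      rw [Commute, SemiconjBy]
      simp only [s, ← map_mul]
      congr 1
      rw [Equiv.mul_swap_eq_swap_mul,
        Equiv.swap_apply_of_ne_of_ne (ne (by omega) (by omega) (by omega))
          (ne (by omega) (by omega) (by omega)),
        Equiv.swap_apply_of_ne_of_ne (ne (by omega) (by omega) (by omega))
          (ne (by omega) (by omega) (by omega))]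
    s_comm_e := fun i j _ hij hj => by
      rw [Commute, SemiconjBy, s, M.σ_e,
        Equiv.swap_apply_of_ne_of_ne (ne (by omega) (by omega) (by omega))
          (ne (by omega) (by omega) (by omega)),
        Equiv.swap_apply_of_ne_of_ne (ne (by omega) (by omega) (by omega))
          (ne (by omega) (by omega) (by omega))]
    e_comm_s := fun i j _ hij hj => by
      rw [Commute, SemiconjBy, s, M.σ_e,
        Equiv.swap_apply_of_ne_of_ne (ne (by omega) (by omega) (by omega))
          (ne (by omega) (by omega) (by omega)),
        Equiv.swap_apply_of_ne_of_ne (ne (by omega) (by omega) (by omega))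
          (ne (by omega) (by omega) (by omega))]
    e_comm := fun i j _ hij hj => M.e_comm _ _ _ _ (ne (by omega) (by omega) (by omega))
      (ne (by omega) (by omega) (by omega)) (ne (by omega) (by omega) (by omega))
      (ne (by omega) (by omega) (by omega)) (ne (by omega) (by omega) (by omega))
      (ne (by omega) (by omega) (by omega))
    braid := fun i _ hi => M.braid
        (ne (by omega) (by omega) (by omega))
        (ne (by omega) (by omega) (by omega))
        (ne (by omega) (by omega) (by omega))
    e_s := fun i _ hi => M.e_mul_s (ne (by omega) (by omega) (by omega))
    s_e := fun i _ hi => M.s_mul_e (ne (by omega) (by omega) (by omega))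
    see := fun i _ hi => M.s_e_e
        (ne (by omega) (by omega) (by omega))
        (ne (by omega) (by omega) (by omega))
        (ne (by omega) (by omega) (by omega))
    ees := fun i _ hi => M.e_e_s
        (ne (by omega) (by omega) (by omega))
        (ne (by omega) (by omega) (by omega))
        (ne (by omega) (by omega) (by omega))
    ees' := fun i _ hi => by
      rw [M.s_symm (pos (i + 1)), M.s_symm (pos i), M.e_symm (pos (i + 1)) _
        (ne (by omega) (by omega) (by omega)), M.e_symm (pos i) _
        (ne (by omega) (by omega) (by omega))]
      exact M.e_e_s
        (ne (by omega) (by omega) (by omega))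
        (ne (by omega) (by omega) (by omega))
        (ne (by omega) (by omega) (by omega))
    see' := fun i _ hi => by
      rw [M.s_symm (pos (i + 1)), M.s_symm (pos i), M.e_symm (pos (i + 1)) _
        (ne (by omega) (by omega) (by omega)), M.e_symm (pos i) _
        (ne (by omega) (by omega) (by omega))]
      exact M.s_e_e
        (ne (by omega) (by omega) (by omega))
        (ne (by omega) (by omega) (by omega))
        (ne (by omega) (by omega) (by omega))
    eee := fun i _ hi => M.e_e_e
        (ne (by omega) (by omega) (by omega))
        (ne (by omega) (by omega) (by omega))
        (ne (by omega) (by omega) (by omega))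
    eee' := fun i _ hi => by
      rw [M.e_symm (pos (i + 1)) _ (ne (by omega) (by omega) (by omega)),
        M.e_symm (pos i) _ (ne (by omega) (by omega) (by omega))]
      exact M.e_e_e
        (ne (by omega) (by omega) (by omega))
        (ne (by omega) (by omega) (by omega))
        (ne (by omega) (by omega) (by omega))
    e_e := fun i _ hi => by
      rw [M.e_mul_e (ne (by omega) (by omega) (by omega)), hw]
    e_y_e := fun a hn => M.e_mul_jm_pow_mul_e (ne (by omega) (by omega) (by omega)) a
    y_s := fun i hi hin => by
      rw [Commute, SemiconjBy, s, M.σ_jm, Equiv.swap_apply_of_ne_of_ne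
        (ne (by omega) (by omega) (by omega)) (ne (by omega) (by omega) (by omega))]
    y_e := fun i hi hin => M.commute_jm_e u (ne (by omega) (by omega) (by omega))
      (ne (by omega) (by omega) (by omega)) (ne (by omega) (by omega) (by omega))
    y_y := fun hn => by
      rw [y_two]
      exact M.commute_jm hδ _ _ (ne (by omega) (by omega) (by omega))
    e_y_add := fun hn => by
      rw [y_two]
      exact M.e_mul_jm_add hδ _ _ (ne (by omega) (by omega) (by omega))
    y_add_e := fun hn => by
      rw [y_two]
      exact M.jm_add_mul_e hδ _ _ (ne (by omega) (by omega) (by omega)) }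

end ColoredBrauer

/-! ### Polynomials attached to a moment sequence -/

namespace DegBMWPoly

variable {F : Type u} [Field F]

/-- The linear map from polynomials that takes the value `v k` at `X ^ k`. -/
def ofSeq {V : Type u} [AddCommGroup V] [Module F V] (v : ℕ → V) : F[X] →ₗ[F] V :=
  Polynomial.lsum fun k => LinearMap.toSpanSingleton F V (v k)

theorem ofSeq_monomial {V : Type u} [AddCommGroup V] [Module F V] (v : ℕ → V) (k : ℕ) (a : F) :
    ofSeq v (monomial k a) = a • v k := by
  simp [ofSeq]

theorem ofSeq_C {V : Type u} [AddCommGroup V] [Module F V] (v : ℕ → V) (a : F) :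
    ofSeq v (C a : F[X]) = a • v 0 := by
  rw [← monomial_zero_left (R := F), ofSeq_monomial]

theorem ofSeq_X_pow {V : Type u} [AddCommGroup V] [Module F V] (v : ℕ → V) (k : ℕ) :
    ofSeq v (X ^ k : F[X]) = v k := by
  rw [X_pow_eq_monomial, ofSeq_monomial, one_smul]

theorem ofSeq_mem_degreeLT {v : ℕ → F[X]} (hv : ∀ k, v k ∈ degreeLT F k) {f : F[X]} {m : ℕ}
    (hf : f.natDegree ≤ m) : ofSeq v f ∈ degreeLT F m := by
  rw [ofSeq, Polynomial.lsum_apply, Polynomial.sum]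
  refine sum_mem fun k hk => ?_
  rw [LinearMap.toSpanSingleton_apply]
  refine Submodule.smul_mem _ _ (degreeLT_mono ?_ (hv k))
  exact (le_natDegree_of_mem_supp k hk).trans hf

theorem induction_X_mul {p : F[X] → Prop} (f : F[X]) (hC : ∀ a, p (C a))
    (hadd : ∀ f g, p f → p g → p (f + g)) (hX : ∀ f, p f → p (X * f)) : p f := by
  induction f using Polynomial.induction_on' with
  | add f g hf hg => exact hadd f g hf hg
  | monomial k a =>
    induction k with
    | zero => rw [monomial_zero_left]; exact hC a
    | succ k ih => rw [← X_mul_monomial]; exact hX _ ih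

/-- The linear functional on polynomials with moments `ω k`. -/
def moment (ω : ℕ → F) : F[X] →ₗ[F] F := ofSeq ω

theorem moment_X_pow (ω : ℕ → F) (k : ℕ) : moment ω (X ^ k) = ω k := ofSeq_X_pow ω k

/-- The terms of `divDiff`. -/
def divDiffSeq (ω : ℕ → F) : ℕ → F[X]
  | 0 => 0
  | k + 1 => X * divDiffSeq ω k + C (ω k)

/-- The divided difference `(f x - f t) / (x - t)` as a polynomial in `t`, after the functional
`moment ω` has been applied with respect to `x`. -/
def divDiff (ω : ℕ → F) : F[X] →ₗ[F] F[X] := ofSeq (divDiffSeq ω)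

theorem divDiff_C (ω : ℕ → F) (a : F) : divDiff ω (C a) = 0 := by
  rw [divDiff, ofSeq_C, divDiffSeq, smul_zero]

theorem divDiff_X_mul (ω : ℕ → F) (f : F[X]) :
    divDiff ω (X * f) = X * divDiff ω f + C (moment ω f) := by
  induction f using Polynomial.induction_on' with
  | add f g hf hg =>
    rw [mul_add, map_add, hf, hg, map_add, map_add, C_add]
    ring
  | monomial k a =>
    rw [X_mul_monomial, divDiff, ofSeq_monomial, ofSeq_monomial, moment, ofSeq_monomial, divDiffSeq,
      smul_add, mul_smul_comm, smul_C]

theorem divDiffSeq_mem (ω : ℕ → F) (k : ℕ) : divDiffSeq ω k ∈ degreeLT F k := by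
  induction k with
  | zero => exact zero_mem _
  | succ k ih =>
    rw [divDiffSeq]
    refine add_mem ?_ ?_
    · rw [mem_degreeLT] at ih ⊢
      rw [mul_comm, degree_mul_X, Nat.cast_succ]
      by_cases h : divDiffSeq ω k = 0
      · rw [h, degree_zero, WithBot.bot_add]; exact WithBot.bot_lt_coe _
      · rw [degree_eq_natDegree h] at ih ⊢
        exact_mod_cast Nat.succ_lt_succ (by exact_mod_cast ih)
    · rw [mem_degreeLT]
      exact degree_C_le.trans_lt (by exact_mod_cast Nat.succ_pos k)

/-- The terms of `oddQuot`. -/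
def oddQuotSeq : ℕ → F[X]
  | 0 => 0
  | k + 1 => X ^ k - X * oddQuotSeq k

/-- The polynomial `(f t - f (-t)) / (2 t)`, that is, the odd part divided by `t`. -/
def oddQuot : F[X] →ₗ[F] F[X] := ofSeq oddQuotSeq

theorem oddQuot_C (a : F) : oddQuot (C a) = 0 := by
  rw [oddQuot, ofSeq_C, oddQuotSeq, smul_zero]

theorem oddQuot_X_mul (f : F[X]) : oddQuot (X * f) = f - X * oddQuot f := by
  induction f using Polynomial.induction_on' with
  | add f g hf hg =>
    rw [mul_add, map_add, hf, hg, map_add]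
    ring
  | monomial k a =>
    rw [X_mul_monomial, oddQuot, ofSeq_monomial, ofSeq_monomial, oddQuotSeq,
      smul_sub, mul_smul_comm, ← smul_X_eq_monomial]

theorem oddQuotSeq_mem (k : ℕ) : (oddQuotSeq k : F[X]) ∈ degreeLT F k := by
  induction k with
  | zero => exact zero_mem _
  | succ k ih =>
    rw [oddQuotSeq]
    refine sub_mem ?_ ?_
    · rw [mem_degreeLT, degree_X_pow]
      exact_mod_cast Nat.lt_succ_self k
    · rw [mem_degreeLT] at ih ⊢
      rw [mul_comm, degree_mul_X, Nat.cast_succ]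
      by_cases h : (oddQuotSeq k : F[X]) = 0
      · rw [h, degree_zero, WithBot.bot_add]; exact WithBot.bot_lt_coe _
      · rw [degree_eq_natDegree h] at ih ⊢
        exact_mod_cast Nat.succ_lt_succ (by exact_mod_cast ih)

theorem oddQuotSeq_comp (k : ℕ) : (oddQuotSeq k : F[X]).comp (-X) = oddQuotSeq k := by
  induction k using Nat.twoStepInduction with
  | zero => simp [oddQuotSeq]
  | one => simp [oddQuotSeq]
  | more k ih _ =>
    have h : (oddQuotSeq (k + 2) : F[X]) = X ^ 2 * oddQuotSeq k := by
      rw [oddQuotSeq, oddQuotSeq]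
      ring
    rw [h, mul_comp, ih]
    simp

theorem oddQuot_comp (f : F[X]) : (oddQuot f).comp (-X) = oddQuot f := by
  induction f using Polynomial.induction_on' with
  | add f g hf hg => rw [map_add, add_comp, hf, hg]
  | monomial k a => rw [oddQuot, ofSeq_monomial, smul_comp, oddQuotSeq_comp]

/-- The polynomial `S f` with `s * f(y) * e = (S f)(y) * e` in the degenerate affine BMW algebra. -/
def twist (ω : ℕ → F) (f : F[X]) : F[X] :=
  f.comp (-X) + (divDiff ω f).comp (-X) - oddQuot f

theorem twist_C (ω : ℕ → F) (a : F) : twist ω (C a) = C a := by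
  simp [twist, divDiff_C, oddQuot_C]

theorem twist_add (ω : ℕ → F) (f g : F[X]) :
    twist ω (f + g) = twist ω f + twist ω g := by
  simp only [twist, map_add, add_comp]
  ring

theorem twist_X_mul (ω : ℕ → F) (f : F[X]) :
    twist ω (X * f) = -(X * twist ω f) + C (moment ω f) - f := by
  simp only [twist, divDiff_X_mul, oddQuot_X_mul, mul_comp, add_comp, X_comp, C_comp]
  ring

/-- For a monic polynomial `B` of degree `m` this is the numerator of `1 + t⁻¹ W(t)`, where `B` is
the denominator and `W` the generating function of an admissible sequence. -/
def numer (m : ℕ) (B : F[X]) : F[X] := (-1) ^ m * B.comp (-X) + oddQuot B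

theorem numer_pair (m : ℕ) (B : F[X]) (a b : F) :
    numer (m + 2) ((X - C a) * (X - C b) * B) =
      (X + C a) * (X + C b) * numer m B - (C a + C b) * B := by
  have h : (X - C a) * (X - C b) * B =
      X * (X * B) - (X * ((a + b) • B)) + (a * b) • B := by
    simp only [smul_eq_C_mul, C_add, C_mul]
    ring
  have h2 : oddQuot ((X - C a) * (X - C b) * B) =
      (X + C a) * (X + C b) * oddQuot B - (C a + C b) * B := by
    rw [h, map_add, map_sub, oddQuot_X_mul, oddQuot_X_mul, oddQuot_X_mul, map_smul, map_smul]
    simp only [smul_eq_C_mul, C_add, C_mul]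
    ring
  rw [numer, numer, h2]
  simp only [mul_comp, sub_comp, X_comp, C_comp]
  ring

/-- If `B` spans the annihilator of the functional `moment ω`, the symmetry of the form
`(f, g) ↦ moment ω (f * g)` under `twist ω` makes `B` an eigenvector of `twist ω`, and this
determines `ω` in terms of `B`. -/
theorem divDiff_eq_numer_sub {ω : ℕ → F} {B : F[X]} (hB : B.Monic) (hdeg : 0 < B.natDegree)
    (hmin : ∀ g : F[X], (∀ f, moment ω (f * g) = 0) → B ∣ g)
    (hker : ∀ f, moment ω (f * B) = 0)
    (hsymm : ∀ f g, moment ω (f * twist ω g) = moment ω (twist ω f * g)) :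
    divDiff ω B = numer B.natDegree B - B := by
  set m := B.natDegree with hm
  have hdvd : B ∣ twist ω B := hmin _ fun f => by rw [hsymm, hker]
  have hmem : (divDiff ω B).comp (-X) - oddQuot B ∈ degreeLT F m := by
    refine sub_mem ?_ (ofSeq_mem_degreeLT oddQuotSeq_mem le_rfl)
    have := ofSeq_mem_degreeLT (divDiffSeq_mem ω) (le_refl B.natDegree)
    rw [mem_degreeLT] at this ⊢
    by_cases h0 : divDiff ω B = 0
    · rw [h0, zero_comp, degree_zero]; exact WithBot.bot_lt_coe _
    · refine degree_le_natDegree.trans_lt ?_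
      rw [natDegree_comp, natDegree_neg, natDegree_X, mul_one]
      rw [← divDiff, degree_eq_natDegree h0] at this
      exact this
  -- The leading coefficient of `twist ω B` is that of `B.comp (-X)`, so the difference to
  -- `(-1) ^ m * B` is a multiple of `B` of smaller degree.
  have hdvd' : B ∣ twist ω B - (-1) ^ m * B := dvd_sub hdvd (dvd_mul_left _ _)
  have hsmall : twist ω B - (-1) ^ m * B ∈ degreeLT F m := by
    have e : twist ω B - (-1) ^ m * B =
        (B.comp (-X) - (-1) ^ m * B) + ((divDiff ω B).comp (-X) - oddQuot B) := by
      rw [twist]; ring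
    rw [e]
    refine add_mem ?_ hmem
    rw [mem_degreeLT]
    have hn : ((-1) ^ m * B).natDegree = m := by
      rcases neg_one_pow_eq_or F[X] m with h | h
      · rw [h, one_mul]
      · rw [h, neg_one_mul, natDegree_neg]
    have h0 : (-1) ^ m * B ≠ 0 := mul_ne_zero (pow_ne_zero _ (by simp)) hB.ne_zero
    have hcomp : (B.comp (-X)).natDegree = m := by
      rw [natDegree_comp, natDegree_neg, natDegree_X, mul_one]
    have h1 : B.comp (-X) ≠ 0 := by
      intro h
      rw [h, natDegree_zero] at hcomp
      omega
    have hlc : (B.comp (-X)).leadingCoeff = ((-1) ^ m * B).leadingCoeff := by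
      rw [leadingCoeff_comp (by simp), hB.leadingCoeff, leadingCoeff_mul, hB.leadingCoeff,
        leadingCoeff_neg, leadingCoeff_X, leadingCoeff_pow, leadingCoeff_neg, leadingCoeff_one]
      ring
    have := degree_sub_lt_left
      (by rw [degree_eq_natDegree h1, degree_eq_natDegree h0, hcomp, hn]) h1 hlc
    rwa [degree_eq_natDegree h1, hcomp] at this
  have hzero : twist ω B - (-1) ^ m * B = 0 := by
    by_contra h
    have h1 := natDegree_le_of_dvd hdvd' h
    rw [mem_degreeLT, degree_eq_natDegree h] at hsmall
    have h2 : (twist ω B - (-1) ^ m * B).natDegree < m := by exact_mod_cast hsmall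
    omega
  -- Substituting `-X` turns `twist ω B = (-1) ^ m * B` into the formula for `divDiff ω B`.
  have hX : (-X : F[X]).comp (-X) = X := by simp
  have h := congrArg (fun p : F[X] => p.comp (-X)) hzero
  simp only [twist, sub_comp, add_comp, comp_assoc, hX, comp_X, mul_comp, pow_comp, neg_comp,
    one_comp, zero_comp, oddQuot_comp] at h
  rw [numer]
  linear_combination h

end DegBMWPoly

/-! ### Consequences of the relations on two strands -/

section twoStrands

open DegBMWPoly

variable {F : Type u} [Field F] {ω : ℕ → F} {R : Type u} [Ring R] [Algebra F R]

/-- If `e * y ^ a * e` is `ω a` times `e`, then `e * f(y) * e` is `moment ω f` times `e`. -/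
theorem mul_aeval_mul_self {e y : R} (h : ∀ a, e * y ^ a * e = ω a • e) (f : F[X]) :
    e * aeval y f * e = moment ω f • e := by
  induction f using Polynomial.induction_on' with
  | add f g hf hg => rw [map_add, mul_add, add_mul, hf, hg, map_add, add_smul]
  | monomial k a =>
    rw [aeval_monomial, moment, ofSeq_monomial, ← Algebra.smul_def, mul_smul_comm, smul_mul_assoc,
      h, smul_smul, smul_eq_mul]

/-- The annihilator of the functional `moment ω` contains every polynomial `p` with `p(y) e = 0`. -/
theorem moment_mul_eq_zero {e y : R} (he : e ≠ 0) (h : ∀ a, e * y ^ a * e = ω a • e) {p : F[X]}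
    (hp : aeval y p * e = 0) (f : F[X]) : moment ω (f * p) = 0 := by
  have := mul_aeval_mul_self h (f * p)
  rw [map_mul, mul_assoc, mul_assoc, hp, mul_zero, mul_zero] at this
  exact (smul_eq_zero.1 this.symm).resolve_right he

/-- The relations between `s_1`, `e_1`, `y_1`, `y_2`. -/
structure TwoStrandRel (ω : ℕ → F) (s e y z : R) : Prop where
  e_s : e * s = e
  s_e : s * e = e
  s_y : s * y = z * s + e - 1
  y_s : y * s = s * z + e - 1
  z_e : z * e = -(y * e)
  e_z : e * z = -(e * y)
  comm : Commute y z
  e_y_e : ∀ a, e * y ^ a * e = ω a • e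

namespace TwoStrandRel

variable {s e y z : R} (H : TwoStrandRel ω s e y z)
include H

theorem e_aeval_e (f : F[X]) : e * aeval y f * e = moment ω f • e :=
  mul_aeval_mul_self H.e_y_e f

theorem s_aeval_e (f : F[X]) : s * aeval y f * e = aeval y (twist ω f) * e := by
  induction f using induction_X_mul with
  | hC a => rw [twist_C, aeval_C, ← Algebra.commutes, mul_assoc, H.s_e]
  | hadd f g hf hg => rw [twist_add, map_add, map_add, mul_add, add_mul, hf, hg, add_mul]
  | hX f hf =>
    have hz : z * (aeval y (twist ω f) * e) = -(y * aeval y (twist ω f) * e) := by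
      have hc : Commute z (aeval y (twist ω f)) := by
        rw [aeval_eq_sum_range]
        exact Commute.sum_right _ _ _ fun k _ =>
          Commute.smul_right (H.comm.symm.pow_right k) _
      rw [← mul_assoc, hc.eq, mul_assoc, H.z_e, mul_neg, ← mul_assoc]
      have : Commute y (aeval y (twist ω f)) := by
        rw [aeval_eq_sum_range]
        exact Commute.sum_right _ _ _ fun k _ => Commute.smul_right (Commute.self_pow y k) _
      rw [this.eq]
    rw [twist_X_mul, map_mul, aeval_X, ← mul_assoc, H.s_y, sub_mul, add_mul, one_mul, sub_mul,
      add_mul, mul_assoc z, mul_assoc z, hf, hz, H.e_aeval_e, map_sub, map_add, map_neg,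
      map_mul, aeval_X, aeval_C, sub_mul, add_mul, neg_mul, ← Algebra.smul_def]

theorem e_aeval_s (f : F[X]) : e * aeval y f * s = e * aeval y (twist ω f) := by
  induction f using induction_X_mul with
  | hC a => rw [twist_C, aeval_C, ← Algebra.commutes, mul_assoc, H.e_s]
  | hadd f g hf hg => rw [twist_add, map_add, map_add, mul_add, add_mul, hf, hg, mul_add]
  | hX f hf =>
    have hz : (e * aeval y (twist ω f)) * z = -(e * (y * aeval y (twist ω f))) := by
      have hc : Commute z (aeval y (twist ω f)) := by
        rw [aeval_eq_sum_range]
        exact Commute.sum_right _ _ _ fun k _ =>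
          Commute.smul_right (H.comm.symm.pow_right k) _
      rw [mul_assoc, ← hc.eq, ← mul_assoc, H.e_z, neg_mul, mul_assoc]
    rw [twist_X_mul, mul_comm X f, map_mul, aeval_X, ← mul_assoc, mul_assoc (e * _), H.y_s,
      mul_sub, mul_add, mul_one, ← mul_assoc (e * _), hf, hz, H.e_aeval_e, map_sub, map_add,
      map_neg, map_mul, aeval_X, aeval_C, mul_sub, mul_add, mul_neg, ← Algebra.commutes,
      ← Algebra.smul_def]

theorem moment_symm (he : e ≠ 0) (f g : F[X]) :
    moment ω (f * twist ω g) = moment ω (twist ω f * g) := by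
  refine smul_left_injective F he ?_
  change moment ω (f * twist ω g) • e = moment ω (twist ω f * g) • e
  rw [← H.e_aeval_e, ← H.e_aeval_e, map_mul, map_mul, mul_assoc, mul_assoc, ← H.s_aeval_e,
    ← mul_assoc, ← mul_assoc, ← mul_assoc, ← mul_assoc, H.e_aeval_s]

theorem y_mul_e_ne_zero (he : e ≠ 0) (hω : ω 0 = 0) : y * e ≠ 0 := by
  intro h
  have h1 : s * y * e = -(y * e) + ω 0 • e - e := by
    have h2 := H.e_y_e 0
    rw [pow_zero, mul_one] at h2
    rw [H.s_y, sub_mul, add_mul, mul_assoc, H.s_e, H.z_e, h2, one_mul]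
  rw [mul_assoc, h, mul_zero, neg_zero, hω, zero_smul, zero_add, zero_sub, zero_eq_neg] at h1
  exact he h1

theorem map {R' : Type u} [Ring R'] [Algebra F R'] (φ : R →ₐ[F] R') :
    TwoStrandRel ω (φ s) (φ e) (φ y) (φ z) where
  e_s := by rw [← map_mul, H.e_s]
  s_e := by rw [← map_mul, H.s_e]
  s_y := by rw [← map_mul, H.s_y, map_sub, map_add, map_mul, map_one]
  y_s := by rw [← map_mul, H.y_s, map_sub, map_add, map_mul, map_one]
  z_e := by rw [← map_mul, H.z_e, map_neg, map_mul]
  e_z := by rw [← map_mul, H.e_z, map_neg, map_mul]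
  comm := H.comm.map φ
  e_y_e a := by rw [← map_pow, ← map_mul, ← map_mul, H.e_y_e, map_smul]

end TwoStrandRel

end twoStrands

/-! ### Generating functions at infinity -/

section genFun

open DegBMWPoly

variable {F : Type u} [Field F]

theorem polyAtInfinity_C (a : F) : polyAtInfinity F (C a) = HahnSeries.C a := by
  simp [polyAtInfinity]

theorem polyAtInfinity_X : polyAtInfinity F X = tAtInfinity F := by
  simp [polyAtInfinity]

theorem genFunAtInfinity_injective : Function.Injective (genFunAtInfinity (F := F)) := by
  intro ω ω' h
  have := HahnSeries.ofPowerSeries_injective h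
  funext k
  simpa using congrArg (PowerSeries.coeff k) this

theorem genFunAtInfinity_coeff_natCast (ω : ℕ → F) (k : ℕ) :
    (genFunAtInfinity ω).coeff (k : ℤ) = ω k := by
  rw [genFunAtInfinity, HahnSeries.ofPowerSeries_apply_coeff, PowerSeries.coeff_mk]

theorem genFunAtInfinity_sum {ι : Type*} (s : Finset ι) (a : ι → F) (v : ι → ℕ → F) :
    genFunAtInfinity (fun k => ∑ i ∈ s, a i * v i k) =
      ∑ i ∈ s, polyAtInfinity F (C (a i)) * genFunAtInfinity (v i) := by
  simp only [genFunAtInfinity, polyAtInfinity_C]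
  rw [show (PowerSeries.mk fun k => ∑ i ∈ s, a i * v i k) =
    ∑ i ∈ s, PowerSeries.C (a i) * PowerSeries.mk (v i) by ext k; simp, map_sum]
  simp only [map_mul, HahnSeries.ofPowerSeries_C]

theorem genFunAtInfinity_add (v w : ℕ → F) :
    genFunAtInfinity (fun k => v k + w k) = genFunAtInfinity v + genFunAtInfinity w := by
  rw [genFunAtInfinity, genFunAtInfinity, genFunAtInfinity, ← map_add]
  congr 1

theorem genFunAtInfinity_sub (v w : ℕ → F) :
    genFunAtInfinity (fun k => v k - w k) = genFunAtInfinity v - genFunAtInfinity w := by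
  rw [genFunAtInfinity, genFunAtInfinity, genFunAtInfinity, ← map_sub]
  congr 1

theorem genFunAtInfinity_smul (a : F) (v : ℕ → F) :
    genFunAtInfinity (fun k => a * v k) = polyAtInfinity F (C a) * genFunAtInfinity v := by
  simpa using genFunAtInfinity_sum {()} (fun _ => a) fun _ => v

theorem genFunAtInfinity_zero : genFunAtInfinity (fun _ => (0 : F)) = 0 := by
  simpa using genFunAtInfinity_sum (∅ : Finset ℕ) (fun _ => (0 : F)) fun _ _ => 0

theorem tAtInfinity_mul_genFun (v : ℕ → F) :
    polyAtInfinity F X * genFunAtInfinity v =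
      polyAtInfinity F X * polyAtInfinity F (C (v 0)) + genFunAtInfinity fun k => v (k + 1) := by
  have h : PowerSeries.mk v =
      PowerSeries.X * PowerSeries.mk (fun k => v (k + 1)) + PowerSeries.C (v 0) := by
    conv_lhs => rw [PowerSeries.eq_X_mul_shift_add_const (PowerSeries.mk v)]
    simp
  have ht : tAtInfinity F * HahnSeries.ofPowerSeries ℤ F PowerSeries.X = 1 := by
    rw [tAtInfinity, HahnSeries.ofPowerSeries_X, HahnSeries.single_mul_single]
    simp
  rw [genFunAtInfinity, h, map_add, map_mul, mul_add, ← mul_assoc, polyAtInfinity_X, ht, one_mul,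
    add_comm, genFunAtInfinity, HahnSeries.ofPowerSeries_C, polyAtInfinity_C]

/-- The product of a polynomial with a generating function, split into its polynomial part and
the generating function of the shifted moments. -/
theorem polyAtInfinity_mul_genFun (ω : ℕ → F) (f : F[X]) :
    polyAtInfinity F f * genFunAtInfinity ω =
      polyAtInfinity F X * polyAtInfinity F (divDiff ω f) +
        genFunAtInfinity fun k => moment ω (X ^ k * f) := by
  induction f using induction_X_mul with
  | hC a =>
    rw [divDiff_C, map_zero, mul_zero, zero_add, ← genFunAtInfinity_smul]
    congr 1
    funext k
    rw [mul_comm (X ^ k), ← smul_eq_C_mul, map_smul, moment_X_pow, smul_eq_mul]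
  | hadd f g hf hg =>
    rw [map_add, add_mul, hf, hg, map_add, map_add]
    simp only [mul_add, map_add]
    rw [genFunAtInfinity_add]
    ring
  | hX f hf =>
    rw [map_mul, mul_assoc, hf, mul_add, tAtInfinity_mul_genFun, divDiff_X_mul, map_add,
      map_mul (polyAtInfinity F), pow_zero, one_mul]
    simp only [pow_succ, mul_assoc]
    ring

/-- Solving a triangular system whose coefficients are paired by the reflection `i ↦ r - 1 - i`:
the partial sums `Q` over the intervals symmetric about the middle have quotients
`numer m B / B`, where `B` is the product of the `X - C (U i)` over the interval. -/
theorem prod_mul_partialSum {K : Type*} [CommRing K] (φ : F[X] →+* K) {r : ℕ} {U d : ℕ → F}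
    {x Q : ℕ → K} (hd : ∀ i j, i + j + 1 = r → d i = U i + U j + if i = j then 1 else 0)
    (hQ : ∀ i, Q (i + 1) = Q i + φ (C (d i)) * x i)
    (hx : ∀ i j, i + j + 1 = r → (φ X - φ (C (U i))) * x i = Q i - if j < i then x j else 0)
    (m : ℕ) : ∀ k, k + m + k = r →
      φ (∏ i ∈ Finset.range m, (X - C (U (k + i)))) * Q (k + m) =
        φ (numer m (∏ i ∈ Finset.range m, (X - C (U (k + i))))) * Q k := by
  induction m using Nat.twoStepInduction with
  | zero =>
    intro k _
    have : numer 0 (1 : F[X]) = 1 := by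
      rw [numer, ← C_1, oddQuot_C]; simp
    simp [this]
  | one =>
    intro k hk
    have h1 : numer 1 (X - C (U k)) = X + C (U k) + 1 := by
      have : oddQuot (X - C (U k)) = 1 := by
        rw [map_sub, oddQuot_C, ← mul_one X, oddQuot_X_mul, ← C_1, oddQuot_C]; simp
      rw [numer, this]
      simp [add_comm]
    have hxk := hx k k (by omega)
    rw [if_neg (lt_irrefl k), sub_zero] at hxk
    have hdk := hd k k (by omega)
    rw [if_pos rfl] at hdk
    simp only [Finset.prod_range_one, add_zero, h1, hQ, hdk, map_add, map_sub, map_one]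
    linear_combination (2 * φ (C (U k)) + 1) * hxk
  | more m ih _ =>
    intro k hk
    -- Strip the two outermost points `k` and `k + m + 1` of the interval.
    have hprod : ∏ i ∈ Finset.range (m + 2), (X - C (U (k + i))) =
        (X - C (U k)) * (X - C (U (k + m + 1))) *
          ∏ i ∈ Finset.range m, (X - C (U (k + 1 + i))) := by
      rw [Finset.prod_range_succ, Finset.prod_range_succ']
      simp only [add_zero, add_comm, add_left_comm, add_assoc]
      ring
    have hB := ih (k + 1) (by omega)
    rw [hprod, numer_pair]
    generalize ∏ i ∈ Finset.range m, (X - C (U (k + 1 + i))) = B at hB ⊢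
    rw [show k + 1 + m = k + m + 1 by omega] at hB
    have hxk := hx k (k + m + 1) (by omega)
    rw [if_neg (by omega), sub_zero] at hxk
    have hdk := hd k (k + m + 1) (by omega)
    rw [if_neg (by omega), add_zero] at hdk
    have hxj := hx (k + m + 1) k (by omega)
    rw [if_pos (by omega)] at hxj
    have hdj := hd (k + m + 1) k (by omega)
    rw [if_neg (by omega), add_zero] at hdj
    have hQk := hQ k
    have hQj := hQ (k + m + 1)
    rw [hdk] at hQk
    rw [hdj] at hQj
    rw [show k + (m + 2) = k + m + 1 + 1 by omega, hQj]
    simp only [map_add, map_sub, map_mul] at hQk hQj ⊢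
    generalize φ (C (U k)) = a at *
    generalize φ (C (U (k + m + 1))) = b at *
    linear_combination (φ X - a) * φ B * (a + b) * hxj + (φ X - a) * (φ X + a) * hB -
      φ B * (a + b) * hxk + (φ X - a) * (φ X + a) * φ (numer m B) * hQk +
      (φ X + a) * φ (numer m B) * (a + b) * hxk

/-- The moments of the Jucys-Murphy operator with eigenvalues `u` are determined by the polynomial
with roots `u`. -/
theorem jmMoment_eq {r : ℕ} {u δ : Fin r → F} {ω : ℕ → F}
    (hδ : ∀ a, δ a = u a + u a.rev + if a = a.rev then 1 else 0)
    (hker : ∀ f, moment ω (f * ∏ c, (X - C (u c))) = 0)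
    (hB : divDiff ω (∏ c, (X - C (u c))) = numer r (∏ c, (X - C (u c))) - ∏ c, (X - C (u c))) :
    jmMoment δ u = ω := by
  set φ := polyAtInfinity F
  -- The recursion of the coordinates becomes a triangular system for their generating functions
  -- `w b`; the last partial sum `Q r` is `t` plus the generating function of the moments.
  let U : ℕ → F := fun i => if h : i < r then u ⟨i, h⟩ else 0
  let d : ℕ → F := fun i => if h : i < r then δ ⟨i, h⟩ else 0
  let w : Fin r → LaurentSeries F := fun b => genFunAtInfinity fun k => jmCoord δ u k b
  let x : ℕ → LaurentSeries F := fun i => if h : i < r then w ⟨i, h⟩ else 0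
  let Q : ℕ → LaurentSeries F := fun i => φ X + ∑ c ∈ Finset.range i, φ (C (d c)) * x c
  have hU : ∀ c : Fin r, U c = u c := fun c => by simp [U]
  have hdc : ∀ c : Fin r, d c = δ c := fun c => by simp [d]
  have hxc : ∀ c : Fin r, x c = w c := fun c => by simp [x]
  have hw : ∀ b : Fin r, φ X * w b = φ (C (u b)) * w b - (if b.rev < b then w b.rev else 0) +
      (φ X + ∑ c, if c < b then φ (C (δ c)) * w c else 0) := by
    intro b
    have h := tAtInfinity_mul_genFun fun k => jmCoord δ u k b
    simp only [jmCoord, jmStep, Pi.one_apply] at h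
    rw [genFunAtInfinity_add, genFunAtInfinity_sub, genFunAtInfinity_smul] at h
    have h1 : genFunAtInfinity (fun k => if b.rev < b then jmCoord δ u k b.rev else 0) =
        if b.rev < b then w b.rev else 0 := by
      split_ifs
      · rfl
      · exact genFunAtInfinity_zero
    have h2 : genFunAtInfinity (fun k => ∑ c, if c < b then δ c * jmCoord δ u k c else 0) =
        ∑ c, if c < b then φ (C (δ c)) * w c else 0 := by
      have := genFunAtInfinity_sum Finset.univ (fun c => if c < b then δ c else 0)
        fun c k => jmCoord δ u k c
      simp only [ite_mul, zero_mul, apply_ite C, apply_ite (polyAtInfinity F), map_zero] at this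
      exact this
    rw [h1, h2, C_1, map_one, mul_one] at h
    rw [h]
    ring
  have key := prod_mul_partialSum φ (r := r) (U := U) (d := d) (x := x) (Q := Q)
    (fun i j hij => ?_) (fun i => ?_) (fun i j hij => ?_) r 0 (by omega)
  · have hQr : Q r = φ X + genFunAtInfinity (jmMoment δ u) := by
      have : jmMoment δ u = fun k => ∑ b, δ b * jmCoord δ u k b := rfl
      rw [this, genFunAtInfinity_sum]
      simp only [Q]
      rw [← Fin.sum_univ_eq_sum_range (fun c => φ (C (d c)) * x c)]
      simp only [hdc, hxc]
      rfl
    have hQ0 : Q 0 = φ X := by simp [Q]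
    have hp : ∏ i ∈ Finset.range r, (X - C (U (0 + i))) = ∏ c, (X - C (u c)) := by
      simp only [zero_add]
      rw [← Fin.prod_univ_eq_prod_range (fun i => X - C (U i))]
      simp only [hU]
    rw [hp, zero_add, hQr, hQ0] at key
    have h2 := polyAtInfinity_mul_genFun ω (∏ c, (X - C (u c)))
    simp only [hker] at h2
    rw [genFunAtInfinity_zero, hB, map_sub] at h2
    have hne : φ (∏ c, (X - C (u c))) ≠ 0 := by
      rw [Ne, ← map_zero φ]
      exact (polyAtInfinity_injective F).ne
        (Finset.prod_ne_zero_iff.2 fun c _ => X_sub_C_ne_zero (u c))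
    refine genFunAtInfinity_injective (mul_left_cancel₀ hne ?_)
    linear_combination key - h2
  · obtain ⟨hi, hj⟩ : i < r ∧ j < r := by omega
    have hr : (⟨i, hi⟩ : Fin r).rev = ⟨j, hj⟩ := by ext; simp; omega
    simp only [d, U, hi, hj, dif_pos, hδ, hr, Fin.mk.injEq]
  · simp only [Q, Finset.sum_range_succ, add_assoc]
  · obtain ⟨hi, hj⟩ : i < r ∧ j < r := by omega
    have hr : (⟨i, hi⟩ : Fin r).rev = ⟨j, hj⟩ := by ext; simp; omega
    have h := hw ⟨i, hi⟩
    rw [hr] at h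
    have hs : ∑ c ∈ Finset.range i, φ (C (d c)) * x c =
        ∑ c, if c < (⟨i, hi⟩ : Fin r) then φ (C (δ c)) * w c else 0 := by
      have := Fin.sum_univ_eq_sum_range (fun c => if c < i then φ (C (d c)) * x c else 0) r
      simp only [hdc, hxc] at this
      simp only [Fin.lt_def]
      rw [this, ← Finset.sum_filter]
      congr 1
      ext c
      simp
      omega
    simp only [Q]
    rw [hs]
    simp only [U, x, hi, hj, dif_pos, Fin.lt_def] at h ⊢
    linear_combination h

end genFun

/-! ### Linear recurrences and rational generating functions -/

section recurrence

open DegBMWPoly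

variable {F : Type u} [Field F] {ω : ℕ → F}

theorem moment_X_pow_mul_monic {Q : F[X]} (hQ : Q.Monic) (l : ℕ) :
    moment ω (X ^ l * Q) =
      ω (Q.natDegree + l) + ∑ j : Fin Q.natDegree, Q.coeff j * ω (j + l) := by
  conv_lhs => rw [hQ.as_sum]
  rw [mul_add, ← pow_add, map_add, moment_X_pow, add_comm l, Finset.mul_sum, map_sum,
    Fin.sum_univ_eq_sum_range fun j => Q.coeff j * ω (j + l)]
  congr 1
  refine Finset.sum_congr rfl fun j _ => ?_
  rw [mul_left_comm, ← pow_add, ← smul_eq_C_mul, map_smul, moment_X_pow, smul_eq_mul, add_comm]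

theorem moment_mul_eq_zero_of_X_pow {Q : F[X]} (h : ∀ l, moment ω (X ^ l * Q) = 0) (f : F[X]) :
    moment ω (f * Q) = 0 := by
  induction f using Polynomial.induction_on' with
  | add f g hf hg => rw [add_mul, map_add, hf, hg, add_zero]
  | monomial k a =>
    rw [← C_mul_X_pow_eq_monomial, mul_assoc, ← smul_eq_C_mul, map_smul, h, smul_zero]

/-- A nonzero polynomial whose shifts by `l ≥ N` have moment zero yields a linear recurrence. -/
theorem exists_recurrence {Q : F[X]} (hQ : Q ≠ 0) {N : ℕ}
    (h : ∀ l, N ≤ l → moment ω (X ^ l * Q) = 0) :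
    ∃ r : ℕ, 0 < r ∧ ∃ a : Fin r → F,
      ∀ l : ℕ, N ≤ l → ω (r + l) + ∑ j : Fin r, a j * ω (j + l) = 0 := by
  -- The factor `X` makes the length of the recurrence positive.
  have hm : (X * (Q * C Q.leadingCoeff⁻¹)).Monic := monic_X.mul (monic_mul_leadingCoeff_inv hQ)
  refine ⟨(X * (Q * C Q.leadingCoeff⁻¹)).natDegree, ?_,
    fun j => (X * (Q * C Q.leadingCoeff⁻¹)).coeff j, fun l hl => ?_⟩
  · rw [monic_X.natDegree_mul (monic_mul_leadingCoeff_inv hQ), natDegree_X]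
    omega
  · rw [← moment_X_pow_mul_monic hm, ← mul_assoc, ← pow_succ, mul_comm Q, mul_left_comm,
      ← smul_eq_C_mul, map_smul, h _ (by omega), smul_zero]

/-- Multiplying the characteristic polynomial by a power of `X` absorbs the initial terms that
violate the recurrence. -/
theorem exists_annihilator {r N : ℕ} {a : Fin r → F}
    (h : ∀ l : ℕ, N ≤ l → ω (r + l) + ∑ j : Fin r, a j * ω (j + l) = 0) :
    ∃ Q : F[X], Q ≠ 0 ∧ ∀ f, moment ω (f * Q) = 0 := by
  have hP : (X ^ r + ∑ j : Fin r, C (a j) * X ^ (j : ℕ)).Monic :=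
    monic_X_pow_add (degree_sum_fin_lt a)
  refine ⟨X ^ N * (X ^ r + ∑ j : Fin r, C (a j) * X ^ (j : ℕ)),
    ((monic_X_pow N).mul hP).ne_zero, moment_mul_eq_zero_of_X_pow fun l => ?_⟩
  rw [← mul_assoc, ← pow_add, mul_add, ← pow_add, map_add, moment_X_pow, Finset.mul_sum, map_sum,
    ← h (l + N) (by omega), add_comm r]
  congr 1
  refine Finset.sum_congr rfl fun j _ => ?_
  rw [mul_left_comm, ← pow_add, ← smul_eq_C_mul, map_smul, moment_X_pow, smul_eq_mul,
    add_comm (j : ℕ)]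

theorem polyAtInfinity_coeff_succ (p : F[X]) (k : ℕ) :
    (polyAtInfinity F p).coeff ((k + 1 : ℕ) : ℤ) = 0 := by
  induction p using Polynomial.induction_on' with
  | add p q hp hq => rw [map_add, HahnSeries.coeff_add, hp, hq, add_zero]
  | monomial m a =>
    rw [polyAtInfinity, Polynomial.coe_eval₂RingHom, Polynomial.eval₂_monomial, tAtInfinity,
      HahnSeries.single_pow, HahnSeries.C_apply, HahnSeries.single_mul_single,
      HahnSeries.coeff_single_of_ne]
    simp only [nsmul_eq_mul]
    omega

/-- The denominator `Q` satisfies the recurrence from `l = 1` on; the moment of `Q` itself, for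
`l = 0`, contributes to the constant term of the numerator. -/
theorem exists_recurrence_of_rational {f : RatFunc F}
    (hf : expandAtInfinity F f = genFunAtInfinity ω) :
    ∃ Q : F[X], Q ≠ 0 ∧ ∀ l, 1 ≤ l → moment ω (X ^ l * Q) = 0 := by
  refine ⟨f.denom, f.denom_ne_zero, fun l hl => ?_⟩
  obtain ⟨k, rfl⟩ := Nat.exists_eq_add_of_le' hl
  have hd : polyAtInfinity F f.denom ≠ 0 := by
    rw [Ne, ← map_zero (polyAtInfinity F)]
    exact (polyAtInfinity_injective F).ne f.denom_ne_zero
  rw [expandAtInfinity, RatFunc.liftRingHom_apply, div_eq_iff hd, mul_comm,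
    polyAtInfinity_mul_genFun, ← map_mul] at hf
  have h := congrArg (fun s : LaurentSeries F => s.coeff ((k + 1 : ℕ) : ℤ)) hf
  simp only [HahnSeries.coeff_add, polyAtInfinity_coeff_succ] at h
  rw [zero_add, genFunAtInfinity_coeff_natCast] at h
  exact h.symm

theorem rational_of_annihilator {Q : F[X]} (hQ : Q ≠ 0) (h : ∀ f, moment ω (f * Q) = 0) :
    ∃ f : RatFunc F, expandAtInfinity F f = genFunAtInfinity ω := by
  refine ⟨algebraMap _ _ (X * divDiff ω Q) / algebraMap _ _ Q, ?_⟩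
  have hd : polyAtInfinity F Q ≠ 0 := by
    rw [Ne, ← map_zero (polyAtInfinity F)]
    exact (polyAtInfinity_injective F).ne hQ
  have h2 := polyAtInfinity_mul_genFun ω Q
  simp only [h] at h2
  rw [genFunAtInfinity_zero, add_zero] at h2
  rw [expandAtInfinity, RatFunc.liftRingHom_apply_div, div_eq_iff hd, map_mul, ← h2, mul_comm]

/-- The annihilator of the functional `moment ω`. -/
def momentIdeal (ω : ℕ → F) : Ideal F[X] where
  carrier := {g | ∀ f, moment ω (f * g) = 0}
  add_mem' {g g'} hg hg' f := by rw [mul_add, map_add, hg, hg', add_zero]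
  zero_mem' f := by rw [mul_zero, map_zero]
  smul_mem' c g hg f := by rw [smul_eq_mul, ← mul_assoc, hg]

theorem exists_monic_generator {Q : F[X]} (hQ : Q ≠ 0) (h : ∀ f, moment ω (f * Q) = 0) :
    ∃ B : F[X], B.Monic ∧ (∀ f, moment ω (f * B) = 0) ∧
      ∀ g : F[X], (∀ f, moment ω (f * g) = 0) → B ∣ g := by
  let G := Submodule.IsPrincipal.generator (momentIdeal ω)
  have hG : ∀ g : F[X], (∀ f, moment ω (f * g) = 0) ↔ G ∣ g := fun g =>
    Submodule.IsPrincipal.mem_iff_generator_dvd (momentIdeal ω)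
  have hG0 : G ≠ 0 := fun h0 => hQ (zero_dvd_iff.1 (h0 ▸ (hG Q).1 h))
  have hu : IsUnit (C G.leadingCoeff⁻¹) :=
    isUnit_C.2 (isUnit_iff_ne_zero.2 (inv_ne_zero (leadingCoeff_ne_zero.2 hG0)))
  refine ⟨G * C G.leadingCoeff⁻¹, monic_mul_leadingCoeff_inv hG0, (hG _).2 (dvd_mul_right _ _),
    fun g hg => hu.mul_right_dvd.2 ((hG g).1 hg)⟩

theorem exists_prod_X_sub_C [IsAlgClosed F] {B : F[X]} (hB : B.Monic) :
    ∃ u : Fin B.natDegree → F, B = ∏ c, (X - C (u c)) := by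
  have h := (IsAlgClosed.splits B).eq_prod_roots_of_monic hB
  obtain ⟨l, hl⟩ := Quot.exists_rep B.roots
  change (l : Multiset F) = B.roots at hl
  rw [← hl, Multiset.map_coe, Multiset.prod_coe] at h
  have hlen : l.length = B.natDegree := by
    rw [h, ← Multiset.prod_coe, ← Multiset.map_coe, natDegree_multiset_prod_X_sub_C_eq_card,
      Multiset.coe_card]
  rw [← hlen]
  exact ⟨fun c => l[c.1], h.trans (Fin.prod_univ_fun_getElem l fun a => X - C a).symm⟩

/-- A sequence with a linear recurrence, for which the form `(f, g) ↦ moment ω (f * g)` is symmetric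
under `twist ω`, is the moment sequence of a Jucys-Murphy operator. When the sequence is zero its
annihilator has no roots, and the polynomial `X ^ 2` is used in place of the generator. -/
theorem exists_jmMoment_eq [IsAlgClosed F] {Q : F[X]} (hQ : Q ≠ 0)
    (h : ∀ f, moment ω (f * Q) = 0)
    (hsymm : ∀ f g, moment ω (f * twist ω g) = moment ω (twist ω f * g)) :
    ∃ (r : ℕ) (u : Fin r → F), 0 < r ∧
      jmMoment (fun a => u a + u a.rev + if a = a.rev then 1 else 0) u = ω ∧
      ((∀ g : F[X], g.degree < r → (∀ f, moment ω (f * g) = 0) → g = 0) ∨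
        r = 2 ∧ u = 0 ∧ ω 0 = 0) := by
  obtain ⟨B, hB, hker, hmin⟩ := exists_monic_generator hQ h
  rcases Nat.eq_zero_or_pos B.natDegree with h0 | h0
  · rw [hB.natDegree_eq_zero] at h0
    subst h0
    have hω : ∀ f, moment ω f = 0 := fun f => by rw [← mul_one f, hker]
    refine ⟨2, 0, two_pos, jmMoment_eq (fun _ => rfl) (fun f => hω _) ?_,
      Or.inr ⟨rfl, rfl, by rw [← moment_X_pow ω, hω]⟩⟩
    have hX : ∏ c : Fin 2, (X - C ((0 : Fin 2 → F) c)) = X * (X * C 1) := by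
      simp [pow_two]
    rw [hX, divDiff_X_mul, divDiff_X_mul, divDiff_C, numer, oddQuot_X_mul, oddQuot_X_mul, oddQuot_C,
      hω, hω]
    simp
  · obtain ⟨u, hu⟩ := exists_prod_X_sub_C hB
    have hD := divDiff_eq_numer_sub hB h0 hmin hker hsymm
    refine ⟨B.natDegree, u, h0, jmMoment_eq (fun _ => rfl) (hu ▸ hker) ?_, Or.inl ?_⟩
    · rw [← hu]; exact hD
    · intro g hg hg'
      rw [← degree_eq_natDegree hB.ne_zero] at hg
      exact eq_zero_of_dvd_of_degree_lt (hmin g hg') hg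

end recurrence

/-! ### Modules and admissible parameters -/

section modules

open DegBMWPoly

variable {F : Type u} [Field F] {ω : ℕ → F} {n : ℕ}

namespace DegAffBMW

theorem e_mul_y_pow_mul_e (h1 : 1 ≤ 1 ∧ 1 < n) (h2 : 1 ≤ 1 ∧ 1 ≤ n) (a : ℕ) :
    e ω 1 h1 * y ω 1 h2 ^ a * e ω 1 h1 = ω a • e ω 1 h1 := by
  rw [e, y, ← map_pow, ← map_mul, ← map_mul, ← map_smul]
  rcases Nat.eq_zero_or_pos a with rfl | ha
  · rw [pow_zero, mul_one]
    exact RingQuot.mkAlgHom_rel F (DegAffBMWRel.idempotent 1 h1)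
  · exact RingQuot.mkAlgHom_rel F (DegAffBMWRel.compression a ha h1 h2)

/-- The relations between the generators on the first two strands. -/
theorem twoStrandRel (h1 : 1 ≤ 1 ∧ 1 < n) (h2 : 1 ≤ 1 ∧ 1 ≤ n) (h3 : 1 ≤ 2 ∧ 2 ≤ n) :
    TwoStrandRel ω (mk ω (DegBMWFree.s F 1 h1)) (e ω 1 h1) (y ω 1 h2) (y ω 2 h3) where
  e_s := by
    rw [e, ← map_mul]
    exact RingQuot.mkAlgHom_rel F (DegAffBMWRel.e_mul_s 1 h1)
  s_e := by
    rw [e, ← map_mul]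
    exact RingQuot.mkAlgHom_rel F (DegAffBMWRel.s_mul_e 1 h1)
  s_y := by
    rw [add_sub_assoc, ← sub_eq_iff_eq_add', e, y, y, ← map_mul, ← map_mul, ← map_sub,
      ← map_one (mk ω), ← map_sub]
    exact RingQuot.mkAlgHom_rel F (DegAffBMWRel.skein 1 h1 h2 h3)
  y_s := by
    rw [add_sub_assoc, ← sub_eq_iff_eq_add', e, y, y, ← map_mul, ← map_mul, ← map_sub,
      ← map_one (mk ω), ← map_sub]
    exact RingQuot.mkAlgHom_rel F (DegAffBMWRel.skein' 1 h1 h2 h3)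
  z_e := by
    rw [← add_eq_zero_iff_eq_neg, add_comm, ← add_mul, e, y, y, ← map_add, ← map_mul,
      ← map_zero (mk ω)]
    exact RingQuot.mkAlgHom_rel F (DegAffBMWRel.antisymm' 1 h1 h2 h3)
  e_z := by
    rw [← add_eq_zero_iff_eq_neg, add_comm, ← mul_add, e, y, y, ← map_add, ← map_mul,
      ← map_zero (mk ω)]
    exact RingQuot.mkAlgHom_rel F (DegAffBMWRel.antisymm 1 h1 h2 h3)
  comm := by
    rw [Commute, SemiconjBy, y, y, ← map_mul, ← map_mul]
    exact RingQuot.mkAlgHom_rel F (DegAffBMWRel.y_comm_y 1 2 h2 h3)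
  e_y_e := e_mul_y_pow_mul_e h1 h2

end DegAffBMW

/-- A finite-dimensional module on which `e_1` acts nontrivially forces a recurrence: the minimal
polynomial of `y_1` lies in the annihilator of the moment functional. -/
theorem exists_annihilator_of_hasModule (hn : 2 ≤ n) (h : DegAffBMWHasModule n hn ω) :
    ∃ Q : F[X], Q ≠ 0 ∧ ∀ f, moment ω (f * Q) = 0 := by
  obtain ⟨M, _, _, _, _, _, m, hm⟩ := h
  let ρ : DegAffBMW n ω →ₐ[F] Module.End F M := Algebra.lsmul F F M
  let T := ρ (DegAffBMW.y ω 1 ⟨le_rfl, by omega⟩)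
  have he : ρ (DegAffBMW.e ω 1 ⟨le_rfl, hn⟩) ≠ 0 := fun h0 => hm (LinearMap.congr_fun h0 m)
  refine ⟨minpoly F T, minpoly.ne_zero (Algebra.IsIntegral.isIntegral T),
    moment_mul_eq_zero (y := T) he (fun a => ?_) (by rw [minpoly.aeval, zero_mul])⟩
  rw [← map_pow, ← map_mul, ← map_mul, DegAffBMW.e_mul_y_pow_mul_e, map_smul]

namespace DegCycBMW

variable {r : ℕ} {u : Fin r → F}

theorem aeval_y (h2 : 1 ≤ 1 ∧ 1 ≤ n) :
    aeval (y (n := n) ω u 1 h2) (∏ c, (X - C (u c))) = 0 := by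
  have h : mk ω u (List.ofFn fun k : Fin r =>
      DegAffBMW.y ω 1 h2 - algebraMap F (DegAffBMW n ω) (u k)).prod = mk ω u 0 :=
    RingQuot.mkAlgHom_rel F (DegCycBMWRel.cyclotomic h2)
  rw [map_zero] at h
  rw [← h, ← List.prod_ofFn, y, aeval_algHom_apply, map_list_prod, List.map_ofFn]
  refine congrArg (mk ω u) (congrArg List.prod (congrArg List.ofFn (funext fun k => ?_)))
  simp

theorem e_mul_y_pow_mul_e (h1 : 1 ≤ 1 ∧ 1 < n) (h2 : 1 ≤ 1 ∧ 1 ≤ n) (a : ℕ) :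
    e ω u 1 h1 * y ω u 1 h2 ^ a * e ω u 1 h1 = ω a • e ω u 1 h1 := by
  rw [e, y, ← map_pow, ← map_mul, ← map_mul, DegAffBMW.e_mul_y_pow_mul_e, map_smul]

/-- A representation of the affine algebra in which `y_1` satisfies the cyclotomic relation factors
through the cyclotomic algebra. -/
theorem e_ne_zero_of_hom {A : Type u} [Ring A] [Algebra F A] (ρ : DegAffBMW n ω →ₐ[F] A)
    (h1 : 1 ≤ 1 ∧ 1 < n) (h2 : 1 ≤ 1 ∧ 1 ≤ n)
    (hy : aeval (ρ (DegAffBMW.y ω 1 h2)) (∏ c, (X - C (u c))) = 0)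
    (he : ρ (DegAffBMW.e ω 1 h1) ≠ 0) : e ω u 1 h1 ≠ 0 := by
  have hρ : ∀ ⦃x y⦄, DegCycBMWRel n ω u x y → ρ x = ρ y := by
    rintro _ _ ⟨h2⟩
    rw [map_zero, ← hy, ← List.prod_ofFn, aeval_algHom_apply, map_list_prod, map_list_prod,
      map_list_prod, List.map_ofFn, List.map_ofFn, List.map_ofFn]
    congr 2
    funext k
    simp
  intro h0
  apply he
  have := RingQuot.liftAlgHom_mkAlgHom_apply F ρ hρ (DegAffBMW.e ω 1 h1)
  rw [← this]
  exact (congrArg (RingQuot.liftAlgHom F ⟨ρ, hρ⟩) h0).trans (map_zero _)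

end DegCycBMW

theorem exists_annihilator_of_admissible {r : ℕ} (hr : 0 < r) {u : Fin r → F}
    (h : DegBMWAdmissible ω u) : ∃ Q : F[X], Q ≠ 0 ∧ ∀ f, moment ω (f * Q) = 0 := by
  have he := h.ne_zero ⟨0, hr⟩
  rw [pow_zero, one_mul] at he
  refine ⟨∏ c, (X - C (u c)), Finset.prod_ne_zero_iff.2 fun c _ => X_sub_C_ne_zero (u c),
    moment_mul_eq_zero (y := DegCycBMW.y (n := 2) ω u 1 (by decide)) he
      (DegCycBMW.e_mul_y_pow_mul_e _ _) (by rw [DegCycBMW.aeval_y, zero_mul])⟩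

/-- If the moments of the Jucys-Murphy operator are `ω`, the algebra acts on coloured matchings. -/
theorem exists_representation {r : ℕ} (hr : 0 < r) {u : Fin r → F}
    (hω : jmMoment (fun a => u a + u a.rev + if a = a.rev then 1 else 0) u = ω)
    (h1 : 1 ≤ 1 ∧ 1 < n) (h2 : 1 ≤ 1 ∧ 1 ≤ n) :
    ∃ (M : Type u) (_ : AddCommGroup M) (_ : Module F M) (_ : FiniteDimensional F M)
      (ρ : DegAffBMW n ω →ₐ[F] Module.End F M),
      ρ (DegAffBMW.e ω 1 h1) ≠ 0 ∧
        aeval (ρ (DegAffBMW.y ω 1 h2)) (∏ c, (X - C (u c))) = 0 := by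
  subst hω
  set δ : Fin r → F := fun a => u a + u a.rev + if a = a.rev then 1 else 0
  have hδ : ∀ a, δ a.rev = δ a := fun a => by
    simp only [δ, Fin.rev_rev, add_comm (u a.rev), eq_comm (a := a.rev)]
  -- The algebra acts on the copy of the positions with label `false`; the other copy supplies
  -- partners, so that `e_1` can be applied without closing a loop.
  let M := ColMatching.coloredBrauer (I := Fin (n + 1) × Bool) hδ
  let H := M.action (u := u) (fun _ => rfl) n (fun j => (Fin.ofNat (n + 1) j, false)) (by
    intro i j hi hj h
    have := congrArg (fun x : Fin (n + 1) × Bool => (x.1 : ℕ)) h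
    simpa [Nat.mod_eq_of_lt (Nat.lt_succ_of_le hi), Nat.mod_eq_of_lt (Nat.lt_succ_of_le hj)]
      using this)
  refine ⟨_, _, _, inferInstance, H.hom, ?_, ?_⟩
  · rw [H.hom_e]
    intro h0
    refine ColMatching.projEnd_mul_joinEnd_ne_zero (F := F) (J := Fin (n + 1)) δ
      (i := Fin.ofNat (n + 1) 1) (j := Fin.ofNat (n + 1) 2) ?_ ⟨0, hr⟩ ?_
    · intro h
      have := congrArg Fin.val h
      simp [Nat.mod_eq_of_lt (show 1 < n + 1 by omega),
        Nat.mod_eq_of_lt (show 2 < n + 1 by omega)] at this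
    · exact (congrArg (_ * ·) h0).trans (mul_zero _)
  · rw [H.hom_y]
    exact M.aeval_jm_prod _

theorem hasModule_of_representation (hn : 2 ≤ n) {M : Type u} [AddCommGroup M] [Module F M]
    [FiniteDimensional F M] (ρ : DegAffBMW n ω →ₐ[F] Module.End F M)
    (he : ρ (DegAffBMW.e ω 1 ⟨le_rfl, hn⟩) ≠ 0) : DegAffBMWHasModule n hn ω := by
  let _ : Module (DegAffBMW n ω) M := Module.compHom M ρ.toRingHom
  refine ⟨M, _, _, _, ⟨fun a x m => ?_⟩, ‹_›, ?_⟩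
  · change ρ (a • x) m = a • ρ x m
    rw [map_smul, LinearMap.smul_apply]
  · by_contra! h
    exact he (LinearMap.ext h)

/-- Independence of the powers of `y_1` on `e_1`, when the roots `u` are those of the generator of
the annihilator of the moment functional, or when the sequence is zero and `u = (0, 0)`. -/
theorem admissible_of_e_ne_zero {r : ℕ} {u : Fin r → F}
    (he : DegCycBMW.e (n := 2) ω u 1 (by decide) ≠ 0)
    (h : (∀ g : F[X], g.degree < r → (∀ f, moment ω (f * g) = 0) → g = 0) ∨
      r = 2 ∧ u = 0 ∧ ω 0 = 0) : DegBMWAdmissible ω u := by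
  rw [DegBMWAdmissible, Fintype.linearIndependent_iff]
  intro c hc
  set e := DegCycBMW.e (n := 2) ω u 1 (by decide)
  set y := DegCycBMW.y (n := 2) ω u 1 (by decide)
  rcases h with hmin | ⟨rfl, rfl, hω⟩
  · have hg : aeval y (∑ k : Fin r, C (c k) * X ^ (k : ℕ)) * e = 0 := by
      rw [← hc, map_sum, Finset.sum_mul]
      refine Finset.sum_congr rfl fun k _ => ?_
      rw [map_mul, aeval_C, map_pow, aeval_X, ← Algebra.smul_def, smul_mul_assoc]
    have h0 := hmin _ (degree_sum_fin_lt c)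
      (moment_mul_eq_zero he (DegCycBMW.e_mul_y_pow_mul_e _ _) hg)
    intro k
    have := congrArg (fun p : F[X] => p.coeff k) h0
    simpa [finsetSum_coeff, coeff_X_pow, Fin.val_inj] using this
  · have hy2 : y * y = 0 := by
      have := DegCycBMW.aeval_y (n := 2) (ω := ω) (u := (0 : Fin 2 → F)) (by decide)
      simpa [pow_two] using this
    have hye : y * e ≠ 0 :=
      ((DegAffBMW.twoStrandRel (n := 2) (by decide) (by decide) (by decide)).map
        (DegCycBMW.mk ω 0)).y_mul_e_ne_zero he hω
    simp only [Fin.sum_univ_two, Fin.val_zero, Fin.val_one, pow_zero, pow_one, one_mul] at hc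
    have h0 : c 0 = 0 := by
      have h1 := congrArg (y * ·) hc
      simp only [mul_add, mul_smul_comm, ← mul_assoc, hy2, zero_mul, smul_zero, add_zero,
        mul_zero] at h1
      exact (smul_eq_zero.1 h1).resolve_right hye
    rw [h0, zero_smul, zero_add] at hc
    have h1 := (smul_eq_zero.1 hc).resolve_right hye
    exact Fin.forall_fin_two.2 ⟨h0, h1⟩

/-- A nonzero `e_1` and a recurrence give both admissible parameters and a finite-dimensional
module: the representation on coloured matchings is used for two strands and for `n` strands. -/
theorem admissible_and_hasModule [IsAlgClosed F] (hn : 2 ≤ n)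
    (he : DegAffBMW.e (n := n) ω 1 ⟨le_rfl, hn⟩ ≠ 0) {Q : F[X]} (hQ : Q ≠ 0)
    (h : ∀ f, moment ω (f * Q) = 0) :
    (∃ r : ℕ, 0 < r ∧ ∃ u : Fin r → F, DegBMWAdmissible ω u) ∧ DegAffBMWHasModule n hn ω := by
  obtain ⟨r, u, hr, hω, hind⟩ := exists_jmMoment_eq hQ h
    ((DegAffBMW.twoStrandRel ⟨le_rfl, hn⟩ ⟨le_rfl, by omega⟩ ⟨by omega, hn⟩).moment_symm he)
  constructor
  · obtain ⟨M, _, _, _, ρ, hρe, hρy⟩ := exists_representation (n := 2) hr hω (by decide) (by decide)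
    have h1 : DegCycBMW.e (n := 2) ω u 1 (by decide) ≠ 0 :=
      DegCycBMW.e_ne_zero_of_hom ρ (by decide) (by decide) hρy hρe
    exact ⟨r, hr, u, admissible_of_e_ne_zero h1 hind⟩
  · obtain ⟨M, _, _, _, ρ, hρe, -⟩ :=
      exists_representation (n := n) hr hω ⟨le_rfl, hn⟩ ⟨le_rfl, by omega⟩
    exact hasModule_of_representation hn ρ hρe

end modules

end

theorem mainTheorem5 {F : Type u} [Field F] [IsAlgClosed F] (n : ℕ) (hn : 2 ≤ n) (ω : ℕ → F)
    (he : DegAffBMW.e (n := n) ω 1 ⟨le_rfl, hn⟩ ≠ 0) :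
    List.TFAE [
      ∃ f : RatFunc F, expandAtInfinity F f = genFunAtInfinity ω,
      ∃ r : ℕ, 0 < r ∧ ∃ (N : ℕ) (a : Fin r → F),
        ∀ l : ℕ, N ≤ l → ω (r + l) + ∑ j : Fin r, a j * ω (j + l) = 0,
      ∃ r : ℕ, 0 < r ∧ ∃ a : Fin r → F,
        ∀ l : ℕ, ω (r + l) + ∑ j : Fin r, a j * ω (j + l) = 0,
      ∃ r : ℕ, 0 < r ∧ ∃ u : Fin r → F, DegBMWAdmissible ω u,
      DegAffBMWHasModule n hn ω] := by
  have recurrence : (∃ Q : F[X], Q ≠ 0 ∧ ∀ f, DegBMWPoly.moment ω (f * Q) = 0) →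
      ∃ r : ℕ, 0 < r ∧ ∃ a : Fin r → F,
        ∀ l : ℕ, ω (r + l) + ∑ j : Fin r, a j * ω (j + l) = 0 := by
    rintro ⟨Q, hQ, h⟩
    obtain ⟨r, hr, a, ha⟩ := exists_recurrence hQ (N := 0) fun l _ => h _
    exact ⟨r, hr, a, fun l => ha l (Nat.zero_le l)⟩
  tfae_have 1 → 2 := by
    rintro ⟨f, hf⟩
    obtain ⟨Q, hQ, h⟩ := exists_recurrence_of_rational hf
    obtain ⟨r, hr, a, ha⟩ := exists_recurrence hQ h
    exact ⟨r, hr, 1, a, ha⟩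
  tfae_have 2 → 3 := by
    rintro ⟨r, hr, N, a, ha⟩
    exact recurrence (exists_annihilator ha)
  tfae_have 3 → 1 := by
    rintro ⟨r, hr, a, ha⟩
    obtain ⟨Q, hQ, h⟩ := exists_annihilator (N := 0) fun l _ => ha l
    exact rational_of_annihilator hQ h
  tfae_have 3 → 4 := by
    rintro ⟨r, hr, a, ha⟩
    obtain ⟨Q, hQ, h⟩ := exists_annihilator (N := 0) fun l _ => ha l
    exact (admissible_and_hasModule hn he hQ h).1
  tfae_have 3 → 5 := by
    rintro ⟨r, hr, a, ha⟩
    obtain ⟨Q, hQ, h⟩ := exists_annihilator (N := 0) fun l _ => ha l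
    exact (admissible_and_hasModule hn he hQ h).2
  tfae_have 4 → 3 := by
    rintro ⟨r, hr, u, hu⟩
    exact recurrence (exists_annihilator_of_admissible hr hu)
  tfae_have 5 → 3 := fun h => recurrence (exists_annihilator_of_hasModule hn h)
  tfae_finish
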